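/- **Setting.** Let $d,N\ge 1$, let $\zeta$ be a random variable with values in a measurable space $\Xi$, let $f:\mathbb R^d\times\Xi\to\mathbb R$ and $F(x)=\mathbb E_\zeta[f(x,\zeta)]$ (with $f(x,\zeta)$ integrable for each $x$). Assume that $F$ is twice continuously differentiable and bounded below, $F^*:=\inf F$; that for every $\zeta$ the function $f(\cdot,\zeta)$ is twice continuously differentiable with $L_f$-Lipschitz gradient and $M_f$-Lipschitz Hessian; that $\nabla F$ and $\nabla^2F$ are Lipschitz with constants $L_F>0$ and $M_F>0$, $M_F\le M_f$; and that for some $\beta_1,\beta_2\ge 0$, $\mathbb E_\zeta\|\nabla f(x,\zeta)-\nabla F(x)\|^2\le\beta_1\|\nabla F(x)\|^2+\beta_2$ for all $x$. Let $\theta>0$, $\epsilon>0$, $p\in(0,1]$, $x_0\in\mathbb R^d$. **Methods.** Each of five methods draws directions $T=(u_1,\dots,u_N)$ and uses a scaling $\gamma$: cFD: $N=d$, $u_j=e_j$, $\gamma=1$; cGS: $u_j$ i.i.d. $\mathcal N(0,I)$, $\gamma=1/N$; cSS: $u_j$ i.i.d. uniform on the unit sphere, $\gamma=d/N$; cRC: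 $N\le d$ distinct canonical vectors chosen uniformly at random, $\gamma=d/N$; cRS: $u_1,\dots,u_N$ random orthonormal vectors with $\mathbb E\sum_ju_ju_j^T=\frac Nd I$ (for example uniformly distributed orthonormal frames), $\gamma=d/N$. For a sample set $S$ let $F_S=\frac1{|S|}\sum_{\zeta_i\in S}f(\cdot,\zeta_i)$ and $$g_{S,T}(x)=\gamma\sum_{j=1}^N\frac{F_S(x+\nu u_j)-F_S(x-\nu u_j)}{2\nu}\,u_j,\qquad g_{\zeta,T}=g_{\{\zeta\},T},\qquad g_T(x)=\mathbb E_\zeta[g_{\zeta,T}(x)].$$ With $\Omega_1=\frac1{4(1+\theta^2)L_F}$ and $\Omega_3=\big(\frac{6\epsilon p}{M_F^2d}\big)^{1/4}$ take the step size $\bar\alpha$ and the sampling radius $\nu=\hat\nu$ to be - cFD: $\bar\alpha=\Omega_1$, $\hat\nu=\Omega_3$; - cGS: $\bar\alpha=\frac{N}{N+4.5d}\Omega_1$, $\hat\nu=\Big(\frac{2(N+4.5d)}{72Nd+216d^2+(d+2)(d+4)(d+6)}\Big)^{1/4}\Omega_3$; - cSS: $\bar\alpha=\frac{N}{N+4.5d}\Omega_1$,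 $\hat\nu=\Big(\frac{2d(N+4.5d)}{72N+216d+d^2}\Big)^{1/4}\Omega_3$; - cRC and cRS: $\bar\alpha=\frac Nd\Omega_1$, $\hat\nu=\Omega_3$. Let $x_{k+1}=x_k-\bar\alpha\,g_{S_k,T_k}(x_k)$, where at iteration $k$ the size $|S_k|\ge1$ is determined by the past, $S_k$ consists of $|S_k|$ i.i.d. copies of $\zeta$, and $T_k$ has the law of the method, $T_k$ and the samples being independent of each other and of the past. Suppose that, as long as no $\epsilon$-accurate iterate has been reached (that is, $\|\nabla F(x_j)\|^2>\epsilon$ for all $j\le k$), the norm condition holds: $$\frac{\mathbb E_{T}\big[\mathbb E_{\zeta}\|g_{\zeta,T}(x_k)-g_{T}(x_k)\|^2\big]}{|S_k|}\le\theta^2\,\mathbb E_{T}\big[\|g_{T}(x_k)\|^2\big].\qquad(\ast)$$ **Theorem (Complexity Results).** Put $K_\epsilon=\frac{8(F(x_0)-F^*)}{\epsilon p\bar\alpha}$. 1. For every integer $K\ge\max(1,K_\epsilon)$, with probability at least $1-p$ there is $k\le K-1$ with $\|\nabla F(x_k)\|^2\le\epsilon$. 2. Suppose moreover that, as long as no $\epsilon$-accurate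 iterate has been reached, $|S_k|$ is the smallest positive integer satisfying $(\ast)$. Then, with probability at least $1-p$, there is $k\le K_\epsilon$ with $\|\nabla F(x_k)\|^2\le\epsilon$ such that the number of stochastic function evaluations used to reach $x_k$ satisfies $$\sum_{j<k}2N|S_j|\ \le\ W_\epsilon:=2NK_\epsilon\Big(b_1+\frac{4b_2}{\epsilon}\Big),$$ where, with $\nu=\hat\nu$, - cFD, cRC, cRS: $b_1=1+\frac{4\beta_1}{\theta^2}$, $b_2=\frac{(2+\beta_1)M_f^2\nu^4d}{9\theta^2}+\frac{2\beta_2}{\theta^2}$; - cGS: $b_1=1+\frac{4(d+2)\beta_1}{\theta^2}$, $b_2=\frac{2(d+2)\beta_2+2M_f^2\nu^4d(d+2)\left[\frac19(d+4)(d+6)+2\beta_1d\right]}{\theta^2}$; - cSS: $b_1=1+\frac{4d\beta_1}{\theta^2}$, $b_2=\frac{2d\beta_2+2dM_f^2\nu^4\left(\frac d9+2\beta_1\right)}{\theta^2}$. 3. As $\epsilon\to0^+$ with all other data fixed, $K_\epsilon=\mathcal O(\epsilon^{-1})$ and $W_\epsilon=\mathcal O(\epsilon^{-2})$. Moreover there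 is a constant $C$ depending only on $\theta$ such that, for all the data above, $b_1\le C\,B_1$, $b_2\le C\,B_2$, $K_\epsilon\le C\,(F(x_0)-F^*)\,\mathcal K$ and, if $\epsilon\le1$, $W_\epsilon\le C\,(F(x_0)-F^*)(1+\beta_1+\beta_2)\frac{M_f^2}{M_F^2}\,\mathcal W$, where - cFD: $B_1=1+\beta_1$, $B_2=(1+\beta_1)M_f^2\nu^4d+\beta_2$, $\mathcal K=\frac{L_F}{\epsilon p}$, $\mathcal W=\frac{L_Fd}{\epsilon^2p}$; - cGS: $B_1=(1+\beta_1)d$, $B_2=(\beta_1+d)M_f^2\nu^4d^3+\beta_2d$, $\mathcal K=\frac{L_F}{\epsilon p}\frac{N+d}{N}$, $\mathcal W=\frac{L_Fd(N+d)}{\epsilon^2p}+\frac{L_F(N+d)^2d^2}{\epsilon(N+d^2)}$; - cSS: $B_1=(1+\beta_1)d$, $B_2=(\beta_1+d)M_f^2\nu^4d+\beta_2d$, $\mathcal K$ and $\mathcal W$ as for cGS; - cRC, cRS: $B_1,B_2,\mathcal W$ as for cFD, $\mathcal K=\frac{L_F}{\epsilon p}\frac dN$. -/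

import Mathlib

open MeasureTheory ProbabilityTheory Filter Topology Asymptotics
open scoped Gradient ENNReal

noncomputable section

namespace CentralFD

/-- `ℝ^d` with the Euclidean norm. -/
abbrev Vec (d : ℕ) := EuclideanSpace ℝ (Fin d)

/-- The five central finite-difference gradient estimation methods. -/
inductive Method
  | cFD
  | cGS
  | cSS
  | cRC
  | cRS

/-! ### Problem data -/

section Problem

variable {d : ℕ} {Ξ : Type*} [MeasurableSpace Ξ]

/-- The objective `F x = E_ζ [f (x, ζ)]`, where `ζ` has law `μ`. -/
def objective (μ : Measure Ξ) (f : Vec d → Ξ → ℝ) (x : Vec d) : ℝ := ∫ z, f x z ∂μ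

/-- `h` has a gradient that is Lipschitz with constant `L`. -/
def GradLipschitz (h : Vec d → ℝ) (L : ℝ) : Prop :=
  ∀ x y, ‖∇ h x - ∇ h y‖ ≤ L * ‖x - y‖

/-- `h` has a Hessian (the derivative of its gradient, in operator norm) that is Lipschitz with
constant `M`. -/
def HessLipschitz (h : Vec d → ℝ) (M : ℝ) : Prop :=
  ∀ x y, ‖fderiv ℝ (∇ h) x - fderiv ℝ (∇ h) y‖ ≤ M * ‖x - y‖

/-- Standing assumptions on the stochastic function and the objective: the values `f (x, ζ)` are
random variables with finite mean; `F` is `C²` and bounded below; every `f (·, ζ)` is `C²` with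
`Lf`-Lipschitz gradient and `Mf`-Lipschitz Hessian. -/
structure SmoothAssumption (μ : Measure Ξ) (f : Vec d → Ξ → ℝ) (Lf Mf : ℝ) : Prop where
  measurable : ∀ x, Measurable (f x)
  integrable : ∀ x, Integrable (f x) μ
  contDiff_objective : ContDiff ℝ 2 (objective μ f)
  bddBelow : BddBelow (Set.range (objective μ f))
  contDiff : ∀ z, ContDiff ℝ 2 (fun x => f x z)
  gradLipschitz : ∀ z, GradLipschitz (fun x => f x z) Lf
  hessLipschitz : ∀ z, HessLipschitz (fun x => f x z) Mf

/-- Bounded variance of the stochastic gradients: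
`E ‖∇f(x, ζ) - ∇F(x)‖² ≤ β₁ ‖∇F(x)‖² + β₂` (the expectation being finite). -/
def VarianceAssumption (μ : Measure Ξ) (f : Vec d → Ξ → ℝ) (β₁ β₂ : ℝ) : Prop :=
  ∀ x, Integrable (fun z => ‖∇ (fun y => f y z) x - ∇ (objective μ f) x‖ ^ 2) μ ∧
    ∫ z, ‖∇ (fun y => f y z) x - ∇ (objective μ f) x‖ ^ 2 ∂μ
      ≤ β₁ * ‖∇ (objective μ f) x‖ ^ 2 + β₂

end Problem

/-! ### Directions and gradient estimators -/

/-- The scaling coefficient `γ` of the method when `N` directions are used in `ℝ^d`. -/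
def scaling : Method → ℕ → ℕ → ℝ
  | .cFD, _, _ => 1
  | .cGS, _, N => 1 / N
  | .cSS, d, N => d / N
  | .cRC, d, N => d / N
  | .cRS, d, N => d / N

/-- The uniform distribution on the unit sphere of `ℝ^d`, as a measure on `ℝ^d`: the normalized
surface measure. -/
def uniformSphere (d : ℕ) : Measure (Vec d) :=
  (((volume : Measure (Vec d)).toSphere Set.univ)⁻¹ • (volume : Measure (Vec d)).toSphere).map
    Subtype.val

/-- `IsDirectionLaw m d N τ`: `τ` is the law of the `N` directions `T = (u_1, …, u_N)` used by the
method `m` in one iteration.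
* `cFD`: the canonical basis, `N = d`.
* `cGS`: i.i.d. standard normal vectors.
* `cSS`: i.i.d. uniform vectors on the unit sphere.
* `cRC`: `N ≤ d` distinct canonical vectors, chosen uniformly at random.
* `cRS`: random orthonormal vectors, spanning an isotropic random subspace:
  `E ∑_j ⟪u_j, v⟫² = (N / d) ‖v‖²` for all `v`, that is `E [U Uᵀ] = (N / d) I`. This contains the
  uniform (Haar) orthonormal `N`-frames as well as `N` vectors drawn uniformly without replacement
  from a random orthonormal basis. -/
def IsDirectionLaw : Method → (d N : ℕ) → Measure (Fin N → Vec d) → Prop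
  | .cFD, d, N, τ => ∃ h : N = d,
      τ = Measure.dirac (fun j => EuclideanSpace.single (Fin.cast h j) (1 : ℝ))
  | .cGS, d, N, τ => τ = Measure.pi (fun _ : Fin N => stdGaussian (Vec d))
  | .cSS, d, N, τ => τ = Measure.pi (fun _ : Fin N => uniformSphere d)
  | .cRC, d, N, τ => N ≤ d ∧
      τ = (Fintype.card (Fin N ↪ Fin d) : ℝ≥0∞)⁻¹ •
        ∑ σ : Fin N ↪ Fin d, Measure.dirac (fun j => EuclideanSpace.single (σ j) (1 : ℝ))
  | .cRS, d, N, τ => IsProbabilityMeasure τ ∧ (∀ᵐ u ∂τ, Orthonormal ℝ u) ∧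
      ∀ v : Vec d, ∫ u, ∑ j, (inner ℝ (u j) v) ^ 2 ∂τ = (N / d : ℝ) * ‖v‖ ^ 2

section Estimators

variable {d N : ℕ} {Ξ : Type*} [MeasurableSpace Ξ]

/-- The central finite-difference estimator
`γ ∑_j ((h (x + ν u_j) - h (x - ν u_j)) / (2 ν)) u_j`. -/
def centralDiff (γ ν : ℝ) (h : Vec d → ℝ) (x : Vec d) (u : Fin N → Vec d) : Vec d :=
  γ • ∑ j, ((h (x + ν • u j) - h (x - ν • u j)) / (2 * ν)) • u j

/-- The subsampled function `F_S x = (1 / n) ∑_{i < n} f (x, ζ_i)`, `S = {ζ_0, …, ζ_{n-1}}`. -/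
def batchMean (f : Vec d → Ξ → ℝ) (n : ℕ) (ζ : ℕ → Ξ) (x : Vec d) : ℝ :=
  (1 / n : ℝ) * ∑ i ∈ Finset.range n, f x (ζ i)

/-- The gradient estimator `g_{S,T}(x)`. -/
def batchEst (f : Vec d → Ξ → ℝ) (γ ν : ℝ) (n : ℕ) (ζ : ℕ → Ξ) (x : Vec d) (u : Fin N → Vec d) :
    Vec d :=
  centralDiff γ ν (batchMean f n ζ) x u

/-- The single-sample gradient estimator `g_{ζ,T}(x)`. -/
def sampleEst (f : Vec d → Ξ → ℝ) (γ ν : ℝ) (z : Ξ) (x : Vec d) (u : Fin N → Vec d) : Vec d :=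
  centralDiff γ ν (fun y => f y z) x u

/-- `g_T(x)`: the expectation of the estimator over the samples with the directions fixed (for
i.i.d. samples it is the same for every sample size). -/
def meanEst (μ : Measure Ξ) (f : Vec d → Ξ → ℝ) (γ ν : ℝ) (x : Vec d) (u : Fin N → Vec d) :
    Vec d :=
  ∫ z, sampleEst f γ ν z x u ∂μ

/-- `E_T [ E_ζ [ ‖g_{ζ,T}(x) - g_T(x)‖² ] ]`. -/
def sampleVariance (μ : Measure Ξ) (τ : Measure (Fin N → Vec d)) (f : Vec d → Ξ → ℝ) (γ ν : ℝ)
    (x : Vec d) : ℝ :=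
  ∫ u, ∫ z, ‖sampleEst f γ ν z x u - meanEst μ f γ ν x u‖ ^ 2 ∂μ ∂τ

/-- The theoretical norm condition at `x` for the sample size `n`:
`E_T [ E_ζ [ ‖g_{ζ,T}(x) - g_T(x)‖² ] ] / n ≤ θ² E_T [ ‖g_T(x)‖² ]`. -/
def NormCondition (μ : Measure Ξ) (τ : Measure (Fin N → Vec d)) (f : Vec d → Ξ → ℝ) (γ ν θ : ℝ)
    (x : Vec d) (n : ℕ) : Prop :=
  sampleVariance μ τ f γ ν x / n ≤ θ ^ 2 * ∫ u, ‖meanEst μ f γ ν x u‖ ^ 2 ∂τ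

end Estimators

/-! ### The algorithm -/

/-- A run of `x_{k+1} = x_k - α g_{S_k,T_k}(x_k)` from the point `x₀`. Here `ℱ k` is the
information available before iteration `k`, `T k` are the directions (with law `τ`), `ζ k` is an
i.i.d. stream of realizations of `ζ` (with law `μ`) from which the first `n k ≥ 1` form `S_k`. The
sample size `n k` is chosen from the information in `ℱ k`; the directions and the stream of
iteration `k` are independent of each other and of `ℱ k`. -/
structure IsRun {d N : ℕ} {Ξ Ω : Type*} [MeasurableSpace Ξ] {mΩ : MeasurableSpace Ω}
    (P : Measure Ω) (μ : Measure Ξ) (τ : Measure (Fin N → Vec d)) (f : Vec d → Ξ → ℝ)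
    (γ ν α : ℝ) (x₀ : Vec d) (ℱ : Filtration ℕ mΩ) (T : ℕ → Ω → Fin N → Vec d)
    (ζ : ℕ → Ω → ℕ → Ξ) (n : ℕ → Ω → ℕ) (x : ℕ → Ω → Vec d) : Prop where
  init : ∀ ω, x 0 ω = x₀
  step : ∀ k ω, x (k + 1) ω = x k ω - α • batchEst f γ ν (n k ω) (ζ k ω) (x k ω) (T k ω)
  one_le_size : ∀ k ω, 1 ≤ n k ω
  measurable_size : ∀ k, Measurable[ℱ k] (n k)
  measurable_dir : ∀ k, Measurable[ℱ (k + 1)] (T k)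
  measurable_stream : ∀ k, Measurable[ℱ (k + 1)] (ζ k)
  law : ∀ k, P.map (fun ω => (T k ω, ζ k ω)) = τ.prod (Measure.infinitePi fun _ : ℕ => μ)
  indep : ∀ k, Indep (ℱ k)
    (MeasurableSpace.comap (fun ω => (T k ω, ζ k ω)) inferInstance) P

/-- No iterate up to index `k` satisfies `‖∇F(x_j)‖² ≤ ε`. -/
def NotYetAccurate {d : ℕ} {Ω : Type*} (F : Vec d → ℝ) (ε : ℝ) (x : ℕ → Ω → Vec d) (k : ℕ)
    (ω : Ω) : Prop :=
  ∀ j ≤ k, ε < ‖∇ F (x j ω)‖ ^ 2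

/-! ### Parameters -/

/-- The step size `ᾱ`, with `Ω₁ = 1 / (4 (1 + θ²) L_F)`. -/
def stepSize (m : Method) (d N : ℕ) (θ LF : ℝ) : ℝ :=
  let Ω₁ : ℝ := 1 / (4 * (1 + θ ^ 2) * LF)
  match m with
  | .cFD => Ω₁
  | .cGS => N / (N + 4.5 * d) * Ω₁
  | .cSS => N / (N + 4.5 * d) * Ω₁
  | .cRC => N / d * Ω₁
  | .cRS => N / d * Ω₁

/-- The sampling radius `ν̂`, with `Ω₃ = (6 ε p / (M_F² d)) ^ (1/4)`. -/
def radius (m : Method) (d N : ℕ) (MF ε p : ℝ) : ℝ :=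
  let Ω₃ : ℝ := (6 * ε * p / (MF ^ 2 * d)) ^ (1 / 4 : ℝ)
  match m with
  | .cFD => Ω₃
  | .cGS => (2 * (N + 4.5 * d) /
      (72 * N * d + 216 * d ^ 2 + (d + 2) * (d + 4) * (d + 6))) ^ (1 / 4 : ℝ) * Ω₃
  | .cSS => (2 * d * (N + 4.5 * d) / (72 * N + 216 * d + d ^ 2)) ^ (1 / 4 : ℝ) * Ω₃
  | .cRC => Ω₃
  | .cRS => Ω₃

/-- The constant `b₁`. -/
def b₁ (m : Method) (d : ℕ) (θ β₁ : ℝ) : ℝ :=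
  match m with
  | .cFD | .cRC | .cRS => 1 + 4 * β₁ / θ ^ 2
  | .cGS => 1 + 4 * (d + 2) * β₁ / θ ^ 2
  | .cSS => 1 + 4 * d * β₁ / θ ^ 2

/-- The constant `b₂`. -/
def b₂ (m : Method) (d : ℕ) (θ Mf β₁ β₂ ν : ℝ) : ℝ :=
  match m with
  | .cFD | .cRC | .cRS => (2 + β₁) * Mf ^ 2 * ν ^ 4 * d / (9 * θ ^ 2) + 2 * β₂ / θ ^ 2
  | .cGS => (2 * (d + 2) * β₂ + 2 * Mf ^ 2 * ν ^ 4 * d * (d + 2) *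
      (1 / 9 * (d + 4) * (d + 6) + 2 * β₁ * d)) / θ ^ 2
  | .cSS => (2 * d * β₂ + 2 * d * Mf ^ 2 * ν ^ 4 * (d / 9 + 2 * β₁)) / θ ^ 2

/-- The iteration complexity `K_ε = 8 (F(x₀) - F*) / (ε p ᾱ)`, where `Δ = F(x₀) - F*`. -/
def iterComplexity (m : Method) (d N : ℕ) (θ LF Δ p ε : ℝ) : ℝ :=
  8 * Δ / (ε * p * stepSize m d N θ LF)

/-- The bound `2 N K_ε (b₁ + 4 b₂ / ε)` on the sample complexity, with `ν = ν̂` in `b₂`. -/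
def evalComplexity (m : Method) (d N : ℕ) (θ LF MF Mf β₁ β₂ Δ p ε : ℝ) : ℝ :=
  2 * N * iterComplexity m d N θ LF Δ p ε *
    (b₁ m d θ β₁ + 4 * b₂ m d θ Mf β₁ β₂ (radius m d N MF ε p) / ε)

/-! ### Orders of magnitude -/

/-- The order of `b₁`. -/
def b₁Order (m : Method) (d : ℕ) (β₁ : ℝ) : ℝ :=
  match m with
  | .cFD | .cRC | .cRS => 1 + β₁
  | .cGS | .cSS => (1 + β₁) * d

/-- The order of `b₂`. -/
def b₂Order (m : Method) (d : ℕ) (Mf β₁ β₂ ν : ℝ) : ℝ :=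
  match m with
  | .cFD | .cRC | .cRS => (1 + β₁) * Mf ^ 2 * ν ^ 4 * d + β₂
  | .cGS => (β₁ + d) * Mf ^ 2 * ν ^ 4 * d ^ 3 + β₂ * d
  | .cSS => (β₁ + d) * Mf ^ 2 * ν ^ 4 * d + β₂ * d

/-- The order of the iteration complexity. -/
def iterOrder (m : Method) (d N : ℕ) (LF p ε : ℝ) : ℝ :=
  match m with
  | .cFD => LF / (ε * p)
  | .cGS | .cSS => LF / (ε * p) * ((N + d) / N)
  | .cRC | .cRS => LF / (ε * p) * (d / N)

/-- The order of the sample complexity. -/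
def evalOrder (m : Method) (d N : ℕ) (LF p ε : ℝ) : ℝ :=
  match m with
  | .cFD | .cRC | .cRS => LF * d / (ε ^ 2 * p)
  | .cGS | .cSS => LF * d * (N + d) / (ε ^ 2 * p) +
      LF * (N + d) ^ 2 * d ^ 2 / (ε * (N + d ^ 2))

end CentralFD

end

noncomputable section

namespace CentralFD

/-! ### Taylor estimates -/

section Calculus

variable {d : ℕ} {h : Vec d → ℝ}

/-! The proof is a stochastic descent argument for the potential `F - F*`. Given the past, `g_{S,T}`
has mean `E_T[g_T]` and second moment `E_T‖g_T‖²` plus the sampling variance divided by `|S|`; the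
norm condition bounds this by `(1 + θ²) E_T‖g_T‖²`. With `α = ρ / (4 (1 + θ²) L_F)` the descent
lemma bounds the expected change of the potential by `α (-⟪∇F, E g_T⟫ + (ρ/8) E‖g_T‖²)`. Where
`‖∇F‖² > ε`, the bracket is at most `-‖∇F‖²/8`, so a step loses at least `αε/8`
(`SmoothAssumption.lintegral_step_add_le`). Let `A_k` be the event that no iterate up to `k` is
accurate. Telescoping over these decreasing events gives `(k+1) (αε/8) P(A_k) ≤ F(x₀) - F*`
(`IsRun.mul_prob_notYetAccurate_le`), whence the bound `K_ε`.

It remains to estimate `g_T`, which is the central-difference estimator of `F` itself. A difference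
quotient along `u` is `⟪∇h, u⟫ + r(u)` with `|r(u)| ≤ M ν² ‖u‖³ / 6` (`abs_remainder_le`). For
orthonormal directions, `‖g_T‖²` is a sum of squares and everything is estimated direction by
direction (`directionBounds_of_orthonormal`); cFD and cRC are instances of cRS. For independent
directions, the mean and the second moment of a single-direction estimator suffice
(`directionBounds_pi`). A pointwise bound on `r` would lose a factor `√d` in the bias. Instead `u`
is paired with its reflection in the hyperplane orthogonal to a test vector
(`abs_inner_mul_remainder_sub_reflection_le`), which leaves a fourth-moment integral of size `d` for
the Gaussian law and, after scaling, at most `1` for the sphere. The radius `ν̂` makes all these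
errors a fixed fraction of `ε`.

For the sample sizes, `E‖g_T‖²` is bounded below by `λ‖∇F‖²`, and the sampling variance above by
comparing each `g_{ζ,T}` with the linear estimator of `∇F`, so that only `∇f - ∇F` and the remainder
enter. A minimal size `n ≥ 2` makes `n - 1` violate the norm condition, hence `n ≤ b₁ + 4 b₂/ε`
(`SmoothAssumption.size_le`). Since `ν̂⁴` is proportional to `ε`, the part of `b₂/ε` coming from
`ν̂` does not depend on `ε`; the order estimates are then elementary. -/

lemma gradient_eq_symm_fderiv :
    ∇ h = fun x => (InnerProductSpace.toDual ℝ (Vec d)).symm (fderiv ℝ h x) := rfl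

lemma contDiff_gradient (hC : ContDiff ℝ 2 h) : ContDiff ℝ 1 (∇ h) := by
  rw [gradient_eq_symm_fderiv]
  exact (InnerProductSpace.toDual ℝ (Vec d)).symm.contDiff.comp
    (hC.fderiv_right (m := 1) (by norm_num))

lemma hasFDerivAt_gradient (hC : ContDiff ℝ 2 h) (x : Vec d) :
    HasFDerivAt (∇ h) (fderiv ℝ (∇ h) x) x :=
  ((contDiff_gradient hC).differentiable (by norm_num) x).hasFDerivAt

lemma hasDerivAt_comp_line (hC : ContDiff ℝ 2 h) (x v : Vec d) (t : ℝ) :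
    HasDerivAt (fun s : ℝ => h (x + s • v)) (inner ℝ (∇ h (x + t • v)) v) t := by
  have h1 : HasFDerivAt h (InnerProductSpace.toDual ℝ _ (∇ h (x + t • v))) (x + t • v) :=
    ((hC.differentiable (by norm_num)) _).hasGradientAt
  have h2 : HasDerivAt (fun s : ℝ => x + s • v) v t := by
    simpa using ((hasDerivAt_id t).smul_const v).const_add x
  exact (h1.comp_hasDerivAt t h2).congr_deriv (InnerProductSpace.toDual_apply_apply)

lemma hasDerivAt_gradient_comp_line (hC : ContDiff ℝ 2 h) (x v : Vec d) (t : ℝ) :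
    HasDerivAt (fun s : ℝ => ∇ h (x + s • v)) (fderiv ℝ (∇ h) (x + t • v) v) t := by
  have h2 : HasDerivAt (fun s : ℝ => x + s • v) v t := by
    simpa using ((hasDerivAt_id t).smul_const v).const_add x
  exact (hasFDerivAt_gradient hC (x + t • v)).comp_hasDerivAt t h2

/-- Mean value inequality in comparison form; each Taylor estimate below takes an explicit
polynomial for `B`. -/
lemma norm_le_of_hasDerivAt {E : Type*} [NormedAddCommGroup E] [NormedSpace ℝ E]
    {g g' : ℝ → E} {B B' : ℝ → ℝ} (hg : ∀ t, HasDerivAt g (g' t) t)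
    (hB : ∀ t, HasDerivAt B (B' t) t) (h0 : ‖g 0‖ ≤ B 0) (hb : ∀ t, 0 ≤ t → ‖g' t‖ ≤ B' t)
    {t : ℝ} (ht : 0 ≤ t) : ‖g t‖ ≤ B t :=
  image_norm_le_of_norm_deriv_right_le_deriv_boundary (a := 0) (b := t)
    (fun s _ => (hg s).continuousAt.continuousWithinAt)
    (fun s _ => (hg s).hasDerivWithinAt) h0 hB (fun s hs => hb s hs.1) ⟨ht, le_rfl⟩

/-- The descent lemma. -/
lemma le_add_inner_add_of_gradLipschitz (hC : ContDiff ℝ 2 h) {L : ℝ} (hL : GradLipschitz h L)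
    (x v : Vec d) : h (x + v) ≤ h x + inner ℝ (∇ h x) v + L / 2 * ‖v‖ ^ 2 := by
  have key := norm_le_of_hasDerivAt (g := fun t => h (x + t • v) - h x - t * inner ℝ (∇ h x) v)
    (g' := fun t => inner ℝ (∇ h (x + t • v)) v - inner ℝ (∇ h x) v)
    (B := fun t => L / 2 * ‖v‖ ^ 2 * t ^ 2) (B' := fun t => L * ‖v‖ ^ 2 * t)
    (fun t => by
      exact (((hasDerivAt_comp_line hC x v t).sub_const (h x)).sub
        ((hasDerivAt_id t).mul_const (inner ℝ (∇ h x) v))).congr_deriv (by ring))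
    (fun t => by
      exact ((hasDerivAt_pow 2 t).const_mul (L / 2 * ‖v‖ ^ 2)).congr_deriv
        (by push_cast; ring))
    (by simp)
    (fun t ht => by
      rw [← inner_sub_left]
      calc _ ≤ ‖∇ h (x + t • v) - ∇ h x‖ * ‖v‖ := norm_inner_le_norm _ _
        _ ≤ (L * ‖(x + t • v) - x‖) * ‖v‖ := by gcongr; exact hL _ _
        _ = _ := by
          rw [add_sub_cancel_left, norm_smul, Real.norm_of_nonneg ht]; ring)
    zero_le_one
  have := (le_abs_self _).trans key
  simp only [one_smul, one_mul, one_pow, mul_one] at this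
  linarith

/-- The second symmetric difference of the gradient. -/
lemma norm_gradient_add_gradient_sub_le (hC : ContDiff ℝ 2 h) {M : ℝ} (hM : HessLipschitz h M)
    (x y : Vec d) : ‖∇ h (x + y) + ∇ h (x - y) - (2 : ℝ) • ∇ h x‖ ≤ M * ‖y‖ ^ 2 := by
  have key := norm_le_of_hasDerivAt
    (g := fun t : ℝ => ∇ h (x + t • y) + ∇ h (x + t • -y) - (2 : ℝ) • ∇ h x)
    (g' := fun t => fderiv ℝ (∇ h) (x + t • y) y + fderiv ℝ (∇ h) (x + t • -y) (-y))
    (B := fun t => M * ‖y‖ ^ 2 * t ^ 2) (B' := fun t => 2 * M * ‖y‖ ^ 2 * t)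
    (fun t => ((hasDerivAt_gradient_comp_line hC x y t).add
        (hasDerivAt_gradient_comp_line hC x (-y) t)).sub_const _)
    (fun t => by
      exact ((hasDerivAt_pow 2 t).const_mul (M * ‖y‖ ^ 2)).congr_deriv (by push_cast; ring))
    (by simp [two_smul])
    (fun t ht => by
      rw [map_neg, ← sub_eq_add_neg, ← sub_apply]
      calc _ ≤ ‖fderiv ℝ (∇ h) (x + t • y) - fderiv ℝ (∇ h) (x + t • -y)‖ * ‖y‖ :=
            ContinuousLinearMap.le_opNorm _ _
        _ ≤ (M * ‖(x + t • y) - (x + t • -y)‖) * ‖y‖ := by gcongr; exact hM _ _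
        _ = _ := by
          have : (x + t • y) - (x + t • -y) = (2 * t) • y := by module
          rw [this, norm_smul, Real.norm_of_nonneg (by positivity)]; ring)
    zero_le_one
  simpa [sub_eq_add_neg] using key

/-- The error of the central difference as an approximation of the directional derivative. -/
def remainder (h : Vec d → ℝ) (ν : ℝ) (x u : Vec d) : ℝ :=
  (h (x + ν • u) - h (x - ν • u)) / (2 * ν) - inner ℝ (∇ h x) u

lemma remainder_neg (ν : ℝ) (x u : Vec d) : remainder h ν x (-u) = -remainder h ν x u := by
  simp only [remainder, smul_neg, sub_neg_eq_add, ← sub_eq_add_neg, inner_neg_right]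
  ring

/-- Differentiating in the direction rather than in `ν` produces a second symmetric difference of
the gradient, which the Hessian bound makes of order `ν²`. -/
lemma hasDerivAt_remainder (hC : ContDiff ℝ 2 h) {ν : ℝ} (hν : 0 < ν) (x w v : Vec d) (t : ℝ) :
    HasDerivAt (fun s : ℝ => remainder h ν x (w + s • v))
      (inner ℝ (∇ h (x + ν • (w + t • v)) + ∇ h (x - ν • (w + t • v)) - (2 : ℝ) • ∇ h x) v / 2)
      t := by
  have h1 := hasDerivAt_comp_line hC (x + ν • w) (ν • v) t
  have h2 := hasDerivAt_comp_line hC (x - ν • w) (-(ν • v)) t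
  have h3 : HasDerivAt (fun s : ℝ => inner ℝ (∇ h x) w + s * inner ℝ (∇ h x) v)
      (inner ℝ (∇ h x) v) t := by
    simpa using ((hasDerivAt_id t).mul_const (inner ℝ (∇ h x) v)).const_add (inner ℝ (∇ h x) w)
  have h4 := ((h1.sub h2).div_const (2 * ν)).sub h3
  have e1 : ∀ s : ℝ, x + ν • w + s • ν • v = x + ν • (w + s • v) := fun s => by module
  have e2 : ∀ s : ℝ, x - ν • w + s • -(ν • v) = x - ν • (w + s • v) := fun s => by module
  have e3 : (fun s : ℝ => remainder h ν x (w + s • v)) =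
      ((fun s : ℝ => h (x + ν • w + s • ν • v)) - fun s : ℝ => h (x - ν • w + s • -(ν • v))) /
      (fun _ => 2 * ν) - fun s : ℝ => inner ℝ (∇ h x) w + s * inner ℝ (∇ h x) v := by
    ext s
    simp only [remainder, Pi.sub_apply, Pi.div_apply, e1, e2, inner_add_right, inner_smul_right]
  rw [e3]
  refine h4.congr_deriv ?_
  rw [e1, e2]
  simp only [inner_neg_right, inner_add_left, inner_sub_left, inner_smul_left, inner_smul_right,
    conj_trivial]
  field_simp
  ring

lemma norm_add_smul_sq {w v : Vec d} (hv : ‖v‖ = 1) (hw : inner ℝ w v = 0) (t : ℝ) :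
    ‖w + t • v‖ ^ 2 = ‖w‖ ^ 2 + t ^ 2 := by
  rw [norm_add_sq_real, inner_smul_right, hw, norm_smul, hv]
  simp

/-- The two points are mirror images in the hyperplane orthogonal to `v` and coincide at `s = 0`, so
it suffices to integrate the derivative of the remainder along both branches. Each contributes half
of `M ν² (‖w‖² + t²)`, since `w` is orthogonal to `v`. -/
lemma abs_remainder_sub_le (hC : ContDiff ℝ 2 h) {M : ℝ} (hM : HessLipschitz h M) {ν : ℝ}
    (hν : 0 < ν) (x : Vec d) {w v : Vec d} (hv : ‖v‖ = 1) (hw : inner ℝ w v = 0) {s : ℝ}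
    (hs : 0 ≤ s) :
    |remainder h ν x (w + s • v) - remainder h ν x (w + s • -v)| ≤
      M * ν ^ 2 * (‖w‖ ^ 2 * s + s ^ 3 / 3) := by
  have bound : ∀ t : ℝ, ∀ z : Vec d, ‖z‖ = 1 → inner ℝ w z = 0 →
      |inner ℝ (∇ h (x + ν • (w + t • z)) + ∇ h (x - ν • (w + t • z)) - (2 : ℝ) • ∇ h x) z / 2|
        ≤ M * ν ^ 2 * (‖w‖ ^ 2 + t ^ 2) / 2 := by
    intro t z hz hwz
    rw [abs_div, abs_two]
    gcongr
    refine (abs_real_inner_le_norm _ _).trans ?_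
    rw [hz, mul_one]
    calc _ ≤ M * ‖ν • (w + t • z)‖ ^ 2 := norm_gradient_add_gradient_sub_le hC hM _ _
      _ = _ := by
        rw [norm_smul, mul_pow, norm_add_smul_sq hz hwz, Real.norm_of_nonneg hν.le]; ring
  have key := norm_le_of_hasDerivAt
    (g := fun s : ℝ => remainder h ν x (w + s • v) - remainder h ν x (w + s • -v))
    (B := fun s => M * ν ^ 2 * (‖w‖ ^ 2 * s + s ^ 3 / 3))
    (B' := fun s => M * ν ^ 2 * (‖w‖ ^ 2 + s ^ 2))
    (fun t => (hasDerivAt_remainder hC hν x w v t).sub (hasDerivAt_remainder hC hν x w (-v) t))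
    (fun t => by
      exact ((((hasDerivAt_id t).const_mul (‖w‖ ^ 2)).add
        ((hasDerivAt_pow 3 t).div_const 3)).const_mul (M * ν ^ 2)).congr_deriv
          (by push_cast; ring))
    (by simp)
    (fun t _ => by
      have h1 := bound t v hv hw
      have h2 := bound t (-v) (by simpa using hv) (by simpa using hw)
      refine (norm_sub_le _ _).trans ?_
      simp only [Real.norm_eq_abs]
      linarith)
    hs
  exact key

/-- The case `w = 0` of the previous estimate: the remainder is odd, so the difference is twice its
value and `1/3` becomes `1/6`. -/
lemma abs_remainder_le (hC : ContDiff ℝ 2 h) {M : ℝ} (hM : HessLipschitz h M) {ν : ℝ}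
    (hν : 0 < ν) (x u : Vec d) : |remainder h ν x u| ≤ M * ν ^ 2 / 6 * ‖u‖ ^ 3 := by
  rcases eq_or_ne u 0 with rfl | hu
  · simp [remainder]
  have hu' : ‖u‖ ≠ 0 := norm_ne_zero_iff.2 hu
  have := abs_remainder_sub_le hC hM hν x (w := 0) (v := (‖u‖)⁻¹ • u)
    (by rw [norm_smul, norm_inv, norm_norm, inv_mul_cancel₀ hu']) (by simp) (norm_nonneg u)
  rw [smul_neg, smul_smul, mul_inv_cancel₀ hu', one_smul, zero_add, zero_add, remainder_neg,
    sub_neg_eq_add, ← two_mul, abs_mul, abs_two, norm_zero] at this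
  linarith

/-- Reflecting the direction in the hyperplane orthogonal to a unit vector. -/
lemma abs_inner_mul_remainder_sub_reflection_le (hC : ContDiff ℝ 2 h) {M : ℝ}
    (hM : HessLipschitz h M) {ν : ℝ} (hν : 0 < ν) (x u : Vec d) {v : Vec d} (hv : ‖v‖ = 1) :
    |inner ℝ u v * (remainder h ν x u - remainder h ν x (u - (2 * inner ℝ u v) • v))| ≤
      M * ν ^ 2 * (inner ℝ u v ^ 2 * ‖u‖ ^ 2 - 2 / 3 * inner ℝ u v ^ 4) := by
  have hvv : inner ℝ v v = (1 : ℝ) := by rw [real_inner_self_eq_norm_sq, hv, one_pow]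
  obtain ⟨w, s, rfl, hw⟩ : ∃ (w : Vec d) (s : ℝ), u = w + s • v ∧ inner ℝ w v = 0 := by
    refine ⟨u - (inner ℝ u v : ℝ) • v, inner ℝ u v, by simp, ?_⟩
    rw [inner_sub_left, inner_smul_left, hvv]; simp
  have hi : inner ℝ (w + s • v) v = s := by
    rw [inner_add_left, hw, inner_smul_left, hvv]; simp
  have he : w + s • v - (2 * s) • v = w + s • -v := by module
  -- With `‖u‖² = ‖w‖² + s²`, the product `s (‖w‖² s + s³/3)` equals `s² ‖u‖² - (2/3) s⁴`. For `s ≤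
  -- 0` the two mirror points exchange roles.
  rw [hi, he, norm_add_smul_sq hv hw, abs_mul]
  rcases le_total 0 s with hs | hs
  · have := abs_remainder_sub_le hC hM hν x hv hw hs
    rw [abs_of_nonneg hs]
    calc _ ≤ s * _ := mul_le_mul_of_nonneg_left this hs
      _ = _ := by ring
  · have := abs_remainder_sub_le hC hM hν x hv hw (neg_nonneg.2 hs)
    rw [abs_of_nonpos hs, abs_sub_comm]
    have e1 : w + s • v = w + (-s) • -v := by module
    have e2 : w + s • -v = w + (-s) • v := by module
    rw [e1, e2]
    calc _ ≤ (-s) * _ := mul_le_mul_of_nonneg_left this (neg_nonneg.2 hs)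
      _ = _ := by ring

end Calculus

/-! ### Sums of independent random variables -/

section IndependentSums

variable {Ω : Type*} [MeasurableSpace Ω] {P : Measure Ω}

/-- By independence each off-diagonal inner product integrates to `⟪e, e⟫`. This serves both the
independent directions and the i.i.d. samples. -/
lemma integral_norm_sum_sq_of_indepFun {E : Type*} [NormedAddCommGroup E] [InnerProductSpace ℝ E]
    [CompleteSpace E] [MeasurableSpace E] [BorelSpace E]
    [IsProbabilityMeasure P] {ι : Type*} (s : Finset ι) {X : ι → Ω → E}
    (hX : ∀ i ∈ s, MemLp (X i) 2 P) (hind : ∀ i ∈ s, ∀ j ∈ s, i ≠ j → IndepFun (X i) (X j) P)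
    {e : E} (he : ∀ i ∈ s, ∫ ω, X i ω ∂P = e) {q : ℝ} (hq : ∀ i ∈ s, ∫ ω, ‖X i ω‖ ^ 2 ∂P = q) :
    ∫ ω, ‖∑ i ∈ s, X i ω‖ ^ 2 ∂P = s.card * q + s.card * (s.card - 1) * ‖e‖ ^ 2 := by
  classical
  have hint : ∀ i ∈ s, ∀ j ∈ s, Integrable (fun ω => inner ℝ (X i ω) (X j ω)) P := by
    intro i hi j hj
    refine ((hX i hi).norm.integrable_mul (hX j hj).norm).mono
      ((hX i hi).1.inner (hX j hj).1) (Eventually.of_forall fun ω => ?_)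
    simpa using norm_inner_le_norm (𝕜 := ℝ) (X i ω) (X j ω)
  have h1 : ∀ ω, ‖∑ i ∈ s, X i ω‖ ^ 2 = ∑ i ∈ s, ∑ j ∈ s, inner ℝ (X i ω) (X j ω) := by
    intro ω
    rw [← real_inner_self_eq_norm_sq, sum_inner]
    simp_rw [inner_sum]
  simp_rw [h1]
  rw [integral_finsetSum _ fun i hi => integrable_finsetSum _ fun j hj => hint i hi j hj]
  have h2 : ∀ i ∈ s, ∫ ω, ∑ j ∈ s, inner ℝ (X i ω) (X j ω) ∂P = q + (s.card - 1) * ‖e‖ ^ 2 := by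
    intro i hi
    rw [integral_finsetSum _ fun j hj => hint i hi j hj, ← Finset.add_sum_erase _ _ hi]
    congr 1
    · simp_rw [real_inner_self_eq_norm_sq]; exact hq i hi
    · rw [Finset.sum_congr rfl (g := fun _ => ‖e‖ ^ 2)]
      · rw [Finset.sum_const, Finset.card_erase_of_mem hi, nsmul_eq_mul,
          Nat.cast_sub (Finset.card_pos.2 ⟨i, hi⟩), Nat.cast_one]
      · intro j hj
        have hij : i ≠ j := (Finset.ne_of_mem_erase hj).symm
        have hj' := Finset.mem_of_mem_erase hj
        have := (hind i hi j hj' hij).integral_bilin ((hX i hi).integrable (by norm_num))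
          ((hX j hj').integrable (by norm_num)) (innerSL ℝ)
        rw [he i hi, he j hj'] at this
        rw [← real_inner_self_eq_norm_sq]
        exact this
  rw [Finset.sum_congr rfl h2, Finset.sum_const, nsmul_eq_mul]
  ring

lemma integral_pow_mul_pow_of_indepFun {X Y : Ω → ℝ} (h : IndepFun X Y P)
    (hX : AEMeasurable X P) (hY : AEMeasurable Y P) (a b : ℕ) :
    ∫ ω, X ω ^ a * Y ω ^ b ∂P = (∫ ω, X ω ^ a ∂P) * ∫ ω, Y ω ^ b ∂P :=
  (h.comp (measurable_id.pow_const a) (measurable_id.pow_const b)).integral_fun_mul_eq_mul_integral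
    (hX.pow_const a).aestronglyMeasurable (hY.pow_const b).aestronglyMeasurable

lemma MemLp.integrable_pow_le [IsFiniteMeasure P] {X : Ω → ℝ} {n : ℕ} (hX : MemLp X n P) {k : ℕ}
    (hk : k ≤ n) : Integrable (fun ω => X ω ^ k) P := by
  have h1 : MemLp X k P := hX.mono_exponent (by exact_mod_cast hk)
  have := h1.integrable_norm_pow' (p := k)
  refine this.mono (h1.1.pow k) (Eventually.of_forall fun ω => ?_)
  simp

/-- The first four moments of the chi-squared distributions, as moments of sums of independent
variables. -/
lemma moments_sum_of_iIndepFun [IsProbabilityMeasure P] {ι : Type*} {X : ι → Ω → ℝ}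
    (hm : ∀ i, Measurable (X i)) (hX : ∀ i, MemLp (X i) 4 P) (hind : iIndepFun X P)
    (h1 : ∀ i, ∫ ω, X i ω ∂P = 1) (h2 : ∀ i, ∫ ω, X i ω ^ 2 ∂P = 3)
    (h3 : ∀ i, ∫ ω, X i ω ^ 3 ∂P = 15) (h4 : ∀ i, ∫ ω, X i ω ^ 4 ∂P = 105) (s : Finset ι) :
    (∫ ω, ∑ i ∈ s, X i ω ∂P = s.card) ∧
    (∫ ω, (∑ i ∈ s, X i ω) ^ 2 ∂P = s.card * (s.card + 2)) ∧
    (∫ ω, (∑ i ∈ s, X i ω) ^ 3 ∂P = s.card * (s.card + 2) * (s.card + 4)) ∧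
    (∫ ω, (∑ i ∈ s, X i ω) ^ 4 ∂P = s.card * (s.card + 2) * (s.card + 4) * (s.card + 6)) := by
  classical
  induction s using Finset.induction_on with
  | empty => simp
  | insert i s hi ih =>
    obtain ⟨i1, i2, i3, i4⟩ := ih
    set S : Ω → ℝ := fun ω => ∑ j ∈ s, X j ω with hS
    have hSm : Measurable S := Finset.measurable_fun_sum s fun j _ => hm j
    have hSL : MemLp S 4 P := memLp_finsetSum s fun j _ => hX j
    have hin : IndepFun S (X i) P := by
      have := hind.indepFun_finsetSum_of_notMem hm hi
      convert this using 1
      ext ω; simp [hS]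
    have hi' := fun a b => integral_pow_mul_pow_of_indepFun hin hSm.aemeasurable
      (hm i).aemeasurable a b
    have hS' : ∀ k ≤ 4, Integrable (fun ω => S ω ^ k) P := fun k hk =>
      MemLp.integrable_pow_le (n := 4) (by exact_mod_cast hSL) hk
    have hX' : ∀ k ≤ 4, Integrable (fun ω => X i ω ^ k) P := fun k hk =>
      MemLp.integrable_pow_le (n := 4) (by exact_mod_cast hX i) hk
    have hp : ∀ a ≤ 4, ∀ b ≤ 4, Integrable (fun ω => S ω ^ a * X i ω ^ b) P := fun a ha b hb =>
      (hin.comp (measurable_id.pow_const a) (measurable_id.pow_const b)).integrable_mul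
        (hS' a ha) (hX' b hb)
    have hs1 : ∫ ω, S ω ^ 1 ∂P = s.card := by simpa using i1
    have hx1 : ∫ ω, X i ω ^ 1 ∂P = 1 := by simpa using h1 i
    replace i2 : ∫ ω, S ω ^ 2 ∂P = s.card * (s.card + 2) := i2
    replace i3 : ∫ ω, S ω ^ 3 ∂P = s.card * (s.card + 2) * (s.card + 4) := i3
    replace i4 : ∫ ω, S ω ^ 4 ∂P = s.card * (s.card + 2) * (s.card + 4) * (s.card + 6) := i4
    have hs0 : ∫ ω, S ω ^ 0 ∂P = 1 := by simp
    have hx0 : ∫ ω, X i ω ^ 0 ∂P = 1 := by simp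
    simp_rw [Finset.sum_insert hi, Finset.card_insert_of_notMem hi, Nat.cast_add, Nat.cast_one]
    change (∫ ω, X i ω + S ω ∂P = _) ∧ (∫ ω, (X i ω + S ω) ^ 2 ∂P = _) ∧
      (∫ ω, (X i ω + S ω) ^ 3 ∂P = _) ∧ (∫ ω, (X i ω + S ω) ^ 4 ∂P = _)
    -- Binomial expansion with factorizing mixed moments. The third moment is carried in the
    -- induction only because the fourth needs it.
    have key : ∀ k ≤ 4, ∫ ω, (X i ω + S ω) ^ k ∂P =
        ∑ m ∈ Finset.range (k + 1), (∫ ω, S ω ^ m ∂P) * (∫ ω, X i ω ^ (k - m) ∂P) * k.choose m := by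
      intro k hk
      simp_rw [add_comm (X i _), add_pow]
      rw [integral_finsetSum]
      · refine Finset.sum_congr rfl fun m hm => ?_
        rw [integral_mul_const, hi']
      · intro m hm
        exact (hp m (by grind) (k - m) (by omega)).mul_const _
    have k1 := key 1 (by norm_num)
    simp only [pow_one] at k1
    refine ⟨?_, ?_, ?_, ?_⟩
    · rw [k1]; simp [Finset.sum_range_succ, i1, h1]; ring
    · rw [key 2 (by norm_num)]; simp [Finset.sum_range_succ, i1, i2, h1, h2]; ring
    · rw [key 3 (by norm_num)]
      simp [Finset.sum_range_succ, i1, i2, i3, h1, h2, h3, Nat.choose]; ring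
    · rw [key 4 (by norm_num)]
      simp [Finset.sum_range_succ, i1, i2, i3, i4, h1, h2, h3, h4, Nat.choose]; ring

end IndependentSums

/-! ### Moments of the standard normal distribution -/

section GaussianMoments

open Polynomial in
/-- The polynomial factor of the `n`-th derivative of `t ↦ exp (t ^ 2 / 2)`. -/
def gaussianMomentPoly : ℕ → ℝ[X]
  | 0 => 1
  | n + 1 => derivative (gaussianMomentPoly n) + X * gaussianMomentPoly n

lemma iteratedDeriv_exp_sq_div_two (n : ℕ) :
    iteratedDeriv n (fun t : ℝ => Real.exp (t ^ 2 / 2)) =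
      fun t => (gaussianMomentPoly n).eval t * Real.exp (t ^ 2 / 2) := by
  induction n with
  | zero => simp [gaussianMomentPoly]
  | succ n ih =>
    rw [iteratedDeriv_succ, ih]
    ext t
    have h1 : HasDerivAt (fun t : ℝ => Real.exp (t ^ 2 / 2)) (Real.exp (t ^ 2 / 2) * t) t :=
      (((hasDerivAt_pow 2 t).div_const 2).exp).congr_deriv (by push_cast; ring)
    refine (((gaussianMomentPoly n).hasDerivAt t).mul h1).deriv.trans ?_
    simp [gaussianMomentPoly]
    ring

/-- The moment is the `n`-th derivative at `0` of the moment generating function `exp (t² / 2)`,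
whose exponential factor is `1` there. -/
lemma integral_pow_gaussianReal (n : ℕ) :
    ∫ x, x ^ n ∂gaussianReal 0 1 = (gaussianMomentPoly n).coeff 0 := by
  have h := iteratedDeriv_mgf_zero (X := fun x : ℝ => x) (μ := gaussianReal 0 1)
    (by simp) n
  have e : mgf (fun x : ℝ => x) (gaussianReal 0 1) = fun t => Real.exp (t ^ 2 / 2) := by
    rw [mgf_fun_id_gaussianReal]; ext t; simp
  rw [e, iteratedDeriv_exp_sq_div_two] at h
  simp only [Pi.pow_apply] at h
  rw [← h, Polynomial.coeff_zero_eq_eval_zero]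
  simp

lemma moments_gaussianReal :
    (∫ x, x ^ 2 ∂gaussianReal 0 1 = (1 : ℝ)) ∧ (∫ x, x ^ 4 ∂gaussianReal 0 1 = (3 : ℝ)) ∧
    (∫ x, x ^ 6 ∂gaussianReal 0 1 = (15 : ℝ)) ∧ (∫ x, x ^ 8 ∂gaussianReal 0 1 = (105 : ℝ)) := by
  have h0 : ∀ n, (gaussianMomentPoly (n + 1)).coeff 0 = (gaussianMomentPoly n).coeff 1 := by
    intro n; simp [gaussianMomentPoly, Polynomial.coeff_derivative]
  have hs : ∀ n k, (gaussianMomentPoly (n + 1)).coeff (k + 1) =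
      (gaussianMomentPoly n).coeff (k + 2) * (k + 2) + (gaussianMomentPoly n).coeff k := by
    intro n k
    simp [gaussianMomentPoly, Polynomial.coeff_derivative, add_assoc]; norm_num
  have hz : ∀ k, (gaussianMomentPoly 0).coeff k = if k = 0 then 1 else 0 := by
    intro k; simp [gaussianMomentPoly, Polynomial.coeff_one]
  refine ⟨?_, ?_, ?_, ?_⟩ <;> rw [integral_pow_gaussianReal] <;> norm_num [h0, hs, hz]

end GaussianMoments

/-! ### Isotropic laws -/

section Isotropic

variable {d : ℕ}

/-- A probability law on `ℝ^d` that is invariant under linear isometries and has finite moments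
up to order eight. -/
structure IsIsotropic (σ : Measure (Vec d)) : Prop where
  isProbabilityMeasure : IsProbabilityMeasure σ
  map_eq : ∀ e : Vec d ≃ₗᵢ[ℝ] Vec d, σ.map e = σ
  integrable : Integrable (fun u => ‖u‖ ^ 8) σ

lemma pow_le_one_add_pow {t : ℝ} (ht : 0 ≤ t) {k n : ℕ} (hk : k ≤ n) : t ^ k ≤ 1 + t ^ n := by
  rcases le_total t 1 with h | h
  · have := pow_le_one₀ (n := k) ht h
    have := pow_nonneg ht n
    linarith
  · have := pow_le_pow_right₀ h hk
    linarith

/-- A continuous function of growth at most `‖u‖ ^ 8` is integrable. -/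
lemma integrable_of_norm_le {E : Type*} [NormedAddCommGroup E]
    {σ : Measure (Vec d)} [IsProbabilityMeasure σ]
    (hσ : Integrable (fun u => ‖u‖ ^ 8) σ) {φ : Vec d → E} (hφ : Continuous φ) (C : ℝ) {k : ℕ}
    (hk : k ≤ 8) (hb : ∀ u, ‖φ u‖ ≤ C * ‖u‖ ^ k) : Integrable φ σ := by
  refine (((integrable_const 1).add hσ).const_mul |C|).mono' hφ.aestronglyMeasurable
    (Eventually.of_forall fun u => (hb u).trans ?_)
  calc C * ‖u‖ ^ k ≤ |C| * ‖u‖ ^ k := by gcongr; exact le_abs_self C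
    _ ≤ _ := by
      gcongr
      exact pow_le_one_add_pow (norm_nonneg u) hk

namespace IsIsotropic

variable {σ : Measure (Vec d)}

lemma integral_comp (hσ : IsIsotropic σ) (e : Vec d ≃ₗᵢ[ℝ] Vec d) (φ : Vec d → ℝ) :
    ∫ u, φ (e u) ∂σ = ∫ u, φ u ∂σ :=
  MeasurePreserving.integral_comp ⟨e.continuous.measurable, hσ.map_eq e⟩
    e.toHomeomorph.measurableEmbedding φ

lemma integrable_norm_pow (hσ : IsIsotropic σ) {k : ℕ} (hk : k ≤ 8) :
    Integrable (fun u => ‖u‖ ^ k) σ := by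
  have := hσ.isProbabilityMeasure
  exact integrable_of_norm_le hσ.integrable (by fun_prop) 1 hk (fun u => by simp)

lemma integrable_inner_pow_mul (hσ : IsIsotropic σ) (v : Vec d) {a k : ℕ} (hk : a + k ≤ 8) :
    Integrable (fun u => inner ℝ u v ^ a * ‖u‖ ^ k) σ := by
  have := hσ.isProbabilityMeasure
  refine integrable_of_norm_le hσ.integrable (by fun_prop) (‖v‖ ^ a) hk (fun u => ?_)
  rw [norm_mul, norm_pow, norm_pow, norm_norm, pow_add]
  calc ‖inner ℝ u v‖ ^ a * ‖u‖ ^ k ≤ (‖u‖ * ‖v‖) ^ a * ‖u‖ ^ k := by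
        gcongr; exact norm_inner_le_norm _ _
    _ = _ := by ring

/-- The reflection that sends `v` to `w` preserves the law and carries one integrand to the other.
-/
lemma integral_inner_sq_mul_eq_of_norm_eq (hσ : IsIsotropic σ) {v w : Vec d} (h : ‖v‖ = ‖w‖)
    (k : ℕ) : ∫ u, inner ℝ u v ^ 2 * ‖u‖ ^ k ∂σ = ∫ u, inner ℝ u w ^ 2 * ‖u‖ ^ k ∂σ := by
  have h1 := hσ.integral_comp (Submodule.reflection (ℝ ∙ (v - w))ᗮ)
    (fun u => inner ℝ u w ^ 2 * ‖u‖ ^ k)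
  rw [← h1]
  congr 1
  ext u
  rw [LinearIsometryEquiv.norm_map]
  rw [← LinearIsometryEquiv.inner_map_map (Submodule.reflection (ℝ ∙ (v - w))ᗮ) u v,
    Submodule.reflection_sub h]

/-- The integral depends on `v` only through its norm, so it can be averaged over the canonical
basis, where the squared coordinates add up to `‖u‖²`. -/
lemma integral_inner_sq_mul (hσ : IsIsotropic σ) (hd : 1 ≤ d) (v : Vec d) {k : ℕ} (hk : k ≤ 6) :
    ∫ u, inner ℝ u v ^ 2 * ‖u‖ ^ k ∂σ = ‖v‖ ^ 2 / d * ∫ u, ‖u‖ ^ (k + 2) ∂σ := by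
  have hd' : (d : ℝ) ≠ 0 := by positivity
  have h1 : ∀ i : Fin d, ∫ u, inner ℝ u v ^ 2 * ‖u‖ ^ k ∂σ =
      ‖v‖ ^ 2 * ∫ u, inner ℝ u (EuclideanSpace.single i (1 : ℝ)) ^ 2 * ‖u‖ ^ k ∂σ := by
    intro i
    rw [hσ.integral_inner_sq_mul_eq_of_norm_eq (w := ‖v‖ • EuclideanSpace.single i (1 : ℝ))
      (by simp [norm_smul]), ← integral_const_mul]
    congr 1
    ext u
    rw [inner_smul_right]; ring
  have h2 : (d : ℝ) * ∫ u, inner ℝ u v ^ 2 * ‖u‖ ^ k ∂σ = ‖v‖ ^ 2 * ∫ u, ‖u‖ ^ (k + 2) ∂σ := by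
    calc (d : ℝ) * ∫ u, inner ℝ u v ^ 2 * ‖u‖ ^ k ∂σ
        = ∑ i : Fin d, ∫ u, inner ℝ u v ^ 2 * ‖u‖ ^ k ∂σ := by simp
      _ = ∑ i : Fin d, ‖v‖ ^ 2 *
            ∫ u, inner ℝ u (EuclideanSpace.single i (1 : ℝ)) ^ 2 * ‖u‖ ^ k ∂σ :=
          Finset.sum_congr rfl fun i _ => h1 i
      _ = ‖v‖ ^ 2 * ∫ u, ‖u‖ ^ (k + 2) ∂σ := by
          rw [← Finset.mul_sum, ← integral_finsetSum _
            (fun i _ => hσ.integrable_inner_pow_mul _ (by omega))]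
          congr 2
          ext u
          rw [← Finset.sum_mul, pow_add, mul_comm, EuclideanSpace.norm_sq_eq u]
          congr 1
          exact Finset.sum_congr rfl fun i _ => by simp [EuclideanSpace.inner_single_right]
  field_simp
  linarith

lemma integrable_inner_smul (hσ : IsIsotropic σ) (v : Vec d) :
    Integrable (fun u => (inner ℝ v u : ℝ) • u) σ := by
  have := hσ.isProbabilityMeasure
  refine integrable_of_norm_le hσ.integrable (by fun_prop) ‖v‖ (k := 2) (by norm_num) (fun u => ?_)
  rw [norm_smul]
  calc _ ≤ ‖v‖ * ‖u‖ * ‖u‖ := by gcongr; exact norm_inner_le_norm _ _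
    _ = _ := by ring

/-- Polarization: the bilinear form `E ⟪v,u⟫⟪w,u⟫` is recovered from the quadratic one at `v + w`
and `v - w`. -/
lemma integral_inner_smul (hσ : IsIsotropic σ) (hd : 1 ≤ d) (v : Vec d) :
    ∫ u, (inner ℝ v u : ℝ) • u ∂σ = ((∫ u, ‖u‖ ^ 2 ∂σ) / d) • v := by
  refine ext_inner_right ℝ fun w => ?_
  have h1 : ∀ z : Vec d, ∫ u, inner ℝ u z ^ 2 ∂σ = ‖z‖ ^ 2 / d * ∫ u, ‖u‖ ^ 2 ∂σ := fun z => by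
    simpa using hσ.integral_inner_sq_mul hd z (k := 0) (by norm_num)
  have h2 : ∀ z : Vec d, Integrable (fun u => inner ℝ u z ^ 2) σ := fun z => by
    simpa using hσ.integrable_inner_pow_mul z (a := 2) (k := 0) (by norm_num)
  rw [real_inner_comm, ← integral_inner (hσ.integrable_inner_smul v)]
  calc ∫ u, inner ℝ w ((inner ℝ v u : ℝ) • u) ∂σ
      = ∫ u, (inner ℝ u (v + w) ^ 2 - inner ℝ u (v - w) ^ 2) / 4 ∂σ := by
        congr 1; ext u
        rw [inner_smul_right, inner_add_right, inner_sub_right, real_inner_comm u v,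
          real_inner_comm u w]
        ring
    _ = (‖v + w‖ ^ 2 / d * ∫ u, ‖u‖ ^ 2 ∂σ - ‖v - w‖ ^ 2 / d * ∫ u, ‖u‖ ^ 2 ∂σ) / 4 := by
        rw [integral_div, integral_sub (h2 _) (h2 _), h1, h1]
    _ = _ := by
        rw [norm_add_sq_real, norm_sub_sq_real, inner_smul_left]
        simp only [conj_trivial]
        ring

lemma continuous_remainder {h : Vec d → ℝ} (hC : Continuous h) (ν : ℝ) (x : Vec d) :
    Continuous (remainder h ν x) := by
  unfold remainder
  fun_prop

/-- By the symmetry of the law, the bias of the estimator is of the order of the fourth moments. -/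
lemma abs_integral_remainder_mul_inner_le (hσ : IsIsotropic σ) {h : Vec d → ℝ}
    (hC : ContDiff ℝ 2 h) {M : ℝ} (hM : HessLipschitz h M) {ν : ℝ} (hν : 0 < ν) (x : Vec d)
    {v : Vec d} (hv : ‖v‖ = 1) :
    |∫ u, remainder h ν x u * inner ℝ u v ∂σ| ≤
      M * ν ^ 2 / 2 * ∫ u, (inner ℝ u v ^ 2 * ‖u‖ ^ 2 - 2 / 3 * inner ℝ u v ^ 4) ∂σ := by
  have := hσ.isProbabilityMeasure
  have hcr := continuous_remainder hC.continuous ν x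
  have hR : ∀ u : Vec d, Submodule.reflection (ℝ ∙ v)ᗮ u = u - (2 * inner ℝ u v) • v := by
    intro u
    rw [Submodule.reflection_orthogonal_apply, Submodule.reflection_singleton_apply, hv,
      real_inner_comm]
    simp only [RCLike.ofReal_real_eq_id, id, one_pow, div_one]
    module
  have hint : Integrable (fun u => remainder h ν x u * inner ℝ u v) σ := by
    refine integrable_of_norm_le hσ.integrable (by fun_prop) (M * ν ^ 2 / 6) (k := 4) (by norm_num)
      (fun u => ?_)
    rw [norm_mul]
    calc ‖remainder h ν x u‖ * ‖inner ℝ u v‖ ≤ (M * ν ^ 2 / 6 * ‖u‖ ^ 3) * (‖u‖ * ‖v‖) :=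
          mul_le_mul (abs_remainder_le hC hM hν x u) (norm_inner_le_norm _ _) (norm_nonneg _)
            ((abs_nonneg _).trans (abs_remainder_le hC hM hν x u))
      _ = _ := by rw [hv]; ring
  have hvv : inner ℝ v v = (1 : ℝ) := by rw [real_inner_self_eq_norm_sq, hv, one_pow]
  have hint2 : Integrable
      (fun u => remainder h ν x (u - (2 * inner ℝ u v) • v) * inner ℝ u v) σ := by
    have := (MeasurePreserving.integrable_comp_emb
      ⟨(Submodule.reflection (ℝ ∙ v)ᗮ).continuous.measurable, hσ.map_eq _⟩
      (Submodule.reflection (ℝ ∙ v)ᗮ).toHomeomorph.measurableEmbedding).2 hint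
    refine this.neg.congr (Eventually.of_forall fun u => ?_)
    simp only [Pi.neg_apply, Function.comp_apply, hR, inner_sub_left, inner_smul_left, hvv,
      conj_trivial]
    ring
  -- The reflection `u'` of `u` has the same law and `⟪u', v⟫ = -⟪u, v⟫`. Hence twice the integral
  -- is that of `⟪u, v⟫ (r(u) - r(u'))`, to which the reflection estimate applies.
  have h1 : ∫ u, remainder h ν x u * inner ℝ u v ∂σ =
      -∫ u, remainder h ν x (u - (2 * inner ℝ u v) • v) * inner ℝ u v ∂σ := by
    rw [← hσ.integral_comp (Submodule.reflection (ℝ ∙ v)ᗮ), ← integral_neg]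
    congr 1
    ext u
    rw [hR, inner_sub_left, inner_smul_left, hvv]
    simp only [conj_trivial]
    ring
  have h2 : 2 * ∫ u, remainder h ν x u * inner ℝ u v ∂σ = ∫ u, inner ℝ u v *
      (remainder h ν x u - remainder h ν x (u - (2 * inner ℝ u v) • v)) ∂σ := by
    rw [two_mul]
    nth_rewrite 2 [h1]
    rw [← sub_eq_add_neg, ← integral_sub hint hint2]
    congr 1
    ext u
    ring
  have h3 : |2 * ∫ u, remainder h ν x u * inner ℝ u v ∂σ| ≤
      ∫ u, M * ν ^ 2 * (inner ℝ u v ^ 2 * ‖u‖ ^ 2 - 2 / 3 * inner ℝ u v ^ 4) ∂σ := by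
    rw [h2]
    refine norm_integral_le_of_norm_le (f := fun u => inner ℝ u v *
      (remainder h ν x u - remainder h ν x (u - (2 * inner ℝ u v) • v))) (g := fun u => M * ν ^ 2 *
      (inner ℝ u v ^ 2 * ‖u‖ ^ 2 - 2 / 3 * inner ℝ u v ^ 4)) ?_ (Eventually.of_forall fun u =>
      abs_inner_mul_remainder_sub_reflection_le hC hM hν x u hv)
    refine ((hσ.integrable_inner_pow_mul v (by norm_num)).sub (Integrable.const_mul ?_ _)).const_mul _
    simpa using hσ.integrable_inner_pow_mul v (a := 4) (k := 0) (by norm_num)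
  rw [abs_mul, abs_two, integral_const_mul] at h3
  linarith

end IsIsotropic

/-- Moment bounds for an isotropic law, scaled by `c` so that `c E [u uᵀ] = I`. -/
structure MomentBounds (σ : Measure (Vec d)) (c κ e t : ℝ) : Prop extends IsIsotropic σ where
  pos : 0 < c
  second : c * ∫ u, ‖u‖ ^ 2 ∂σ = d
  fourth : c ^ 2 * ∫ u, ‖u‖ ^ 4 ∂σ = κ * d
  eighth : c ^ 2 * ∫ u, ‖u‖ ^ 8 ∂σ = e
  bias : ∀ v : Vec d, ‖v‖ = 1 →
    c * ∫ u, (inner ℝ u v ^ 2 * ‖u‖ ^ 2 - 2 / 3 * inner ℝ u v ^ 4) ∂σ ≤ t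

/-- Here `‖u‖²` is a sum of `d` independent squared normals, whose first four moments are `1, 3, 15,
105`. -/
lemma moments_norm_stdGaussian (d : ℕ) :
    (∫ u, ‖u‖ ^ 2 ∂stdGaussian (Vec d) = d) ∧ (∫ u, ‖u‖ ^ 4 ∂stdGaussian (Vec d) = d * (d + 2)) ∧
    (∫ u, ‖u‖ ^ 8 ∂stdGaussian (Vec d) = d * (d + 2) * (d + 4) * (d + 6)) ∧
    Integrable (fun u => ‖u‖ ^ 8) (stdGaussian (Vec d)) := by
  have hL : ∀ i : Fin d, MemLp (fun x : Fin d → ℝ => x i ^ 2) 4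
      (Measure.pi fun _ : Fin d => gaussianReal 0 1) := by
    intro i
    have h1 : MemLp (fun x : ℝ => x ^ 2) 4 (gaussianReal 0 1) := by
      have h8 := memLp_id_gaussianReal (μ := 0) (v := 1) 8
      have := h8.norm_rpow_div (q := 2)
      convert this using 1
      · ext x; simp
      · rw [ENNReal.eq_div_iff (by norm_num) (by norm_num)]; norm_num
    exact h1.comp_measurePreserving (measurePreserving_eval (fun _ : Fin d => gaussianReal 0 1) i)
  have hk : ∀ i : Fin d, ∀ k : ℕ, ∫ x : Fin d → ℝ, (x i ^ 2) ^ k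
      ∂(Measure.pi fun _ : Fin d => gaussianReal 0 1) = ∫ x, x ^ (2 * k) ∂gaussianReal 0 1 := by
    intro i k
    have h := (measurePreserving_eval (fun _ : Fin d => gaussianReal 0 1) i).map_eq
    conv_rhs => rw [← h]
    rw [integral_map (measurable_pi_apply i).aemeasurable (by fun_prop)]
    simp_rw [pow_mul]
  obtain ⟨g1, g2, g3, g4⟩ := moments_gaussianReal
  obtain ⟨s1, s2, -, s4⟩ := moments_sum_of_iIndepFun
    (P := Measure.pi fun _ : Fin d => gaussianReal 0 1) (X := fun i x => x i ^ 2)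
    (fun i => by fun_prop) hL
    (iIndepFun_pi (X := fun _ (x : ℝ) => x ^ 2) fun i => by fun_prop)
    (fun i => by simpa [g1] using hk i 1) (fun i => (hk i 2).trans g2) (fun i => (hk i 3).trans g3)
    (fun i => (hk i 4).trans g4) Finset.univ
  have hS : ∀ k, ∫ u, ‖u‖ ^ (2 * k) ∂stdGaussian (Vec d) =
      ∫ x : Fin d → ℝ, (∑ i, x i ^ 2) ^ k ∂(Measure.pi fun _ : Fin d => gaussianReal 0 1) := by
    intro k
    rw [← map_pi_eq_stdGaussian, integral_map (by fun_prop) (by fun_prop)]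
    simp_rw [pow_mul, EuclideanSpace.norm_sq_eq]
    simp
  rw [Finset.card_univ, Fintype.card_fin] at s1 s2 s4
  refine ⟨?_, (hS 2).trans s2, (hS 4).trans s4, ?_⟩
  · have := hS 1
    simp only [mul_one, pow_one] at this
    rw [this, s1]
  · rw [← map_pi_eq_stdGaussian, integrable_map_measure (by fun_prop) (by fun_prop)]
    have h1 : MemLp (fun x : Fin d → ℝ => ∑ i, x i ^ 2) (4 : ℕ)
        (Measure.pi fun _ : Fin d => gaussianReal 0 1) := by
      exact_mod_cast memLp_finsetSum Finset.univ fun i _ => hL i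
    refine (MemLp.integrable_pow_le h1 le_rfl).congr (Eventually.of_forall fun x => ?_)
    simp only [Function.comp_apply]
    rw [show (8 : ℕ) = 2 * 4 by norm_num, pow_mul, EuclideanSpace.norm_sq_eq]
    simp

lemma isIsotropic_stdGaussian (d : ℕ) : IsIsotropic (stdGaussian (Vec d)) where
  isProbabilityMeasure := inferInstance
  map_eq e := stdGaussian_map e
  integrable := (moments_norm_stdGaussian d).2.2.2

lemma integral_inner_pow_four_stdGaussian {v : Vec d} (hv : ‖v‖ = 1) :
    ∫ u, inner ℝ u v ^ 4 ∂stdGaussian (Vec d) = 3 := by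
  have h1 := IsGaussian.map_eq_gaussianReal (μ := stdGaussian (Vec d)) (innerSL ℝ v)
  rw [integral_strongDual_stdGaussian, variance_dual_stdGaussian, innerSL_apply_norm, hv] at h1
  have h2 := moments_gaussianReal.2.1
  rw [one_pow, Real.toNNReal_one] at h1
  rw [← h1, integral_map (by fun_prop) (by fun_prop)] at h2
  rw [← h2]
  congr 1
  ext u
  rw [innerSL_apply_apply, real_inner_comm]

lemma momentBounds_stdGaussian (hd : 1 ≤ d) :
    MomentBounds (stdGaussian (Vec d)) 1 (d + 2) (d * (d + 2) * (d + 4) * (d + 6)) d where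
  toIsIsotropic := isIsotropic_stdGaussian d
  pos := one_pos
  second := by rw [one_mul, (moments_norm_stdGaussian d).1]
  fourth := by rw [(moments_norm_stdGaussian d).2.1]; ring
  eighth := by rw [(moments_norm_stdGaussian d).2.2.1]; ring
  -- The integral is exactly `d (d + 2) / d - (2/3) · 3 = d`.
  bias v hv := by
    have hσ := isIsotropic_stdGaussian d
    have h4 : Integrable (fun u => inner ℝ u v ^ 4) (stdGaussian (Vec d)) := by
      simpa using hσ.integrable_inner_pow_mul v (a := 4) (k := 0) (by norm_num)
    rw [integral_sub (hσ.integrable_inner_pow_mul v (by norm_num)) (h4.const_mul _),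
      integral_const_mul, integral_inner_pow_four_stdGaussian hv,
      hσ.integral_inner_sq_mul hd v (by norm_num), (moments_norm_stdGaussian d).2.1, hv]
    have : (d : ℝ) ≠ 0 := by positivity
    field_simp
    linarith

open Pointwise in
-- Surface measure is the dimension times the volume of the cone over the set. This reduces rotation
-- invariance to that of Lebesgue measure, because an isometry maps cones to cones.
lemma uniformSphere_apply {A : Set (Vec d)} (hA : MeasurableSet A) :
    uniformSphere d A = ((volume : Measure (Vec d)).toSphere Set.univ)⁻¹ *
      (Module.finrank ℝ (Vec d) *
        volume (Set.Ioo (0 : ℝ) 1 • (A ∩ Metric.sphere (0 : Vec d) 1))) := by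
  rw [uniformSphere, Measure.map_apply measurable_subtype_coe hA, Measure.smul_apply,
    Measure.toSphere_apply' _ (measurable_subtype_coe hA), Subtype.image_preimage_coe, smul_eq_mul,
    Set.inter_comm]

open Pointwise in
lemma uniformSphere_map (e : Vec d ≃ₗᵢ[ℝ] Vec d) : (uniformSphere d).map e = uniformSphere d := by
  ext A hA
  rw [Measure.map_apply e.continuous.measurable hA, uniformSphere_apply hA,
    uniformSphere_apply (e.continuous.measurable hA)]
  congr 2
  have h1 : Set.Ioo (0 : ℝ) 1 • (e ⁻¹' A ∩ Metric.sphere (0 : Vec d) 1) =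
      e ⁻¹' (Set.Ioo (0 : ℝ) 1 • (A ∩ Metric.sphere (0 : Vec d) 1)) := by
    ext y
    simp only [Set.mem_smul, Set.mem_inter_iff, Set.mem_preimage, mem_sphere_zero_iff_norm]
    constructor
    · rintro ⟨r, hr, u, ⟨hu, hu1⟩, rfl⟩
      exact ⟨r, hr, e u, ⟨hu, by rwa [e.norm_map]⟩, (e.map_smul r u).symm⟩
    · rintro ⟨r, hr, u, ⟨hu, hu1⟩, he⟩
      refine ⟨r, hr, e.symm u, ⟨by simpa using hu, by rwa [e.symm.norm_map]⟩, ?_⟩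
      rw [← e.symm.map_smul, he, e.symm_apply_apply]
  rw [h1]
  exact (MeasurePreserving.measure_preimage_equiv
    (f := e.toHomeomorph.toMeasurableEquiv) e.measurePreserving _)

lemma ae_norm_uniformSphere (d : ℕ) : ∀ᵐ u ∂uniformSphere d, ‖u‖ = 1 := by
  rw [uniformSphere, ae_map_iff measurable_subtype_coe.aemeasurable
    (measurableSet_eq_fun measurable_norm measurable_const)]
  exact Eventually.of_forall fun u => by simp

lemma isProbabilityMeasure_uniformSphere (hd : 1 ≤ d) : IsProbabilityMeasure (uniformSphere d) := by
  have : Nontrivial (Vec d) := by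
    have : Nonempty (Fin d) := ⟨⟨0, hd⟩⟩
    infer_instance
  refine ⟨?_⟩
  rw [uniformSphere, Measure.map_apply measurable_subtype_coe .univ, Set.preimage_univ,
    Measure.smul_apply, smul_eq_mul]
  exact ENNReal.inv_mul_cancel (Measure.measure_univ_ne_zero.2 (volume : Measure (Vec d)).toSphere_ne_zero)
    (measure_ne_top _ _)

lemma integral_norm_pow_uniformSphere (hd : 1 ≤ d) (k : ℕ) :
    ∫ u, ‖u‖ ^ k ∂uniformSphere d = 1 := by
  have := isProbabilityMeasure_uniformSphere hd
  rw [integral_congr_ae (g := fun _ => (1 : ℝ))]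
  · simp
  · filter_upwards [ae_norm_uniformSphere d] with u hu
    rw [hu, one_pow]

lemma isIsotropic_uniformSphere (hd : 1 ≤ d) : IsIsotropic (uniformSphere d) where
  isProbabilityMeasure := isProbabilityMeasure_uniformSphere hd
  map_eq := uniformSphere_map
  integrable := by
    have := isProbabilityMeasure_uniformSphere hd
    refine (integrable_const (1 : ℝ)).congr ?_
    filter_upwards [ae_norm_uniformSphere d] with u hu
    rw [hu, one_pow]

lemma momentBounds_uniformSphere (hd : 1 ≤ d) :
    MomentBounds (uniformSphere d) d d (d ^ 2) 1 where
  toIsIsotropic := isIsotropic_uniformSphere hd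
  pos := by positivity
  second := by rw [integral_norm_pow_uniformSphere hd, mul_one]
  fourth := by rw [integral_norm_pow_uniformSphere hd]; ring
  eighth := by rw [integral_norm_pow_uniformSphere hd, mul_one]
  bias v hv := by
    have hσ := isIsotropic_uniformSphere hd
    have h4 : Integrable (fun u => inner ℝ u v ^ 4) (uniformSphere d) := by
      simpa using hσ.integrable_inner_pow_mul v (a := 4) (k := 0) (by norm_num)
    rw [integral_sub (hσ.integrable_inner_pow_mul v (by norm_num)) (h4.const_mul _),
      integral_const_mul, hσ.integral_inner_sq_mul hd v (by norm_num),
      integral_norm_pow_uniformSphere hd, hv]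
    -- Only the sign of the fourth moment is used: the other term alone gives `d · (1/d) = 1`.
    have h0 : 0 ≤ ∫ u, inner ℝ u v ^ 4 ∂uniformSphere d := integral_nonneg fun u => by positivity
    have : (0 : ℝ) < d := by positivity
    rw [mul_sub]
    have h2 : (d : ℝ) * (1 ^ 2 / d * 1) = 1 := by field_simp
    rw [h2]
    have : 0 ≤ (d : ℝ) * (2 / 3 * ∫ u, inner ℝ u v ^ 4 ∂uniformSphere d) := by positivity
    linarith

end Isotropic

/-! ### The estimator of a smooth function under a law of directions -/

section DirectionBounds

variable {d N : ℕ} {h : Vec d → ℝ}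

/-- The estimator of a linear function with gradient `v`. -/
def linearEst (γ : ℝ) (v : Vec d) (u : Fin N → Vec d) : Vec d :=
  γ • ∑ j, (inner ℝ v (u j) : ℝ) • u j

/-- A weight dominating the estimators. -/
def dirWeight (u : Fin N → Vec d) : ℝ := ∑ j, (1 + ‖u j‖ ^ 4)

lemma centralDiff_eq (γ ν : ℝ) (h : Vec d → ℝ) (x : Vec d) (u : Fin N → Vec d) :
    centralDiff γ ν h x u =
      γ • ∑ j, (inner ℝ (∇ h x) (u j) + remainder h ν x (u j)) • u j := by
  simp [centralDiff, remainder]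

/-- The error has the same form as the estimator, with `∇h x` replaced by `∇h x - v` and the same
remainder, so estimator and error obey the same second-moment computation. -/
lemma centralDiff_sub_linearEst (γ ν : ℝ) (h : Vec d → ℝ) (x v : Vec d) (u : Fin N → Vec d) :
    centralDiff γ ν h x u - linearEst γ v u =
      γ • ∑ j, (inner ℝ (∇ h x - v) (u j) + remainder h ν x (u j)) • u j := by
  rw [centralDiff_eq, linearEst, ← smul_sub, ← Finset.sum_sub_distrib]
  congr 1
  refine Finset.sum_congr rfl fun j _ => ?_
  rw [← sub_smul, inner_sub_left]
  ring_nf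

lemma continuous_centralDiff (hC : Continuous h) (γ ν : ℝ) (x : Vec d) :
    Continuous (centralDiff (N := N) γ ν h x) := by
  unfold centralDiff
  fun_prop

lemma continuous_linearEst (γ : ℝ) (v : Vec d) : Continuous (linearEst (N := N) γ v) := by
  unfold linearEst
  fun_prop

lemma norm_smul_sum_le (γ : ℝ) {C : ℝ} {c : Fin N → ℝ} {u : Fin N → Vec d}
    (hc : ∀ j, ‖c j • u j‖ ≤ C * (1 + ‖u j‖ ^ 4)) :
    ‖γ • ∑ j, c j • u j‖ ≤ |γ| * C * dirWeight u := by
  rw [norm_smul, Real.norm_eq_abs, dirWeight, mul_assoc, Finset.mul_sum]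
  gcongr
  exact (norm_sum_le _ _).trans (Finset.sum_le_sum fun j _ => hc j)

lemma norm_linearEst_le (γ : ℝ) (v : Vec d) (u : Fin N → Vec d) :
    ‖linearEst γ v u‖ ≤ |γ| * ‖v‖ * dirWeight u := by
  refine norm_smul_sum_le γ fun j => ?_
  rw [norm_smul]
  calc _ ≤ (‖v‖ * ‖u j‖) * ‖u j‖ := by gcongr; exact norm_inner_le_norm _ _
    _ = ‖v‖ * ‖u j‖ ^ 2 := by ring
    _ ≤ _ := by gcongr; exact pow_le_one_add_pow (norm_nonneg _) (by norm_num)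

lemma norm_inner_add_remainder_smul_le (hC : ContDiff ℝ 2 h) {M : ℝ} (hM : HessLipschitz h M)
    {ν : ℝ} (hν : 0 < ν) (x w u : Vec d) :
    ‖(inner ℝ w u + remainder h ν x u) • u‖ ≤ ‖w‖ * ‖u‖ ^ 2 + M * ν ^ 2 / 6 * ‖u‖ ^ 4 := by
  rw [norm_smul]
  calc _ ≤ (‖w‖ * ‖u‖ + M * ν ^ 2 / 6 * ‖u‖ ^ 3) * ‖u‖ := by
        gcongr
        exact (norm_add_le _ _).trans
          (add_le_add (norm_inner_le_norm _ _) (abs_remainder_le hC hM hν x u))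
    _ = _ := by ring

lemma norm_centralDiff_le (hC : ContDiff ℝ 2 h) {M : ℝ} (hM0 : 0 ≤ M) (hM : HessLipschitz h M)
    {ν : ℝ} (hν : 0 < ν) (γ : ℝ) (x : Vec d) (u : Fin N → Vec d) :
    ‖centralDiff γ ν h x u‖ ≤ |γ| * (‖∇ h x‖ + M * ν ^ 2 / 6) * dirWeight u := by
  rw [centralDiff_eq]
  refine norm_smul_sum_le γ fun j => ?_
  refine (norm_inner_add_remainder_smul_le hC hM hν x _ _).trans ?_
  rw [add_mul]
  gcongr
  · exact pow_le_one_add_pow (norm_nonneg _) (by norm_num)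
  · linarith

lemma inner_add_remainder_sq_le (hC : ContDiff ℝ 2 h) {M : ℝ} (hM : HessLipschitz h M)
    {ν : ℝ} (hν : 0 < ν) (x w u : Vec d) :
    (inner ℝ w u + remainder h ν x u) ^ 2 ≤
      4 / 3 * inner ℝ u w ^ 2 + 4 * (M ^ 2 * ν ^ 4 / 36) * ‖u‖ ^ 6 := by
  have h1 := sq_le_sq' (neg_le_of_abs_le (abs_remainder_le hC hM hν x u))
    (le_of_abs_le (abs_remainder_le hC hM hν x u))
  rw [real_inner_comm]
  -- With `a = ⟪u, w⟫` and `r` the remainder, `(a + r)² ≤ (4/3) a² + 4 r²` amounts to `(a - 3r)² ≥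
  -- 0`.
  nlinarith [sq_nonneg (inner ℝ u w - 3 * remainder h ν x u)]

section MemLp

variable {τ : Measure (Fin N → Vec d)}

lemma memLp_dirWeight [IsFiniteMeasure τ] (hτ : ∀ j, Integrable (fun u => ‖u j‖ ^ 8) τ) :
    MemLp dirWeight 2 τ := by
  have : ∀ j, MemLp (fun u : Fin N → Vec d => 1 + ‖u j‖ ^ 4) 2 τ := by
    intro j
    refine (memLp_const (1 : ℝ)).add ?_
    rw [memLp_two_iff_integrable_sq (by fun_prop : Continuous _).aestronglyMeasurable]
    refine (hτ j).congr (Eventually.of_forall fun u => ?_)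
    ring
  exact memLp_finsetSum _ fun j _ => this j

lemma memLp_linearEst [IsFiniteMeasure τ] (hτ : ∀ j, Integrable (fun u => ‖u j‖ ^ 8) τ)
    (γ : ℝ) (v : Vec d) : MemLp (linearEst γ v) 2 τ :=
  ((memLp_dirWeight hτ).const_mul (|γ| * ‖v‖)).mono'
    (continuous_linearEst γ v).aestronglyMeasurable
    (Eventually.of_forall (norm_linearEst_le γ v))

lemma memLp_centralDiff [IsFiniteMeasure τ] (hτ : ∀ j, Integrable (fun u => ‖u j‖ ^ 8) τ)
    (hC : ContDiff ℝ 2 h) {M : ℝ} (hM0 : 0 ≤ M) (hM : HessLipschitz h M)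
    {ν : ℝ} (hν : 0 < ν) (γ : ℝ) (x : Vec d) : MemLp (centralDiff γ ν h x) 2 τ :=
  ((memLp_dirWeight hτ).const_mul (|γ| * (‖∇ h x‖ + M * ν ^ 2 / 6))).mono'
    (continuous_centralDiff hC.continuous γ ν x).aestronglyMeasurable
    (Eventually.of_forall (norm_centralDiff_le hC hM0 hM hν γ x))

end MemLp

/-- Bounds for the estimators with directions of law `τ`, scaling `γ`, sampling radius `ν`:
second moments of the error (with constants `S` and `S'`), and descent and lower bounds for
functions with an `MF`-Lipschitz Hessian, at points that are not `ε`-accurate, when the step size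
is `ρ / (4 (1 + θ²) L)`. -/
structure DirectionBounds (τ : Measure (Fin N → Vec d)) (γ ν MF ε ρ S S' lam : ℝ) : Prop where
  isProbabilityMeasure : IsProbabilityMeasure τ
  integrable : ∀ j, Integrable (fun u => ‖u j‖ ^ 8) τ
  second_moment : ∀ (h : Vec d → ℝ) (M : ℝ), ContDiff ℝ 2 h → 0 ≤ M → HessLipschitz h M →
    ∀ x v, ∫ u, ‖centralDiff γ ν h x u - linearEst γ v u‖ ^ 2 ∂τ ≤
      4 / 3 * S * ‖∇ h x - v‖ ^ 2 + 4 * S' * (M ^ 2 * ν ^ 4 / 36)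
  descent : ∀ h : Vec d → ℝ, ContDiff ℝ 2 h → HessLipschitz h MF → ∀ x, ε < ‖∇ h x‖ ^ 2 →
    -∫ u, inner ℝ (∇ h x) (centralDiff γ ν h x u) ∂τ +
      ρ / 8 * ∫ u, ‖centralDiff γ ν h x u‖ ^ 2 ∂τ ≤ -(‖∇ h x‖ ^ 2 / 8)
  lower : ∀ h : Vec d → ℝ, ContDiff ℝ 2 h → HessLipschitz h MF → ∀ x, ε < ‖∇ h x‖ ^ 2 →
    lam * ‖∇ h x‖ ^ 2 ≤ ∫ u, ‖centralDiff γ ν h x u‖ ^ 2 ∂τ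

/-! ### Orthonormal directions -/

section Orthonormal

variable {τ : Measure (Fin N → Vec d)} [IsProbabilityMeasure τ]

lemma norm_smul_sum_sq_of_orthonormal {u : Fin N → Vec d} (hu : Orthonormal ℝ u) (γ : ℝ)
    (c : Fin N → ℝ) : ‖γ • ∑ j, c j • u j‖ ^ 2 = γ ^ 2 * ∑ j, c j ^ 2 := by
  rw [norm_smul, mul_pow, Real.norm_eq_abs, sq_abs, ← real_inner_self_eq_norm_sq,
    hu.inner_sum c c Finset.univ]
  congr 1
  exact Finset.sum_congr rfl fun j _ => by simp [sq]

lemma integrable_sum_inner_sq (ho : ∀ᵐ u ∂τ, Orthonormal ℝ u) (v : Vec d) :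
    Integrable (fun u => ∑ j, (inner ℝ (u j) v : ℝ) ^ 2) τ := by
  refine (integrable_const (N * ‖v‖ ^ 2)).mono'
    (by fun_prop : Continuous _).aestronglyMeasurable ?_
  filter_upwards [ho] with u hu
  rw [Real.norm_of_nonneg (by positivity)]
  calc _ ≤ ∑ j : Fin N, ‖v‖ ^ 2 := by
        refine Finset.sum_le_sum fun j _ => ?_
        have h1 := abs_real_inner_le_norm (u j) v
        rw [hu.1 j, one_mul] at h1
        exact sq_le_sq' (neg_le_of_abs_le h1) (le_of_abs_le h1)
    _ = _ := by simp

lemma integrable_norm_pow_eight_of_orthonormal (ho : ∀ᵐ u ∂τ, Orthonormal ℝ u) (j : Fin N) :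
    Integrable (fun u => ‖u j‖ ^ 8) τ := by
  refine (integrable_const (1 : ℝ)).congr ?_
  filter_upwards [ho] with u hu
  rw [hu.1 j, one_pow]

/-- Orthonormality makes `‖g‖²` equal to `γ²` times a sum of squares, so scalar inequalities for
each direction suffice; `hi` then turns `γ E ∑ ⟪u_j, v⟫²` into `‖v‖²`. As `γρ = 1`, the quadratic
term of the descent has weight `γ/8`. By `hε` the total remainder `d MF² ν⁴ / 36` is at most `ε/6 <
‖∇h x‖²/6`, and the descent obtained is `-1/2 + 1/12 = -5/12`, more than the `-1/8` required. -/
lemma directionBounds_of_orthonormal (hd : 1 ≤ d) (hN : 1 ≤ N)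
    (ho : ∀ᵐ u ∂τ, Orthonormal ℝ u)
    (hi : ∀ v : Vec d, ∫ u, ∑ j, (inner ℝ (u j) v) ^ 2 ∂τ = (N / d : ℝ) * ‖v‖ ^ 2)
    {ν MF ε : ℝ} (hν : 0 < ν) (hMF : 0 ≤ MF) (hε : 6 * (d * (MF ^ 2 * ν ^ 4 / 36)) ≤ ε) :
    DirectionBounds τ (d / N) ν MF ε (N / d) (d / N) (d / N * d) (0.35 * (d / N)) := by
  have hd' : (0 : ℝ) < d := by positivity
  have hN' : (0 : ℝ) < N := by positivity
  have h8 := integrable_norm_pow_eight_of_orthonormal ho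
  set γ : ℝ := d / N with hγ
  have hγ0 : 0 < γ := by positivity
  have hγρ : γ * (N / d) = 1 := by rw [hγ]; field_simp
  have hγN : γ * N = d := by rw [hγ]; field_simp
  -- the remainders are uniformly bounded
  have hr : ∀ (h : Vec d → ℝ) (M : ℝ), ContDiff ℝ 2 h → HessLipschitz h M → ∀ x,
      ∀ u : Fin N → Vec d, Orthonormal ℝ u → ∀ j,
        remainder h ν x (u j) ^ 2 ≤ M ^ 2 * ν ^ 4 / 36 := by
    intro h M hC hM x u hu j
    have h1 := abs_remainder_le hC hM hν x (u j)
    rw [hu.1 j, one_pow, mul_one] at h1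
    have := sq_le_sq' (neg_le_of_abs_le h1) (le_of_abs_le h1)
    calc _ ≤ _ := this
      _ = _ := by ring
  refine ⟨inferInstance, h8, ?_, ?_, ?_⟩
  · intro h M hC hM0 hM x v
    set w := ∇ h x - v with hw
    have h1 : ∫ u, ‖centralDiff γ ν h x u - linearEst γ v u‖ ^ 2 ∂τ ≤
        ∫ u, γ ^ 2 * (4 / 3 * ∑ j, (inner ℝ (u j) w : ℝ) ^ 2 +
          4 * N * (M ^ 2 * ν ^ 4 / 36)) ∂τ := by
      refine integral_mono_of_nonneg (Eventually.of_forall fun u => by positivity)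
        ((((integrable_sum_inner_sq ho w).const_mul _).add (integrable_const _)).const_mul _) ?_
      filter_upwards [ho] with u hu
      rw [centralDiff_sub_linearEst, norm_smul_sum_sq_of_orthonormal hu]
      gcongr
      calc _ ≤ ∑ j : Fin N, (4 / 3 * (inner ℝ (u j) w : ℝ) ^ 2 + 4 * (M ^ 2 * ν ^ 4 / 36)) := by
            refine Finset.sum_le_sum fun j _ => ?_
            have := inner_add_remainder_sq_le hC hM hν x w (u j)
            rwa [hu.1 j, one_pow, mul_one] at this
        _ = _ := by
            rw [Finset.sum_add_distrib, ← Finset.mul_sum]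
            simp
            ring
    refine h1.trans (le_of_eq ?_)
    rw [integral_const_mul, integral_add ((integrable_sum_inner_sq ho w).const_mul _)
      (integrable_const _), integral_const_mul, hi, integral_const]
    simp only [probReal_univ, one_smul]
    have e1 : γ ^ 2 * (N / d) = γ := by rw [sq, mul_assoc, hγρ, mul_one]
    have e2 : γ ^ 2 * N = γ * d := by rw [sq, mul_assoc, hγN]
    linear_combination (4 / 3 * ‖w‖ ^ 2) * e1 + (4 * (M ^ 2 * ν ^ 4 / 36)) * e2
  · intro h hC hM x hx
    have hL := memLp_centralDiff (N := N) h8 hC hMF hM hν γ x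
    have i1 : Integrable (fun u => inner ℝ (∇ h x) (centralDiff γ ν h x u)) τ :=
      (hL.integrable (by norm_num)).const_inner _
    have i2 : Integrable (fun u => ‖centralDiff γ ν h x u‖ ^ 2) τ := hL.norm.integrable_sq
    have i1n : Integrable (fun u => -inner ℝ (∇ h x) (centralDiff γ ν h x u)) τ := i1.neg
    rw [← integral_neg, ← integral_const_mul, ← integral_add i1n (i2.const_mul _)]
    have h1 : ∫ u, (-inner ℝ (∇ h x) (centralDiff γ ν h x u) +
          N / d / 8 * ‖centralDiff γ ν h x u‖ ^ 2) ∂τ ≤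
        ∫ u, γ * (-(1 / 2) * ∑ j, (inner ℝ (u j) (∇ h x) : ℝ) ^ 2 +
          1 / 2 * N * (MF ^ 2 * ν ^ 4 / 36)) ∂τ := by
      refine integral_mono_ae (i1n.add (i2.const_mul _))
        ((((integrable_sum_inner_sq ho _).const_mul _).add (integrable_const _)).const_mul _) ?_
      filter_upwards [ho] with u hu
      rw [centralDiff_eq, norm_smul_sum_sq_of_orthonormal hu, inner_smul_right, inner_sum]
      simp_rw [inner_smul_right, real_inner_comm (u _) (∇ h x)]
      calc _ = γ * ∑ j, (-((inner ℝ (u j) (∇ h x) + remainder h ν x (u j)) *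
              inner ℝ (u j) (∇ h x)) +
              1 / 8 * (inner ℝ (u j) (∇ h x) + remainder h ν x (u j)) ^ 2) := by
            rw [Finset.sum_add_distrib, Finset.sum_neg_distrib, ← Finset.mul_sum]
            linear_combination (γ / 8 *
              ∑ j, (inner ℝ (u j) (∇ h x) + remainder h ν x (u j)) ^ 2) * hγρ
        _ ≤ γ * ∑ j : Fin N, (-(1 / 2) * (inner ℝ (u j) (∇ h x)) ^ 2 +
              1 / 2 * (MF ^ 2 * ν ^ 4 / 36)) := by
            refine mul_le_mul_of_nonneg_left (Finset.sum_le_sum fun j _ => ?_) hγ0.le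
            have := hr h MF hC hM x u hu j
            -- With `a = ⟪u_j, ∇h x⟫`, `-(a+r)a + (a+r)²/8 = -a²/2 + r²/2 - (3/8)(a+r)²`.
            nlinarith [sq_nonneg (inner ℝ (u j) (∇ h x) + remainder h ν x (u j))]
        _ = _ := by
            rw [Finset.sum_add_distrib, ← Finset.mul_sum]
            rw [Finset.sum_const, Finset.card_univ, Fintype.card_fin, nsmul_eq_mul]
            ring
    refine h1.trans ?_
    rw [integral_const_mul, integral_add ((integrable_sum_inner_sq ho _).const_mul _)
      (integrable_const _), integral_const_mul, hi, integral_const]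
    simp only [probReal_univ, one_smul]
    have e1 : γ * (-(1 / 2) * (N / d * ‖∇ h x‖ ^ 2) + 1 / 2 * N * (MF ^ 2 * ν ^ 4 / 36)) =
        -(1 / 2) * ‖∇ h x‖ ^ 2 + 1 / 2 * (d * (MF ^ 2 * ν ^ 4 / 36)) := by
      linear_combination (-(1 / 2) * ‖∇ h x‖ ^ 2) * hγρ + (1 / 2 * (MF ^ 2 * ν ^ 4 / 36)) * hγN
    rw [e1]
    have := sq_nonneg ‖∇ h x‖
    linarith
  · intro h hC hM x hx
    have hL := memLp_centralDiff (N := N) h8 hC hMF hM hν γ x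
    have i2 : Integrable (fun u => ‖centralDiff γ ν h x u‖ ^ 2) τ := hL.norm.integrable_sq
    have h1 : ∫ u, γ ^ 2 * (0.6 * ∑ j, (inner ℝ (u j) (∇ h x) : ℝ) ^ 2 -
          1.5 * N * (MF ^ 2 * ν ^ 4 / 36)) ∂τ ≤ ∫ u, ‖centralDiff γ ν h x u‖ ^ 2 ∂τ := by
      refine integral_mono_ae
        ((((integrable_sum_inner_sq ho _).const_mul _).sub (integrable_const _)).const_mul _) i2 ?_
      filter_upwards [ho] with u hu
      rw [centralDiff_eq, norm_smul_sum_sq_of_orthonormal hu]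
      simp_rw [real_inner_comm (u _) (∇ h x)]
      gcongr
      calc _ = ∑ j : Fin N, (0.6 * (inner ℝ (u j) (∇ h x) : ℝ) ^ 2 -
              1.5 * (MF ^ 2 * ν ^ 4 / 36)) := by
            rw [Finset.sum_sub_distrib, ← Finset.mul_sum]
            rw [Finset.sum_const, Finset.card_univ, Fintype.card_fin, nsmul_eq_mul]
            ring
        _ ≤ _ := by
            refine Finset.sum_le_sum fun j _ => ?_
            have := hr h MF hC hM x u hu j
            -- `(a+r)² - 0.6 a² + 1.5 r² = 2.5 (0.4 a + r)²`. The split yields `0.6 - 1.5/6 = 0.35`,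
            -- just above the `1/3` that the size bound with `b₁` needs.
            nlinarith [sq_nonneg (0.4 * inner ℝ (u j) (∇ h x) + remainder h ν x (u j))]
    refine le_trans ?_ h1
    rw [integral_const_mul, integral_sub ((integrable_sum_inner_sq ho _).const_mul _)
      (integrable_const _), integral_const_mul, hi, integral_const]
    simp only [probReal_univ, one_smul]
    have e1 : γ ^ 2 * (0.6 * (N / d * ‖∇ h x‖ ^ 2) - 1.5 * N * (MF ^ 2 * ν ^ 4 / 36)) =
        γ * (0.6 * ‖∇ h x‖ ^ 2 - 1.5 * (d * (MF ^ 2 * ν ^ 4 / 36))) := by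
      linear_combination (γ * 0.6 * ‖∇ h x‖ ^ 2) * hγρ -
        (γ * 1.5 * (MF ^ 2 * ν ^ 4 / 36)) * hγN
    rw [e1, mul_comm (0.35 : ℝ), mul_assoc]
    gcongr
    linarith

end Orthonormal

/-! ### Independent isotropic directions -/

section IndependentDirections

variable {σ : Measure (Vec d)} {c κ e t : ℝ}

/-- The estimator with a single direction. -/
def singleEst (c ν : ℝ) (h : Vec d → ℝ) (x w u : Vec d) : Vec d :=
  c • ((inner ℝ w u + remainder h ν x u) • u)

lemma continuous_singleEst (hC : Continuous h) (c ν : ℝ) (x w : Vec d) :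
    Continuous (singleEst c ν h x w) := by
  have := IsIsotropic.continuous_remainder hC ν x
  unfold singleEst
  fun_prop

lemma smul_sum_eq_singleEst (c ν : ℝ) (h : Vec d → ℝ) (x w : Vec d) (u : Fin N → Vec d) :
    (c / N) • ∑ j, (inner ℝ w (u j) + remainder h ν x (u j)) • u j =
      (1 / N : ℝ) • ∑ j, singleEst c ν h x w (u j) := by
  simp only [singleEst]
  rw [← Finset.smul_sum, smul_smul]
  congr 1
  ring

lemma MomentBounds.memLp_singleEst (hσ : MomentBounds σ c κ e t) (hC : ContDiff ℝ 2 h) {M : ℝ}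
    (hM : HessLipschitz h M) {ν : ℝ} (hν : 0 < ν) (x w : Vec d) :
    MemLp (singleEst c ν h x w) 2 σ := by
  have := hσ.isProbabilityMeasure
  have hp : ∀ k ≤ 4, MemLp (fun u : Vec d => ‖u‖ ^ k) 2 σ := by
    intro k hk
    rw [memLp_two_iff_integrable_sq (by fun_prop : Continuous _).aestronglyMeasurable]
    refine (hσ.integrable_norm_pow (k := k * 2) (by omega)).congr (Eventually.of_forall fun u => ?_)
    simp only [pow_mul]
  refine ((((hp 2 (by norm_num)).const_mul ‖w‖).add
    ((hp 4 le_rfl).const_mul (M * ν ^ 2 / 6))).const_mul ‖c‖).mono'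
    (continuous_singleEst hC.continuous c ν x w).aestronglyMeasurable
    (Eventually.of_forall fun u => ?_)
  rw [singleEst, norm_smul]
  exact mul_le_mul_of_nonneg_left (norm_inner_add_remainder_smul_le hC hM hν x w u) (norm_nonneg _)

lemma MomentBounds.integral_norm_singleEst_sq_le (hσ : MomentBounds σ c κ e t) (hd : 1 ≤ d)
    (hC : ContDiff ℝ 2 h) {M : ℝ} (hM : HessLipschitz h M) {ν : ℝ} (hν : 0 < ν) (x w : Vec d) :
    ∫ u, ‖singleEst c ν h x w u‖ ^ 2 ∂σ ≤
      4 / 3 * κ * ‖w‖ ^ 2 + 4 * e * (M ^ 2 * ν ^ 4 / 36) := by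
  have i1 := hσ.integrable_inner_pow_mul w (a := 2) (k := 2) (by norm_num)
  have i2 := hσ.integrable_norm_pow (k := 8) le_rfl
  calc ∫ u, ‖singleEst c ν h x w u‖ ^ 2 ∂σ
      ≤ ∫ u, c ^ 2 * (4 / 3 * (inner ℝ u w ^ 2 * ‖u‖ ^ 2) +
          4 * (M ^ 2 * ν ^ 4 / 36) * ‖u‖ ^ 8) ∂σ := by
        refine integral_mono_of_nonneg (Eventually.of_forall fun u => by positivity)
          (((i1.const_mul _).add (i2.const_mul _)).const_mul _) (Eventually.of_forall fun u => ?_)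
        simp only [singleEst, norm_smul, mul_pow, Real.norm_eq_abs, sq_abs]
        gcongr
        calc _ ≤ _ := mul_le_mul_of_nonneg_right (inner_add_remainder_sq_le hC hM hν x w u)
              (sq_nonneg ‖u‖)
          _ = _ := by ring
    _ = _ := by
        rw [integral_const_mul, integral_add (i1.const_mul _) (i2.const_mul _),
          integral_const_mul, integral_const_mul, hσ.integral_inner_sq_mul hd w (by norm_num)]
        have hd' : (d : ℝ) ≠ 0 := by positivity
        have h4 := hσ.fourth
        have h8 := hσ.eighth
        have h4' : c ^ 2 * (∫ u, ‖u‖ ^ 4 ∂σ) / d = κ := by rw [h4]; field_simp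
        rw [← h4', ← h8]
        ring

/-- Since `c E[u uᵀ] = I`, the linear part has mean exactly `w`. What is left is `c E[r(u) u]`,
whose pairing with each unit vector is controlled by the reflection estimate. -/
lemma MomentBounds.norm_integral_singleEst_sub_le (hσ : MomentBounds σ c κ e t) (hd : 1 ≤ d)
    (hC : ContDiff ℝ 2 h) {M : ℝ} (hM0 : 0 ≤ M) (hM : HessLipschitz h M) {ν : ℝ} (hν : 0 < ν)
    (x w : Vec d) :
    ‖∫ u, singleEst c ν h x w u ∂σ - w‖ ≤ M * ν ^ 2 / 2 * t := by
  have := hσ.isProbabilityMeasure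
  have hd' : (d : ℝ) ≠ 0 := by positivity
  have hcr := IsIsotropic.continuous_remainder hC.continuous ν x
  have hint : Integrable (fun u => remainder h ν x u • u) σ := by
    refine integrable_of_norm_le hσ.integrable (by fun_prop) (M * ν ^ 2 / 6) (k := 4) (by norm_num)
      (fun u => ?_)
    simpa using norm_inner_add_remainder_smul_le hC hM hν x 0 u
  have h1 : ∫ u, singleEst c ν h x w u ∂σ - w = c • ∫ u, remainder h ν x u • u ∂σ := by
    simp only [singleEst, add_smul]
    rw [integral_smul, integral_add (hσ.integrable_inner_smul w) hint, hσ.integral_inner_smul hd,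
      smul_add, smul_smul, mul_div_assoc', hσ.second, div_self hd', one_smul, add_sub_cancel_left]
  rw [h1]
  set b := c • ∫ u, remainder h ν x u • u ∂σ with hb
  have key : ∀ v : Vec d, ‖v‖ = 1 → inner ℝ b v ≤ M * ν ^ 2 / 2 * t := by
    intro v hv
    rw [hb, inner_smul_left, real_inner_comm, ← integral_inner hint]
    simp only [conj_trivial]
    have e1 : ∀ u, inner ℝ v (remainder h ν x u • u) = remainder h ν x u * inner ℝ u v := by
      intro u
      rw [inner_smul_right, real_inner_comm]
    simp_rw [e1]
    calc _ ≤ c * (M * ν ^ 2 / 2 *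
          ∫ u, (inner ℝ u v ^ 2 * ‖u‖ ^ 2 - 2 / 3 * inner ℝ u v ^ 4) ∂σ) :=
          mul_le_mul_of_nonneg_left ((le_abs_self _).trans
            (hσ.abs_integral_remainder_mul_inner_le hC hM hν x hv)) hσ.pos.le
      _ = M * ν ^ 2 / 2 *
          (c * ∫ u, (inner ℝ u v ^ 2 * ‖u‖ ^ 2 - 2 / 3 * inner ℝ u v ^ 4) ∂σ) := by ring
      _ ≤ _ := by gcongr; exact hσ.bias v hv
  -- For `b = 0` the claim is that the right-hand side is nonnegative, which testing with any unit
  -- vector shows.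
  rcases eq_or_ne b 0 with h0 | h0
  · have : Nonempty (Fin d) := ⟨⟨0, hd⟩⟩
    have := key (EuclideanSpace.single ⟨0, hd⟩ (1 : ℝ)) (by simp)
    rw [h0, inner_zero_left] at this
    rwa [h0, norm_zero]
  · have hb' : ‖b‖ ≠ 0 := norm_ne_zero_iff.2 h0
    have := key ((‖b‖)⁻¹ • b) (by rw [norm_smul, norm_inv, norm_norm, inv_mul_cancel₀ hb'])
    rw [inner_smul_right, real_inner_self_eq_norm_sq] at this
    calc ‖b‖ = (‖b‖)⁻¹ * ‖b‖ ^ 2 := by field_simp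
      _ ≤ _ := this

/-- Write `G = ‖∇h x‖`, `B` for the bias bound, and `b`, `q` for the mean and the second moment of
the single-direction estimator. Then `hbias` gives `4B ≤ G`, so `⟪∇h x, E g⟫ ≥ (3/4) G²`. By
independence `E‖g‖² = (q + (N-1)‖b‖²)/N`, and `hκ`, `hvar` bound `ρ E‖g‖²` by `(8/3) G²`. The
descent is `-3/4 + 1/3 = -5/12`, as in the orthonormal case. -/
lemma directionBounds_pi (hσ : MomentBounds σ c κ e t) (hd : 1 ≤ d) (hN : 1 ≤ N)
    {ν MF ε : ℝ} (hν : 0 < ν) (hMF : 0 ≤ MF) (hκ : κ ≤ 4.5 * d)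
    (hbias : 16 * (MF * ν ^ 2 / 2 * t) ^ 2 ≤ ε)
    (hvar : 4 * (e * (MF ^ 2 * ν ^ 4 / 36) + N * (MF * ν ^ 2 / 2 * t) ^ 2) ≤
      4 / 3 * (N + 4.5 * d) * ε) :
    DirectionBounds (Measure.pi fun _ : Fin N => σ) (c / N) ν MF ε (N / (N + 4.5 * d)) κ e
      0.5625 := by
  have := hσ.isProbabilityMeasure
  have hN' : (0 : ℝ) < N := by positivity
  have hmp := fun j : Fin N => measurePreserving_eval (fun _ : Fin N => σ) j
  have h8 : ∀ j : Fin N, Integrable (fun u : Fin N → Vec d => ‖u j‖ ^ 8)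
      (Measure.pi fun _ : Fin N => σ) := fun j =>
    (hmp j).integrable_comp_of_integrable hσ.integrable
  have hsq : ∀ φ : Vec d → Vec d, MemLp φ 2 σ → ∀ j : Fin N,
      ∫ u, ‖φ (u j)‖ ^ 2 ∂(Measure.pi fun _ : Fin N => σ) = ∫ u, ‖φ u‖ ^ 2 ∂σ := by
    intro φ hφ j
    conv_rhs => rw [← (hmp j).map_eq]
    rw [integral_map (measurable_pi_apply j).aemeasurable]
    rw [(hmp j).map_eq]
    exact (hφ.norm.integrable_sq).aestronglyMeasurable
  have hmean : ∀ φ : Vec d → Vec d, MemLp φ 2 σ → ∀ j : Fin N,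
      ∫ u, φ (u j) ∂(Measure.pi fun _ : Fin N => σ) = ∫ u, φ u ∂σ := by
    intro φ hφ j
    conv_rhs => rw [← (hmp j).map_eq]
    rw [integral_map (measurable_pi_apply j).aemeasurable]
    rw [(hmp j).map_eq]
    exact hφ.1
  have facts : ∀ h : Vec d → ℝ, ContDiff ℝ 2 h → HessLipschitz h MF → ∀ x, ε < ‖∇ h x‖ ^ 2 →
      (0.75 * ‖∇ h x‖ ^ 2 ≤ ∫ u, inner ℝ (∇ h x) (centralDiff (c / N) ν h x u)
        ∂(Measure.pi fun _ : Fin N => σ)) ∧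
      (N / (N + 4.5 * d) * ∫ u, ‖centralDiff (c / N) ν h x u‖ ^ 2
        ∂(Measure.pi fun _ : Fin N => σ) ≤ 8 / 3 * ‖∇ h x‖ ^ 2) := by
    intro h hC hM x hx
    have hX := hσ.memLp_singleEst hC hM hν x (∇ h x)
    have hXj : ∀ j : Fin N, MemLp (fun u : Fin N → Vec d => singleEst c ν h x (∇ h x) (u j)) 2
        (Measure.pi fun _ : Fin N => σ) := fun j => hX.comp_measurePreserving (hmp j)
    have hg : ∀ u : Fin N → Vec d, centralDiff (c / N) ν h x u =
        (1 / N : ℝ) • ∑ j, singleEst c ν h x (∇ h x) (u j) := fun u => by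
      rw [centralDiff_eq, smul_sum_eq_singleEst]
    have hq := hσ.integral_norm_singleEst_sq_le hd hC hM hν x (∇ h x)
    have hb := hσ.norm_integral_singleEst_sub_le hd hC hMF hM hν x (∇ h x)
    set b := ∫ u, singleEst c ν h x (∇ h x) u ∂σ with hbdef
    set q := ∫ u, ‖singleEst c ν h x (∇ h x) u‖ ^ 2 ∂σ with hqdef
    set B := MF * ν ^ 2 / 2 * t with hB
    have hB0 : 0 ≤ B := (norm_nonneg _).trans hb
    set G := ‖∇ h x‖ with hG
    have hG0 : 0 ≤ G := norm_nonneg _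
    have hBG : 4 * B ≤ G := by
      refine le_of_sq_le_sq ?_ hG0
      nlinarith
    have hip : inner ℝ (∇ h x) b ≥ G ^ 2 - G * B := by
      have e1 : inner ℝ (∇ h x) b = G ^ 2 + inner ℝ (∇ h x) (b - ∇ h x) := by
        rw [inner_sub_right, real_inner_self_eq_norm_sq]; ring
      have e2 := (abs_le.1 (abs_real_inner_le_norm (∇ h x) (b - ∇ h x))).1
      have e3 : ‖∇ h x‖ * ‖b - ∇ h x‖ ≤ G * B := by gcongr
      rw [e1]; linarith
    have hnb : ‖b‖ ≤ G + B := by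
      have := norm_le_norm_add_norm_sub' b (∇ h x)
      linarith
    constructor
    · have : ∫ u, inner ℝ (∇ h x) (centralDiff (c / N) ν h x u)
          ∂(Measure.pi fun _ : Fin N => σ) = inner ℝ (∇ h x) b := by
        have hint : Integrable (fun u : Fin N → Vec d =>
            (1 / N : ℝ) • ∑ j, singleEst c ν h x (∇ h x) (u j)) (Measure.pi fun _ : Fin N => σ) :=
          Integrable.fun_smul _
            (integrable_finsetSum _ fun j _ => (hXj j).integrable (by norm_num))
        simp_rw [hg]
        rw [integral_inner hint, integral_smul, integral_finsetSum _
          fun j _ => (hXj j).integrable (by norm_num),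
          Finset.sum_congr rfl fun j _ => hmean _ hX j]
        rw [Finset.sum_const, Finset.card_univ, Fintype.card_fin, ← Nat.cast_smul_eq_nsmul ℝ,
          smul_smul, one_div_mul_cancel hN'.ne', one_smul]
      rw [this]
      nlinarith
    · have h1 : ∫ u, ‖centralDiff (c / N) ν h x u‖ ^ 2 ∂(Measure.pi fun _ : Fin N => σ) =
          (1 / N) ^ 2 * (N * q + N * (N - 1) * ‖b‖ ^ 2) := by
        simp_rw [hg, norm_smul, mul_pow]
        rw [integral_const_mul, integral_norm_sum_sq_of_indepFun Finset.univ
          (fun j _ => hXj j) (fun i _ j _ hij => ?_) (fun j _ => hmean _ hX j)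
          (fun j _ => hsq _ hX j)]
        · rw [Finset.card_univ, Fintype.card_fin, Real.norm_of_nonneg (by positivity)]
        · exact (iIndepFun_pi (X := fun _ : Fin N => singleEst c ν h x (∇ h x)) fun _ =>
            (continuous_singleEst hC.continuous c ν x (∇ h x)).aemeasurable).indepFun hij
      rw [h1]
      -- The same split `4/3`, `4` as in the bound on `q`: the main terms add up to `(4/3)(N + 4.5
      -- d) G²`, and the errors are the left side of `hvar`.
      have hb2 : ‖b‖ ^ 2 ≤ 4 / 3 * G ^ 2 + 4 * B ^ 2 := by
        have := pow_le_pow_left₀ (norm_nonneg b) hnb 2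
        nlinarith [sq_nonneg (G - 3 * B)]
      have hden : (0 : ℝ) < N + 4.5 * d := by positivity
      have e1 : N / (N + 4.5 * d) * ((1 / N) ^ 2 * (N * q + N * (N - 1) * ‖b‖ ^ 2)) =
          (q + (N - 1) * ‖b‖ ^ 2) / (N + 4.5 * d) := by
        field_simp
      rw [e1, div_le_iff₀ hden]
      have e2 : (N - 1 : ℝ) * ‖b‖ ^ 2 ≤ N * (4 / 3 * G ^ 2 + 4 * B ^ 2) := by
        have : (N - 1 : ℝ) * ‖b‖ ^ 2 ≤ N * ‖b‖ ^ 2 := by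
          gcongr; linarith
        exact this.trans (by gcongr)
      have e3 : 4 / 3 * κ * G ^ 2 ≤ 4 / 3 * (4.5 * d) * G ^ 2 := by gcongr
      have e4 : 4 / 3 * (N + 4.5 * d) * ε ≤ 4 / 3 * (N + 4.5 * d) * G ^ 2 := by gcongr
      linarith
  refine ⟨inferInstance, h8, ?_, ?_, ?_⟩
  · intro h M hC hM0 hM x v
    have hX := hσ.memLp_singleEst hC hM hν x (∇ h x - v)
    have hXj : ∀ j : Fin N, MemLp (fun u : Fin N → Vec d => singleEst c ν h x (∇ h x - v) (u j)) 2
        (Measure.pi fun _ : Fin N => σ) := fun j => hX.comp_measurePreserving (hmp j)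
    calc _ ≤ ∫ u, (1 / N : ℝ) * ∑ j, ‖singleEst c ν h x (∇ h x - v) (u j)‖ ^ 2
          ∂(Measure.pi fun _ : Fin N => σ) := by
          refine integral_mono_of_nonneg (Eventually.of_forall fun u => by positivity)
            ((integrable_finsetSum _ fun j _ => (hXj j).norm.integrable_sq).const_mul _)
            (Eventually.of_forall fun u => ?_)
          simp only [centralDiff_sub_linearEst, smul_sum_eq_singleEst, norm_smul, mul_pow]
          -- Cauchy–Schwarz is enough for the second moment of the error; no gain from independence
          -- is claimed.
          have h1 : ‖∑ j, singleEst c ν h x (∇ h x - v) (u j)‖ ^ 2 ≤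
              N * ∑ j, ‖singleEst c ν h x (∇ h x - v) (u j)‖ ^ 2 := by
            have := sq_sum_le_card_mul_sum_sq (s := Finset.univ)
              (f := fun j : Fin N => ‖singleEst c ν h x (∇ h x - v) (u j)‖)
            rw [Finset.card_univ, Fintype.card_fin] at this
            exact (pow_le_pow_left₀ (norm_nonneg _) (norm_sum_le _ _) 2).trans this
          calc _ ≤ ‖(1 / N : ℝ)‖ ^ 2 *
                (N * ∑ j, ‖singleEst c ν h x (∇ h x - v) (u j)‖ ^ 2) := by gcongr
            _ = _ := by
                rw [Real.norm_of_nonneg (by positivity)]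
                field_simp
      _ = ∫ u, ‖singleEst c ν h x (∇ h x - v) u‖ ^ 2 ∂σ := by
          rw [integral_const_mul, integral_finsetSum _ fun j _ => (hXj j).norm.integrable_sq,
            Finset.sum_congr rfl fun j _ => hsq _ hX j]
          simp
          field_simp
      _ ≤ _ := hσ.integral_norm_singleEst_sq_le hd hC hM hν x _
  · intro h hC hM x hx
    obtain ⟨f1, f2⟩ := facts h hC hM x hx
    have : 0 ≤ ‖∇ h x‖ ^ 2 := by positivity
    linarith
  · intro h hC hM x hx
    obtain ⟨f1, -⟩ := facts h hC hM x hx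
    have hL := memLp_centralDiff (N := N) h8 hC hMF hM hν (c / N) x
    have i1 : Integrable (fun u => inner ℝ (∇ h x) (centralDiff (c / N) ν h x u))
        (Measure.pi fun _ : Fin N => σ) := (hL.integrable (by norm_num)).const_inner _
    have i2 : Integrable (fun u => ‖centralDiff (c / N) ν h x u‖ ^ 2)
        (Measure.pi fun _ : Fin N => σ) := hL.norm.integrable_sq
    have h1 : ∫ u, (1.5 * inner ℝ (∇ h x) (centralDiff (c / N) ν h x u) - 0.5625 * ‖∇ h x‖ ^ 2)
        ∂(Measure.pi fun _ : Fin N => σ) ≤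
        ∫ u, ‖centralDiff (c / N) ν h x u‖ ^ 2 ∂(Measure.pi fun _ : Fin N => σ) := by
      refine integral_mono ((i1.const_mul _).sub (integrable_const _)) i2 fun u => ?_
      -- Expanding this square linearizes `‖g‖²`; with the first fact, `1.5 · 0.75 - 0.75² =
      -- 0.5625`.
      have e1 : 0 ≤ ‖centralDiff (c / N) ν h x u - (0.75 : ℝ) • ∇ h x‖ ^ 2 := by positivity
      rw [norm_sub_sq_real, inner_smul_right, norm_smul, mul_pow,
        Real.norm_of_nonneg (by norm_num), real_inner_comm] at e1
      linarith
    rw [integral_sub (i1.const_mul _) (integrable_const _), integral_const_mul,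
      integral_const] at h1
    simp only [probReal_univ, one_smul] at h1
    linarith

end IndependentDirections

end DirectionBounds

/-! ### The five methods -/

section Methods

variable {d N : ℕ}

lemma rpow_quarter_pow_four {a : ℝ} (ha : 0 ≤ a) : (a ^ (1 / 4 : ℝ)) ^ 4 = a := by
  rw [← Real.rpow_natCast, ← Real.rpow_mul ha]
  norm_num

/-- The factor `(ν̂ / Ω₃) ^ 4`. -/
def radiusFactor (m : Method) (d N : ℕ) : ℝ :=
  match m with
  | .cFD | .cRC | .cRS => 1
  | .cGS => 2 * (N + 4.5 * d) / (72 * N * d + 216 * d ^ 2 + (d + 2) * (d + 4) * (d + 6))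
  | .cSS => 2 * d * (N + 4.5 * d) / (72 * N + 216 * d + d ^ 2)

lemma radiusFactor_pos (m : Method) (hd : 1 ≤ d) : 0 < radiusFactor m d N := by
  have : (0 : ℝ) < d := by positivity
  cases m <;> simp only [radiusFactor] <;> positivity

lemma radius_eq (m : Method) (d N : ℕ) (MF ε p : ℝ) : radius m d N MF ε p =
    radiusFactor m d N ^ (1 / 4 : ℝ) * (6 * ε * p / (MF ^ 2 * d)) ^ (1 / 4 : ℝ) := by
  cases m <;> simp [radius, radiusFactor]

lemma radius_pow_four (m : Method) (hd : 1 ≤ d) {MF ε p : ℝ} (hε : 0 ≤ ε) (hp : 0 ≤ p) :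
    radius m d N MF ε p ^ 4 = radiusFactor m d N * (6 * ε * p / (MF ^ 2 * d)) := by
  rw [radius_eq, mul_pow, rpow_quarter_pow_four (radiusFactor_pos m hd).le,
    rpow_quarter_pow_four (by positivity)]

lemma radius_pos (m : Method) (hd : 1 ≤ d) {MF ε p : ℝ} (hMF : 0 < MF) (hε : 0 < ε) (hp : 0 < p) :
    0 < radius m d N MF ε p := by
  have : (0 : ℝ) < d := by positivity
  rw [radius_eq]
  have := radiusFactor_pos m (N := N) hd
  positivity

/-- The quotient of the step size by `Ω₁`. -/
def stepFactor (m : Method) (d N : ℕ) : ℝ :=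
  match m with
  | .cFD => 1
  | .cGS | .cSS => N / (N + 4.5 * d)
  | .cRC | .cRS => N / d

lemma stepFactor_pos (m : Method) (hd : 1 ≤ d) (hN : 1 ≤ N) : 0 < stepFactor m d N := by
  have : (0 : ℝ) < d := by positivity
  have : (0 : ℝ) < N := by positivity
  cases m <;> simp only [stepFactor] <;> positivity

lemma stepSize_eq (m : Method) (d N : ℕ) (θ LF : ℝ) :
    stepSize m d N θ LF = stepFactor m d N * (1 / (4 * (1 + θ ^ 2) * LF)) := by
  cases m <;> simp [stepSize, stepFactor]

lemma orthonormal_single_comp {g : Fin N → Fin d} (hg : Function.Injective g) :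
    Orthonormal ℝ (fun j => EuclideanSpace.single (g j) (1 : ℝ)) :=
  (EuclideanSpace.orthonormal_single (𝕜 := ℝ) (ι := Fin d)).comp g hg

/-- Cyclic shifts of `Fin d` permute the embeddings; averaging over all shifts makes `σ j` uniformly
distributed. -/
lemma card_mul_sum_embedding (φ : Fin d → ℝ) (j : Fin N) :
    (d : ℝ) * ∑ σ : Fin N ↪ Fin d, φ (σ j) = Fintype.card (Fin N ↪ Fin d) * ∑ i, φ i := by
  rcases Nat.eq_zero_or_pos d with rfl | hd
  · have : IsEmpty (Fin N ↪ Fin 0) := ⟨fun σ => (σ j).elim0⟩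
    simp
  have : NeZero d := ⟨hd.ne'⟩
  have h1 : ∀ c : Fin d, ∑ σ : Fin N ↪ Fin d, φ (σ j) = ∑ σ : Fin N ↪ Fin d, φ (c + σ j) := by
    intro c
    symm
    exact Fintype.sum_equiv (Equiv.embeddingCongr (Equiv.refl _) (Equiv.addLeft c)) _ _
      fun σ => by simp
  calc (d : ℝ) * ∑ σ : Fin N ↪ Fin d, φ (σ j)
      = ∑ c : Fin d, ∑ σ : Fin N ↪ Fin d, φ (σ j) := by simp
    _ = ∑ c : Fin d, ∑ σ : Fin N ↪ Fin d, φ (c + σ j) := Finset.sum_congr rfl fun c _ => h1 c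
    _ = ∑ σ : Fin N ↪ Fin d, ∑ c : Fin d, φ (c + σ j) := Finset.sum_comm
    _ = ∑ σ : Fin N ↪ Fin d, ∑ i, φ i :=
        Finset.sum_congr rfl fun σ _ => Equiv.sum_comp (Equiv.addRight (σ j)) φ
    _ = _ := by simp

lemma isDirectionLaw_cRS_of_cFD {τ : Measure (Fin N → Vec d)} (hd : 1 ≤ d)
    (hτ : IsDirectionLaw .cFD d N τ) : IsDirectionLaw .cRS d N τ := by
  obtain ⟨rfl, rfl⟩ := hτ
  have hN : (N : ℝ) ≠ 0 := by positivity
  refine ⟨inferInstance, ?_, fun v => ?_⟩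
  · rw [ae_dirac_eq]
    exact orthonormal_single_comp (Fin.cast_injective rfl)
  · rw [integral_dirac, div_self hN, one_mul, EuclideanSpace.norm_sq_eq]
    simp [EuclideanSpace.inner_single_left]

lemma isDirectionLaw_cRS_of_cRC {τ : Measure (Fin N → Vec d)} (hd : 1 ≤ d)
    (hτ : IsDirectionLaw .cRC d N τ) : IsDirectionLaw .cRS d N τ := by
  obtain ⟨hNd, rfl⟩ := hτ
  have hd' : (d : ℝ) ≠ 0 := by positivity
  have hne : Nonempty (Fin N ↪ Fin d) := ⟨Fin.castLEEmb hNd⟩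
  have hc : (Fintype.card (Fin N ↪ Fin d) : ℝ≥0∞) ≠ 0 := by exact_mod_cast Fintype.card_ne_zero
  refine ⟨⟨?_⟩, ?_, fun v => ?_⟩
  · simp only [Measure.smul_apply, Measure.coe_finsetSum, Finset.sum_apply, measure_univ,
      Finset.sum_const, Finset.card_univ, smul_eq_mul, nsmul_eq_mul, mul_one]
    exact ENNReal.inv_mul_cancel hc (ENNReal.natCast_ne_top _)
  · refine Measure.ae_smul_measure ?_ _
    rw [ae_iff, Measure.coe_finsetSum, Finset.sum_apply]
    refine Finset.sum_eq_zero fun σ _ => ?_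
    rw [← ae_iff, ae_dirac_eq]
    exact orthonormal_single_comp σ.injective
  · have hcR : (Fintype.card (Fin N ↪ Fin d) : ℝ) ≠ 0 := by exact_mod_cast Fintype.card_ne_zero
    rw [integral_smul_measure, integral_finsetSum_measure fun σ _ => ?_]
    · simp only [integral_dirac, EuclideanSpace.inner_single_left, map_one, one_mul]
      rw [Finset.sum_comm, ENNReal.toReal_inv, ENNReal.toReal_natCast, smul_eq_mul,
        EuclideanSpace.norm_sq_eq]
      have h1 : ∀ j : Fin N, ∑ σ : Fin N ↪ Fin d, v (σ j) ^ 2 =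
          Fintype.card (Fin N ↪ Fin d) * (∑ i, v i ^ 2) / d := fun j => by
        rw [← card_mul_sum_embedding (fun i => v i ^ 2) j]
        field_simp
      rw [Finset.sum_congr rfl fun j _ => h1 j]
      simp only [Finset.sum_const, Finset.card_univ, Fintype.card_fin, nsmul_eq_mul,
        Real.norm_eq_abs, sq_abs]
      field_simp
    · exact integrable_dirac (by simp)

/-- The sampling variance bound that limits the sample sizes. -/
def SizeBound (m : Method) (d : ℕ) (θ ε ν S S' lam : ℝ) : Prop :=
  ∀ Mf β₁ β₂ G : ℝ, 0 ≤ β₁ → 0 ≤ β₂ → ε < G →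
    4 / 3 * S * (β₁ * G + β₂) + 4 * S' * (Mf ^ 2 * ν ^ 4 / 36) ≤
      lam * G * (θ ^ 2 * (b₁ m d θ β₁ - 1 + 4 * b₂ m d θ Mf β₁ β₂ ν / ε))

/-- Terms proportional to `G` are matched with `b₁ - 1`. Constant terms are matched with `b₂` after
multiplication by `G/ε ≥ 1`, which is the source of the quotient `b₂/ε`. -/
lemma sizeBound_of_le {m : Method} {θ ε ν S S' lam : ℝ} (hε : 0 < ε)
    (hlam : 0 ≤ lam)
    (h : ∀ Mf β₁ β₂ : ℝ, 0 ≤ β₁ → 0 ≤ β₂ →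
      4 / 3 * S * β₁ ≤ lam * (θ ^ 2 * (b₁ m d θ β₁ - 1)) ∧
      4 / 3 * S * β₂ + 4 * S' * (Mf ^ 2 * ν ^ 4 / 36) ≤
        lam * (4 * (θ ^ 2 * b₂ m d θ Mf β₁ β₂ ν)) ∧ 0 ≤ θ ^ 2 * b₂ m d θ Mf β₁ β₂ ν) :
    SizeBound m d θ ε ν S S' lam := by
  intro Mf β₁ β₂ G hβ₁ hβ₂ hG
  obtain ⟨h1, h2, h3⟩ := h Mf β₁ β₂ hβ₁ hβ₂
  have hG0 : 0 < G := hε.trans hG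
  have h4 : (1 : ℝ) ≤ G / ε := by rw [le_div_iff₀ hε]; linarith
  calc _ = 4 / 3 * S * β₁ * G + (4 / 3 * S * β₂ + 4 * S' * (Mf ^ 2 * ν ^ 4 / 36)) := by ring
    _ ≤ lam * (θ ^ 2 * (b₁ m d θ β₁ - 1)) * G +
        lam * (4 * (θ ^ 2 * b₂ m d θ Mf β₁ β₂ ν)) * (G / ε) := by
      have : 0 ≤ lam * (4 * (θ ^ 2 * b₂ m d θ Mf β₁ β₂ ν)) := by positivity
      gcongr
      nlinarith
    _ = _ := by ring

lemma directionBounds_cRS {τ : Measure (Fin N → Vec d)} (hd : 1 ≤ d) (hN : 1 ≤ N)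
    (hτ : IsDirectionLaw .cRS d N τ) {ν MF ε p : ℝ} (hν : 0 < ν) (hMF : 0 < MF) (hε : 0 < ε)
    (hp1 : p ≤ 1) (hν4 : ν ^ 4 = 6 * ε * p / (MF ^ 2 * d)) :
    DirectionBounds τ (d / N) ν MF ε (N / d) (d / N) (d / N * d) (0.35 * (d / N)) := by
  obtain ⟨h1, h2, h3⟩ := hτ
  refine directionBounds_of_orthonormal hd hN h2 h3 hν hMF.le ?_
  have hd' : (0 : ℝ) < d := by positivity
  -- The radius gives `d MF² ν⁴ / 36 = ε p / 6`, so the condition reads `ε p ≤ ε`.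
  rw [hν4]
  field_simp
  linarith

lemma sizeBound_orthonormal {m : Method} (hm : m = .cFD ∨ m = .cRC ∨ m = .cRS) (hd : 1 ≤ d)
    (hN : 1 ≤ N) {θ ε ν : ℝ} (hθ : 0 < θ) (hε : 0 < ε) :
    SizeBound m d θ ε ν (d / N) (d / N * d) (0.35 * (d / N)) := by
  have hd' : (0 : ℝ) < d := by positivity
  have hN' : (0 : ℝ) < N := by positivity
  refine sizeBound_of_le hε (by positivity) fun Mf β₁ β₂ hβ₁ hβ₂ => ?_
  have e1 : b₁ m d θ β₁ = 1 + 4 * β₁ / θ ^ 2 := by rcases hm with rfl | rfl | rfl <;> rfl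
  have e2 : b₂ m d θ Mf β₁ β₂ ν =
      (2 + β₁) * Mf ^ 2 * ν ^ 4 * d / (9 * θ ^ 2) + 2 * β₂ / θ ^ 2 := by
    rcases hm with rfl | rfl | rfl <;> rfl
  have e3 : θ ^ 2 * (1 + 4 * β₁ / θ ^ 2 - 1) = 4 * β₁ := by field_simp; ring
  have e4 : θ ^ 2 * ((2 + β₁) * Mf ^ 2 * ν ^ 4 * d / (9 * θ ^ 2) + 2 * β₂ / θ ^ 2) =
      (2 + β₁) * (Mf ^ 2 * ν ^ 4 * d) / 9 + 2 * β₂ := by field_simp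
  rw [e1, e2, e3, e4]
  have hQ : 0 ≤ Mf ^ 2 * ν ^ 4 * d := by positivity
  have hQ' : 0 ≤ β₁ * (Mf ^ 2 * ν ^ 4 * d) := by positivity
  refine ⟨?_, ?_, by positivity⟩
  · calc _ = (d / N : ℝ) * (4 / 3 * β₁) := by ring
      _ ≤ (d / N : ℝ) * (1.4 * β₁) := by gcongr; norm_num
      _ = _ := by ring
  · calc _ = (d / N : ℝ) * (4 / 3 * β₂ + Mf ^ 2 * ν ^ 4 * d / 9) := by ring
      _ ≤ (d / N : ℝ) * (1.4 * ((2 + β₁) * (Mf ^ 2 * ν ^ 4 * d) / 9 + 2 * β₂)) := by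
        gcongr; linarith
      _ = _ := by ring

lemma directionBounds_cGS (hd : 1 ≤ d) (hN : 1 ≤ N) {ν MF ε p : ℝ} (hν : 0 < ν) (hMF : 0 < MF)
    (hε : 0 < ε) (hp1 : p ≤ 1)
    (hν4 : ν ^ 4 = radiusFactor .cGS d N * (6 * ε * p / (MF ^ 2 * d))) :
    DirectionBounds (Measure.pi fun _ : Fin N => stdGaussian (Vec d)) (1 / N) ν MF ε
      (N / (N + 4.5 * d)) (d + 2) (d * (d + 2) * (d + 4) * (d + 6)) 0.5625 := by
  have hd' : (1 : ℝ) ≤ d := by exact_mod_cast hd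
  have hN' : (0 : ℝ) < N := by positivity
  have hm : MF ^ 2 * ν ^ 4 = 12 * (N + 4.5 * d) * ε * p /
      (d * (72 * N * d + 216 * d ^ 2 + (d + 2) * (d + 4) * (d + 6))) := by
    rw [hν4, radiusFactor]
    field_simp
    ring
  have hb : (MF * ν ^ 2 / 2 * d) ^ 2 = MF ^ 2 * ν ^ 4 * d ^ 2 / 4 := by ring
  refine directionBounds_pi (momentBounds_stdGaussian hd) hd hN hν hMF.le (by linarith) ?_ ?_
  · rw [hb, hm]
    have hD : (0 : ℝ) < 72 * N * d + 216 * d ^ 2 + (d + 2) * (d + 4) * (d + 6) := by positivity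
    have e1 : 16 * (12 * (N + 4.5 * d) * ε * p /
        (d * (72 * N * d + 216 * d ^ 2 + (d + 2) * (d + 4) * (d + 6))) * d ^ 2 / 4) =
        (48 * d * (N + 4.5 * d)) * (ε * p) /
          (72 * N * d + 216 * d ^ 2 + (d + 2) * (d + 4) * (d + 6) : ℝ) := by
      field_simp
      ring
    rw [e1, div_le_iff₀ hD]
    have h1 : ε * p ≤ ε := by nlinarith
    -- The term `216 d²` in the radius is `48 · 4.5 d²`, dictated by the bias condition; `72 N d`
    -- covers the remaining `48 N d`.
    have h2 : (48 * d * (N + 4.5 * d) : ℝ) ≤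
        72 * N * d + 216 * d ^ 2 + (d + 2) * (d + 4) * (d + 6) := by
      have : (0 : ℝ) ≤ (d + 2) * (d + 4) * (d + 6) := by positivity
      nlinarith [mul_pos hN' (by linarith : (0 : ℝ) < d)]
    calc _ ≤ (48 * d * (N + 4.5 * d)) * ε := by gcongr
      _ = ε * (48 * d * (N + 4.5 * d)) := mul_comm _ _
      _ ≤ _ := by gcongr
  · rw [hb, hm]
    have hD : (0 : ℝ) < 72 * N * d + 216 * d ^ 2 + (d + 2) * (d + 4) * (d + 6) := by positivity
    -- The numerator `2 (N + 4.5 d)` of the radius factor supplies the right side of the variance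
    -- condition; the quotient left over is at most `1`.
    have e1 : (4 * (d * (d + 2) * (d + 4) * (d + 6) * (12 * (N + 4.5 * d) * ε * p /
          (d * (72 * N * d + 216 * d ^ 2 + (d + 2) * (d + 4) * (d + 6))) / 36) +
          N * (12 * (N + 4.5 * d) * ε * p /
          (d * (72 * N * d + 216 * d ^ 2 + (d + 2) * (d + 4) * (d + 6))) * d ^ 2 / 4)) : ℝ) =
        4 / 3 * (N + 4.5 * d) * ((ε * p) *
          (((d + 2) * (d + 4) * (d + 6) + 9 * N * d) /
          (72 * N * d + 216 * d ^ 2 + (d + 2) * (d + 4) * (d + 6)))) := by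
      field_simp
      ring
    rw [e1]
    gcongr
    have h1 : ε * p ≤ ε := by nlinarith
    have h2 : ((d + 2) * (d + 4) * (d + 6) + 9 * N * d) /
          (72 * N * d + 216 * d ^ 2 + (d + 2) * (d + 4) * (d + 6)) ≤ (1 : ℝ) := by
      rw [div_le_one hD]
      nlinarith [mul_pos hN' (by linarith : (0 : ℝ) < d)]
    calc _ ≤ ε * 1 := by gcongr
      _ = ε := mul_one ε

lemma directionBounds_cSS (hd : 1 ≤ d) (hN : 1 ≤ N) {ν MF ε p : ℝ} (hν : 0 < ν) (hMF : 0 < MF)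
    (hε : 0 < ε) (hp1 : p ≤ 1)
    (hν4 : ν ^ 4 = radiusFactor .cSS d N * (6 * ε * p / (MF ^ 2 * d))) :
    DirectionBounds (Measure.pi fun _ : Fin N => uniformSphere d) (d / N) ν MF ε
      (N / (N + 4.5 * d)) d (d ^ 2) 0.5625 := by
  have hd' : (1 : ℝ) ≤ d := by exact_mod_cast hd
  have hN' : (0 : ℝ) < N := by positivity
  have hm : MF ^ 2 * ν ^ 4 = 12 * (N + 4.5 * d) * ε * p / (72 * N + 216 * d + d ^ 2) := by
    rw [hν4, radiusFactor]
    field_simp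
    ring
  have hb : (MF * ν ^ 2 / 2 * 1) ^ 2 = MF ^ 2 * ν ^ 4 / 4 := by ring
  have hD : (0 : ℝ) < 72 * N + 216 * d + d ^ 2 := by positivity
  have h1 : ε * p ≤ ε := by nlinarith
  refine directionBounds_pi (momentBounds_uniformSphere hd) hd hN hν hMF.le (by linarith) ?_ ?_
  · rw [hb, hm]
    have e1 : 16 * (12 * (N + 4.5 * d) * ε * p / (72 * N + 216 * d + d ^ 2) / 4) =
        (48 * (N + 4.5 * d)) * (ε * p) / (72 * N + 216 * d + d ^ 2 : ℝ) := by
      field_simp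
      ring
    rw [e1, div_le_iff₀ hD]
    have h2 : (48 * (N + 4.5 * d) : ℝ) ≤ 72 * N + 216 * d + d ^ 2 := by nlinarith
    calc _ ≤ (48 * (N + 4.5 * d)) * ε := by gcongr
      _ = ε * (48 * (N + 4.5 * d)) := mul_comm _ _
      _ ≤ _ := by gcongr
  · rw [hb, hm]
    have e1 : (4 * (d ^ 2 * (12 * (N + 4.5 * d) * ε * p / (72 * N + 216 * d + d ^ 2) / 36) +
          N * (12 * (N + 4.5 * d) * ε * p / (72 * N + 216 * d + d ^ 2) / 4)) : ℝ) =
        4 / 3 * (N + 4.5 * d) * ((ε * p) *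
          ((d ^ 2 + 9 * N) / (72 * N + 216 * d + d ^ 2))) := by
      field_simp
      ring
    rw [e1]
    gcongr
    have h2 : (d ^ 2 + 9 * N) / (72 * N + 216 * d + d ^ 2) ≤ (1 : ℝ) := by
      rw [div_le_one hD]
      nlinarith
    calc _ ≤ ε * 1 := by gcongr
      _ = ε := mul_one ε

lemma sizeBound_cGS (hd : 1 ≤ d) {θ ε ν : ℝ} (hθ : 0 < θ) (hε : 0 < ε) :
    SizeBound .cGS d θ ε ν (d + 2) (d * (d + 2) * (d + 4) * (d + 6)) 0.5625 := by
  have hd' : (1 : ℝ) ≤ d := by exact_mod_cast hd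
  refine sizeBound_of_le hε (by positivity) fun Mf β₁ β₂ hβ₁ hβ₂ => ?_
  have e1 : θ ^ 2 * (b₁ .cGS d θ β₁ - 1) = 4 * ((d + 2) * β₁) := by
    simp only [b₁]; field_simp; ring
  have e2 : θ ^ 2 * b₂ .cGS d θ Mf β₁ β₂ ν = 2 * ((d + 2) * β₂) +
      2 * (Mf ^ 2 * ν ^ 4 * (d * (d + 2) * (d + 4) * (d + 6))) / 9 +
      4 * (Mf ^ 2 * ν ^ 4 * d * (d + 2) * β₁ * d) := by
    simp only [b₂]; field_simp; ring
  rw [e1, e2]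
  have h1 : 0 ≤ (d + 2) * β₁ := by positivity
  have h2 : 0 ≤ (d + 2) * β₂ := by positivity
  have h3 : 0 ≤ Mf ^ 2 * ν ^ 4 * (d * (d + 2) * (d + 4) * (d + 6)) := by positivity
  have h4 : 0 ≤ Mf ^ 2 * ν ^ 4 * d * (d + 2) * β₁ * d := by positivity
  refine ⟨by linarith, by linarith, by positivity⟩

lemma sizeBound_cSS {θ ε ν : ℝ} (hθ : 0 < θ) (hε : 0 < ε) :
    SizeBound .cSS d θ ε ν d (d ^ 2) 0.5625 := by
  refine sizeBound_of_le hε (by positivity) fun Mf β₁ β₂ hβ₁ hβ₂ => ?_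
  have e1 : θ ^ 2 * (b₁ .cSS d θ β₁ - 1) = 4 * (d * β₁) := by
    simp only [b₁]; field_simp; ring
  have e2 : θ ^ 2 * b₂ .cSS d θ Mf β₁ β₂ ν = 2 * (d * β₂) +
      2 * (Mf ^ 2 * ν ^ 4 * d ^ 2) / 9 + 4 * (Mf ^ 2 * ν ^ 4 * d * β₁) := by
    simp only [b₂]; field_simp; ring
  rw [e1, e2]
  have h1 : 0 ≤ d * β₁ := by positivity
  have h2 : 0 ≤ d * β₂ := by positivity
  have h3 : 0 ≤ Mf ^ 2 * ν ^ 4 * d ^ 2 := by positivity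
  have h4 : 0 ≤ Mf ^ 2 * ν ^ 4 * d * β₁ := by positivity
  refine ⟨by linarith, by linarith, by positivity⟩

lemma exists_directionBounds {m : Method} {τ : Measure (Fin N → Vec d)} (hd : 1 ≤ d) (hN : 1 ≤ N)
    (hτ : IsDirectionLaw m d N τ) {θ MF ε p : ℝ} (hθ : 0 < θ) (hMF : 0 < MF) (hε : 0 < ε)
    (hp : 0 < p) (hp1 : p ≤ 1) :
    ∃ S S' lam : ℝ, 0 ≤ S ∧ 0 ≤ S' ∧ 0 < lam ∧
      DirectionBounds τ (scaling m d N) (radius m d N MF ε p) MF ε (stepFactor m d N) S S' lam ∧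
      SizeBound m d θ ε (radius m d N MF ε p) S S' lam := by
  have hd' : (0 : ℝ) < d := by positivity
  have hN' : (0 : ℝ) < N := by positivity
  have hν := radius_pos m (N := N) hd hMF hε hp
  have hν4 := radius_pow_four m (N := N) (MF := MF) hd hε.le hp.le
  have hlam : (0 : ℝ) < 0.35 * (d / N) := by positivity
  cases m with
  | cFD =>
    have h := directionBounds_cRS hd hN (isDirectionLaw_cRS_of_cFD hd hτ) hν hMF hε hp1
      (by rw [hν4, radiusFactor, one_mul])
    obtain ⟨rfl, -⟩ := hτ
    -- As `N = d`, the cRS scaling and step factor reduce to those of cFD.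
    have h1 : (N / N : ℝ) = 1 := div_self hN'.ne'
    refine ⟨_, _, _, by positivity, by positivity, hlam, ?_, sizeBound_orthonormal (.inl rfl) hd hN hθ hε⟩
    simpa only [scaling, stepFactor, h1] using h
  | cGS =>
    obtain rfl := hτ
    exact ⟨_, _, _, by positivity, by positivity, by norm_num,
      directionBounds_cGS hd hN hν hMF hε hp1 hν4, sizeBound_cGS hd hθ hε⟩
  | cSS =>
    obtain rfl := hτ
    exact ⟨_, _, _, by positivity, by positivity, by norm_num,
      directionBounds_cSS hd hN hν hMF hε hp1 hν4, sizeBound_cSS hθ hε⟩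
  | cRC =>
    exact ⟨_, _, _, by positivity, by positivity, hlam,
      directionBounds_cRS hd hN (isDirectionLaw_cRS_of_cRC hd hτ) hν hMF hε hp1
      (by rw [hν4, radiusFactor, one_mul]), sizeBound_orthonormal (.inr (.inl rfl)) hd hN hθ hε⟩
  | cRS =>
    exact ⟨_, _, _, by positivity, by positivity, hlam,
      directionBounds_cRS hd hN hτ hν hMF hε hp1
      (by rw [hν4, radiusFactor, one_mul]), sizeBound_orthonormal (.inr (.inr rfl)) hd hN hθ hε⟩

end Methods

/-! ### Sampling -/

section Sampling

variable {d N : ℕ} {Ξ : Type*} [MeasurableSpace Ξ] {μ : Measure Ξ} {f : Vec d → Ξ → ℝ}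
  {Lf Mf β₁ β₂ : ℝ}

lemma integral_norm_sub_integral_sq {Ω E : Type*} [MeasurableSpace Ω] {P : Measure Ω}
    [IsProbabilityMeasure P] [NormedAddCommGroup E] [InnerProductSpace ℝ E] [CompleteSpace E]
    {X : Ω → E} (hX : MemLp X 2 P) (a : E) :
    ∫ ω, ‖X ω - a‖ ^ 2 ∂P =
      ∫ ω, ‖X ω - ∫ ω', X ω' ∂P‖ ^ 2 ∂P + ‖(∫ ω, X ω ∂P) - a‖ ^ 2 := by
  set e := ∫ ω, X ω ∂P with he
  have hXi : Integrable X P := hX.integrable (by norm_num)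
  have h1 : ∀ ω, ‖X ω - a‖ ^ 2 = ‖X ω - e‖ ^ 2 + (2 * inner ℝ (e - a) (X ω - e) + ‖e - a‖ ^ 2) := by
    intro ω
    have : X ω - a = (e - a) + (X ω - e) := by abel
    rw [this, norm_add_sq_real]; ring
  have i1 : Integrable (fun ω => ‖X ω - e‖ ^ 2) P :=
    (hX.sub (memLp_const e)).norm.integrable_sq
  have i2 : Integrable (fun ω => X ω - e) P := hXi.sub (integrable_const e)
  have i3 : Integrable (fun ω => 2 * inner ℝ (e - a) (X ω - e) + ‖e - a‖ ^ 2) P :=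
    ((i2.const_inner _).const_mul _).add (integrable_const _)
  simp_rw [h1]
  rw [integral_add i1 i3, integral_add ((i2.const_inner _).const_mul _) (integrable_const _), integral_const_mul,
    integral_inner i2, integral_sub hXi (integrable_const e)]
  simp [he]

lemma SmoothAssumption.measurable_uncurry (hS : SmoothAssumption μ f Lf Mf) :
    Measurable (fun q : Vec d × Ξ => f q.1 q.2) :=
  measurable_uncurry_of_continuous_of_measurable (fun z => (hS.contDiff z).continuous) hS.measurable

/-- Each directional derivative is a pointwise limit of difference quotients with steps `1/(n+1)`,
measurable in the sample; the gradient is assembled from its coordinates. -/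
lemma SmoothAssumption.measurable_gradient (hS : SmoothAssumption μ f Lf Mf) (x : Vec d) :
    Measurable (fun z => ∇ (fun y => f y z) x) := by
  have h1 : ∀ v : Vec d, Measurable (fun z => inner ℝ (∇ (fun y => f y z) x) v) := by
    intro v
    refine measurable_of_tendsto_metrizable (f := fun (n : ℕ) z =>
      ((1 / (n + 1) : ℝ))⁻¹ • (f (x + (0 + 1 / (n + 1) : ℝ) • v) z - f (x + (0 : ℝ) • v) z))
      (fun n => Measurable.fun_const_smul
        (Measurable.fun_sub (hS.measurable _) (hS.measurable _)) _) ?_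
    rw [tendsto_pi_nhds]
    intro z
    have h2 := hasDerivAt_comp_line (hS.contDiff z) x v 0
    rw [zero_smul, add_zero] at h2
    refine h2.tendsto_slope_zero.comp ?_
    refine tendsto_nhdsWithin_iff.2 ⟨tendsto_one_div_add_atTop_nhds_zero_nat, ?_⟩
    exact Eventually.of_forall fun n => by
      have : (0 : ℝ) < 1 / (n + 1) := by positivity
      exact this.ne'
  have h2 : (fun z => ∇ (fun y => f y z) x) = fun z =>
      ∑ i, (inner ℝ (∇ (fun y => f y z) x) (EuclideanSpace.single i (1 : ℝ)) : ℝ) •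
        EuclideanSpace.single i (1 : ℝ) := by
    ext z : 1
    conv_lhs => rw [← (EuclideanSpace.basisFun (Fin d) ℝ).sum_repr (∇ (fun y => f y z) x)]
    simp only [EuclideanSpace.basisFun_repr, EuclideanSpace.basisFun_apply,
      EuclideanSpace.inner_single_right, conj_trivial, one_mul]
  rw [h2]
  exact Finset.measurable_fun_sum _ fun i _ => (h1 _).smul_const _

lemma nonneg_of_hessLipschitz (hd : 1 ≤ d) {h : Vec d → ℝ} {M : ℝ} (hM : HessLipschitz h M) :
    0 ≤ M := by
  have h1 := hM (EuclideanSpace.single ⟨0, hd⟩ 1) 0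
  rw [sub_zero, PiLp.norm_single] at h1
  simpa using (norm_nonneg _).trans h1

lemma SmoothAssumption.integrable_norm_gradient_sq [IsProbabilityMeasure μ]
    (hS : SmoothAssumption μ f Lf Mf)
    (hV : VarianceAssumption μ f β₁ β₂) (x : Vec d) :
    Integrable (fun z => ‖∇ (fun y => f y z) x‖ ^ 2) μ := by
  refine (((hV x).1.const_mul 2).add
    (integrable_const (2 * ‖∇ (objective μ f) x‖ ^ 2))).mono'
    ((hS.measurable_gradient x).norm.pow_const 2).aestronglyMeasurable
    (Eventually.of_forall fun z => ?_)
  rw [Real.norm_of_nonneg (by positivity)]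
  have h1 := norm_le_norm_add_norm_sub' (∇ (fun y => f y z) x) (∇ (objective μ f) x)
  have h2 := pow_le_pow_left₀ (norm_nonneg _) h1 2
  simp only [Pi.add_apply]
  nlinarith [sq_nonneg (‖∇ (objective μ f) x‖ - ‖∇ (fun y => f y z) x - ∇ (objective μ f) x‖)]

lemma SmoothAssumption.measurable_sampleEst (hS : SmoothAssumption μ f Lf Mf) (γ ν : ℝ)
    (x : Vec d) :
    Measurable (fun q : (Fin N → Vec d) × Ξ => sampleEst f γ ν q.2 x q.1) := by
  have hf := hS.measurable_uncurry
  unfold sampleEst centralDiff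
  refine Measurable.fun_const_smul
    (Finset.measurable_fun_sum _ fun j _ => Measurable.fun_smul ?_ (by fun_prop)) γ
  have m1 : Measurable (fun q : (Fin N → Vec d) × Ξ => f (x + ν • q.1 j) q.2) :=
    hf.comp (by fun_prop : Measurable fun q : (Fin N → Vec d) × Ξ => (x + ν • q.1 j, q.2))
  have m2 : Measurable (fun q : (Fin N → Vec d) × Ξ => f (x - ν • q.1 j) q.2) :=
    hf.comp (by fun_prop : Measurable fun q : (Fin N → Vec d) × Ξ => (x - ν • q.1 j, q.2))
  exact (Measurable.fun_sub m1 m2).div_const _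

lemma SmoothAssumption.measurable_sampleEst_left (hS : SmoothAssumption μ f Lf Mf) (γ ν : ℝ)
    (x : Vec d) (u : Fin N → Vec d) : Measurable (fun z => sampleEst f γ ν z x u) := by
  have h1 : Measurable (fun z : Ξ => (u, z)) := measurable_prodMk_left
  have h2 := hS.measurable_sampleEst (N := N) γ ν x
  have h3 := h2.comp h1
  exact h3

lemma SmoothAssumption.norm_sampleEst_sq_le (hS : SmoothAssumption μ f Lf Mf) (hd : 1 ≤ d)
    {ν : ℝ} (hν : 0 < ν) (γ : ℝ) (x : Vec d) (u : Fin N → Vec d) (z : Ξ) :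
    ‖sampleEst f γ ν z x u‖ ^ 2 ≤ dirWeight u ^ 2 *
      (γ ^ 2 * (2 * ‖∇ (fun y => f y z) x‖ ^ 2 + 2 * (Mf * ν ^ 2 / 6) ^ 2)) := by
  have h1 := norm_centralDiff_le (hS.contDiff z) (nonneg_of_hessLipschitz hd (hS.hessLipschitz z))
    (hS.hessLipschitz z) hν γ x u
  have h2 := pow_le_pow_left₀ (norm_nonneg _) h1 2
  refine h2.trans ?_
  rw [mul_pow, mul_pow, sq_abs, mul_comm]
  gcongr
  nlinarith [sq_nonneg (‖∇ (fun y => f y z) x‖ - Mf * ν ^ 2 / 6)]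

/-- By linearity `g_T` is the estimator of `F`, so the descent and lower bounds apply to it with
`MF` in place of `Mf`. -/
lemma SmoothAssumption.meanEst_eq (hS : SmoothAssumption μ f Lf Mf) (γ ν : ℝ) (x : Vec d)
    (u : Fin N → Vec d) : meanEst μ f γ ν x u = centralDiff γ ν (objective μ f) x u := by
  unfold meanEst sampleEst centralDiff
  have hi : ∀ j, Integrable (fun z => (f (x + ν • u j) z - f (x - ν • u j) z) / (2 * ν)) μ :=
    fun j => ((hS.integrable _).sub (hS.integrable _)).div_const _
  rw [integral_smul, integral_finsetSum _ fun j _ => (hi j).smul_const _]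
  congr 1
  refine Finset.sum_congr rfl fun j _ => ?_
  rw [integral_smul_const, integral_div, integral_sub (hS.integrable _) (hS.integrable _)]
  rfl

lemma batchEst_eq {Ξ : Type*} (f : Vec d → Ξ → ℝ) (γ ν : ℝ) (n : ℕ) (ζ : ℕ → Ξ) (x : Vec d)
    (u : Fin N → Vec d) :
    batchEst f γ ν n ζ x u = (1 / n : ℝ) • ∑ i ∈ Finset.range n, sampleEst f γ ν (ζ i) x u := by
  unfold batchEst sampleEst centralDiff batchMean
  rw [← Finset.smul_sum, smul_comm, Finset.sum_comm]
  congr 1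
  rw [Finset.smul_sum]
  refine Finset.sum_congr rfl fun j _ => ?_
  rw [← Finset.sum_smul, smul_smul]
  congr 1
  rw [← mul_sub, ← Finset.sum_sub_distrib, mul_div_assoc, Finset.sum_div]

lemma SmoothAssumption.measurable_batchEst (hS : SmoothAssumption μ f Lf Mf) (γ ν : ℝ) :
    Measurable (fun q : (Vec d × ℕ) × ((Fin N → Vec d) × (ℕ → Ξ)) =>
      batchEst f γ ν q.1.2 q.2.2 q.1.1 q.2.1) := by
  have hf := hS.measurable_uncurry
  have hb : ∀ n, Measurable (fun q : Vec d × (ℕ → Ξ) => batchMean f n q.2 q.1) := by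
    intro n
    have h1 : ∀ i, Measurable (fun q : Vec d × (ℕ → Ξ) => f q.1 (q.2 i)) := by
      intro i
      have h2 : Measurable fun q : Vec d × (ℕ → Ξ) => (q.1, q.2 i) := by fun_prop
      exact hf.comp h2
    unfold batchMean
    exact Measurable.const_mul (Finset.measurable_fun_sum _ fun i _ => h1 i) _
  have hn : ∀ n : ℕ, Measurable (fun q : (Vec d × ℕ) × ((Fin N → Vec d) × (ℕ → Ξ)) =>
      batchEst f γ ν n q.2.2 q.1.1 q.2.1) := by
    intro n
    have m1 : ∀ (a : ℝ) (j : Fin N),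
        Measurable (fun q : (Vec d × ℕ) × ((Fin N → Vec d) × (ℕ → Ξ)) =>
          batchMean f n q.2.2 (q.1.1 + a • q.2.1 j)) := by
      intro a j
      have h2 : Measurable fun q : (Vec d × ℕ) × ((Fin N → Vec d) × (ℕ → Ξ)) =>
        (q.1.1 + a • q.2.1 j, q.2.2) := by fun_prop
      have h3 := hb n
      have h4 := h3.comp h2
      exact h4
    unfold batchEst centralDiff
    refine Measurable.fun_const_smul
      (Finset.measurable_fun_sum _ fun j _ => Measurable.fun_smul ?_ (by fun_prop)) γ
    have m2 := m1 (-ν) j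
    simp only [neg_smul, ← sub_eq_add_neg] at m2
    exact Measurable.div_const (Measurable.fun_sub (m1 ν j) m2) _
  -- The sample size ranges over a countable type, so measurability for each fixed size gives joint
  -- measurability.
  have h2 : Measurable (fun w : ((Vec d × ℕ) × ((Fin N → Vec d) × (ℕ → Ξ))) × ℕ =>
      batchEst f γ ν w.2 w.1.2.2 w.1.1.1 w.1.2.1) := measurable_from_prod_countable_left hn
  have h3 : Measurable fun q : (Vec d × ℕ) × ((Fin N → Vec d) × (ℕ → Ξ)) => (q, q.1.2) := by
    fun_prop
  have h4 := h2.comp h3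
  exact h4

variable {τ : Measure (Fin N → Vec d)} {γ ν MF ε ρ S S' lam : ℝ}

lemma SmoothAssumption.memLp_meanEst (hS : SmoothAssumption μ f Lf Mf)
    (hF : HessLipschitz (objective μ f) MF) (hMF : 0 ≤ MF)
    (hν : 0 < ν) (hD : DirectionBounds τ γ ν MF ε ρ S S' lam) (x : Vec d) :
    MemLp (meanEst μ f γ ν x) 2 τ := by
  have := hD.isProbabilityMeasure
  have h1 : meanEst μ f γ ν x = centralDiff (N := N) γ ν (objective μ f) x := by
    ext u : 1
    exact hS.meanEst_eq γ ν x u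
  rw [h1]
  exact memLp_centralDiff hD.integrable hS.contDiff_objective hMF hF hν γ x

lemma SmoothAssumption.integral_norm_meanEst_sq_ge (hS : SmoothAssumption μ f Lf Mf)
    (hF : HessLipschitz (objective μ f) MF)
    (hD : DirectionBounds τ γ ν MF ε ρ S S' lam) {x : Vec d}
    (hx : ε < ‖∇ (objective μ f) x‖ ^ 2) :
    lam * ‖∇ (objective μ f) x‖ ^ 2 ≤ ∫ u, ‖meanEst μ f γ ν x u‖ ^ 2 ∂τ := by
  simp_rw [hS.meanEst_eq]
  exact hD.lower _ hS.contDiff_objective hF x hx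

variable [IsProbabilityMeasure μ]

lemma SmoothAssumption.memLp_sampleEst (hS : SmoothAssumption μ f Lf Mf) (hd : 1 ≤ d)
    (hV : VarianceAssumption μ f β₁ β₂) {ν : ℝ} (hν : 0 < ν) (γ : ℝ) (x : Vec d)
    (u : Fin N → Vec d) : MemLp (fun z => sampleEst f γ ν z x u) 2 μ := by
  have hm := hS.measurable_sampleEst_left γ ν x u
  rw [memLp_two_iff_integrable_sq_norm hm.aestronglyMeasurable]
  have hb : Integrable (fun z => dirWeight u ^ 2 * (γ ^ 2 * (2 * ‖∇ (fun y => f y z) x‖ ^ 2 +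
      2 * (Mf * ν ^ 2 / 6) ^ 2))) μ :=
    ((((hS.integrable_norm_gradient_sq hV x).const_mul 2).fun_add
      (integrable_const _)).const_mul _).const_mul _
  refine hb.mono' (hm.norm.pow_const 2).aestronglyMeasurable (Eventually.of_forall fun z => ?_)
  rw [Real.norm_of_nonneg (by positivity)]
  exact hS.norm_sampleEst_sq_le hd hν γ x u z

lemma SmoothAssumption.memLp_sampleEst_prod (hS : SmoothAssumption μ f Lf Mf) (hd : 1 ≤ d)
    (hV : VarianceAssumption μ f β₁ β₂) {ν : ℝ} (hν : 0 < ν) (γ : ℝ) (x : Vec d)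
    {τ : Measure (Fin N → Vec d)} [IsProbabilityMeasure τ]
    (hτ : ∀ j, Integrable (fun u => ‖u j‖ ^ 8) τ) :
    MemLp (fun q : (Fin N → Vec d) × Ξ => sampleEst f γ ν q.2 x q.1) 2 (τ.prod μ) := by
  have hm := hS.measurable_sampleEst (N := N) γ ν x
  rw [memLp_two_iff_integrable_sq_norm hm.aestronglyMeasurable]
  have hb : Integrable (fun z => γ ^ 2 * (2 * ‖∇ (fun y => f y z) x‖ ^ 2 +
      2 * (Mf * ν ^ 2 / 6) ^ 2)) μ :=
    (((hS.integrable_norm_gradient_sq hV x).const_mul 2).fun_add (integrable_const _)).const_mul _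
  refine ((memLp_dirWeight hτ).integrable_sq.mul_prod hb).mono'
    (hm.norm.pow_const 2).aestronglyMeasurable (Eventually.of_forall fun q => ?_)
  rw [Real.norm_of_nonneg (by positivity)]
  exact hS.norm_sampleEst_sq_le hd hν γ x q.1 q.2

/-- The variance of the estimator given the directions. -/
def condVariance (μ : Measure Ξ) (f : Vec d → Ξ → ℝ) (γ ν : ℝ) (x : Vec d) (u : Fin N → Vec d) :
    ℝ := ∫ z, ‖sampleEst f γ ν z x u - meanEst μ f γ ν x u‖ ^ 2 ∂μ

lemma SmoothAssumption.integrable_condVariance (hS : SmoothAssumption μ f Lf Mf)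
    (hV : VarianceAssumption μ f β₁ β₂) (hd : 1 ≤ d)
    (hF : HessLipschitz (objective μ f) MF) (hMF : 0 ≤ MF)
    (hν : 0 < ν) (hD : DirectionBounds τ γ ν MF ε ρ S S' lam) (x : Vec d) :
    Integrable (condVariance μ f γ ν x) τ := by
  have := hD.isProbabilityMeasure
  have h1 := (hS.memLp_sampleEst_prod hd hV hν γ x hD.integrable).sub
    ((hS.memLp_meanEst hF hMF hν hD x).comp_fst μ)
  exact h1.norm.integrable_sq.integral_prod_left

/-- For fixed directions, the variance is at most the second moment about any vector independent of
the sample. The linear estimator of `∇F` leaves only `∇f - ∇F` and the remainder. Exchanging the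
integrals allows the second-moment bound over directions for each fixed sample. -/
lemma SmoothAssumption.sampleVariance_le (hS : SmoothAssumption μ f Lf Mf)
    (hV : VarianceAssumption μ f β₁ β₂) (hd : 1 ≤ d)
    (hν : 0 < ν) (hD : DirectionBounds τ γ ν MF ε ρ S S' lam) (hS0 : 0 ≤ S) (x : Vec d) :
    sampleVariance μ τ f γ ν x ≤
      4 / 3 * S * (β₁ * ‖∇ (objective μ f) x‖ ^ 2 + β₂) + 4 * S' * (Mf ^ 2 * ν ^ 4 / 36) := by
  have := hD.isProbabilityMeasure
  set v := ∇ (objective μ f) x with hv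
  have hint : Integrable (fun q : (Fin N → Vec d) × Ξ =>
      ‖sampleEst f γ ν q.2 x q.1 - linearEst γ v q.1‖ ^ 2) (τ.prod μ) :=
    ((hS.memLp_sampleEst_prod hd hV hν γ x hD.integrable).sub
      ((memLp_linearEst hD.integrable γ v).comp_fst μ)).norm.integrable_sq
  calc sampleVariance μ τ f γ ν x
      ≤ ∫ u, ∫ z, ‖sampleEst f γ ν z x u - linearEst γ v u‖ ^ 2 ∂μ ∂τ := by
        refine integral_mono_of_nonneg (Eventually.of_forall fun u =>
          integral_nonneg fun z => by positivity) hint.integral_prod_left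
          (Eventually.of_forall fun u => ?_)
        simp only
        rw [integral_norm_sub_integral_sq (hS.memLp_sampleEst hd hV hν γ x u) (linearEst γ v u)]
        change _ ≤ _ + ‖meanEst μ f γ ν x u - linearEst γ v u‖ ^ 2
        have h0 := sq_nonneg ‖meanEst μ f γ ν x u - linearEst γ v u‖
        change ∫ z, ‖sampleEst f γ ν z x u - meanEst μ f γ ν x u‖ ^ 2 ∂μ ≤
          ∫ z, ‖sampleEst f γ ν z x u - meanEst μ f γ ν x u‖ ^ 2 ∂μ + _
        linarith
    _ = ∫ z, ∫ u, ‖sampleEst f γ ν z x u - linearEst γ v u‖ ^ 2 ∂τ ∂μ :=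
        integral_integral_swap hint
    _ ≤ ∫ z, (4 / 3 * S * ‖∇ (fun y => f y z) x - v‖ ^ 2 +
          4 * S' * (Mf ^ 2 * ν ^ 4 / 36)) ∂μ := by
        refine integral_mono hint.integral_prod_right
          (((hV x).1.const_mul _).add (integrable_const _)) fun z => ?_
        exact hD.second_moment _ Mf (hS.contDiff z)
          (nonneg_of_hessLipschitz hd (hS.hessLipschitz z)) (hS.hessLipschitz z) x v
    _ ≤ _ := by
        rw [integral_add ((hV x).1.const_mul _) (integrable_const _), integral_const_mul,
          integral_const]
        simp only [probReal_univ, one_smul]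
        gcongr
        exact (hV x).2

/-- The smallest sample sizes satisfying the norm condition are bounded. -/
lemma SmoothAssumption.size_le (hS : SmoothAssumption μ f Lf Mf)
    (hV : VarianceAssumption μ f β₁ β₂) (hd : 1 ≤ d) (hF : HessLipschitz (objective μ f) MF)
    (hν : 0 < ν) (hD : DirectionBounds τ γ ν MF ε ρ S S' lam) (hS0 : 0 ≤ S) (hS0' : 0 ≤ S')
    (hlam : 0 < lam) (hε : 0 < ε) (hβ₁ : 0 ≤ β₁) (hβ₂ : 0 ≤ β₂)
    {m : Method} {θ : ℝ} (hθ : 0 < θ) (hB : SizeBound m d θ ε ν S S' lam) {x : Vec d}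
    (hx : ε < ‖∇ (objective μ f) x‖ ^ 2) {n : ℕ}
    (hn : IsLeast {l : ℕ | 1 ≤ l ∧ NormCondition μ τ f γ ν θ x l} n) :
    (n : ℝ) ≤ b₁ m d θ β₁ + 4 * b₂ m d θ Mf β₁ β₂ ν / ε := by
  set G := ‖∇ (objective μ f) x‖ ^ 2 with hG
  have hG0 : 0 < G := hε.trans hx
  set R := b₁ m d θ β₁ - 1 + 4 * b₂ m d θ Mf β₁ β₂ ν / ε with hR
  have h1 := hS.sampleVariance_le hV hd hν hD hS0 x
  have h2 := hB Mf β₁ β₂ G hβ₁ hβ₂ hx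
  have h3 := hS.integral_norm_meanEst_sq_ge hF hD hx
  set E := ∫ u, ‖meanEst μ f γ ν x u‖ ^ 2 ∂τ with hE
  have hlG : 0 < lam * G := by positivity
  have hE0 : 0 < E := hlG.trans_le h3
  have hR0 : 0 ≤ θ ^ 2 * R := by
    have : 0 ≤ lam * G * (θ ^ 2 * R) := le_trans (by positivity) h2
    exact nonneg_of_mul_nonneg_right this hlG
  have hR0' : 0 ≤ R := nonneg_of_mul_nonneg_right hR0 (by positivity)
  have h4 : sampleVariance μ τ f γ ν x ≤ E * (θ ^ 2 * R) :=
    (h1.trans h2).trans (by gcongr)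
  suffices (n : ℝ) ≤ R + 1 by linarith
  -- For `n = 1`, `R ≥ 0` suffices, which follows from the size bound because its left side is
  -- nonnegative. For `n ≥ 2`, minimality makes `n - 1` violate the norm condition.
  rcases Nat.lt_or_ge n 2 with h | h
  · have : (n : ℝ) ≤ 1 := by exact_mod_cast Nat.lt_succ_iff.1 h
    linarith
  · have hn1 : 1 ≤ n - 1 := by omega
    have hnot : ¬ NormCondition μ τ f γ ν θ x (n - 1) := by
      intro hc
      have := hn.2 ⟨hn1, hc⟩
      omega
    rw [NormCondition, not_le, lt_div_iff₀ (by exact_mod_cast hn1)] at hnot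
    have h5 : E * θ ^ 2 * ((n - 1 : ℕ) : ℝ) < E * θ ^ 2 * R := by
      calc _ = θ ^ 2 * E * ((n - 1 : ℕ) : ℝ) := by ring
        _ < _ := hnot
        _ ≤ _ := h4
        _ = _ := by ring
    have h6 : ((n - 1 : ℕ) : ℝ) < R :=
      lt_of_mul_lt_mul_left h5 (mul_nonneg hE0.le (sq_nonneg θ))
    rw [Nat.cast_sub (by omega)] at h6
    push_cast at h6
    linarith

lemma SmoothAssumption.moments_batchEst (hS : SmoothAssumption μ f Lf Mf)
    (hV : VarianceAssumption μ f β₁ β₂) (hd : 1 ≤ d) (hν : 0 < ν) (x : Vec d) {n : ℕ} (hn : 1 ≤ n)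
    (u : Fin N → Vec d) :
    MemLp (fun ζ => batchEst f γ ν n ζ x u) 2 (Measure.infinitePi fun _ : ℕ => μ) ∧
    ∫ ζ, batchEst f γ ν n ζ x u ∂(Measure.infinitePi fun _ : ℕ => μ) = meanEst μ f γ ν x u ∧
    ∫ ζ, ‖batchEst f γ ν n ζ x u‖ ^ 2 ∂(Measure.infinitePi fun _ : ℕ => μ) =
      ‖meanEst μ f γ ν x u‖ ^ 2 + condVariance μ f γ ν x u / n := by
  have hn' : (n : ℝ) ≠ 0 := by positivity
  have hm := hS.measurable_sampleEst_left γ ν x u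
  have hX := hS.memLp_sampleEst hd hV hν γ x u
  have hmp := fun i : ℕ => measurePreserving_eval_infinitePi (fun _ : ℕ => μ) i
  have hXi : ∀ i : ℕ, MemLp (fun ζ : ℕ → Ξ => sampleEst f γ ν (ζ i) x u) 2
      (Measure.infinitePi fun _ : ℕ => μ) := fun i => hX.comp_measurePreserving (hmp i)
  have hmean : ∀ i : ℕ, ∫ ζ : ℕ → Ξ, sampleEst f γ ν (ζ i) x u
      ∂(Measure.infinitePi fun _ : ℕ => μ) = meanEst μ f γ ν x u := by
    intro i
    rw [meanEst]
    conv_rhs => rw [← (hmp i).map_eq]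
    rw [integral_map (measurable_pi_apply i).aemeasurable hm.aestronglyMeasurable]
  have hsq : ∀ i : ℕ, ∫ ζ : ℕ → Ξ, ‖sampleEst f γ ν (ζ i) x u‖ ^ 2
      ∂(Measure.infinitePi fun _ : ℕ => μ) =
      condVariance μ f γ ν x u + ‖meanEst μ f γ ν x u‖ ^ 2 := by
    intro i
    have h1 := integral_norm_sub_integral_sq hX 0
    simp only [sub_zero] at h1
    rw [condVariance, meanEst, ← h1]
    conv_rhs => rw [← (hmp i).map_eq]
    rw [integral_map (measurable_pi_apply i).aemeasurable
      (hm.norm.pow_const 2).aestronglyMeasurable]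
  simp_rw [batchEst_eq]
  have hsum : MemLp (fun ζ : ℕ → Ξ => ∑ i ∈ Finset.range n, sampleEst f γ ν (ζ i) x u) 2
      (Measure.infinitePi fun _ : ℕ => μ) := memLp_finsetSum _ fun i _ => hXi i
  refine ⟨hsum.const_smul (1 / n : ℝ), ?_, ?_⟩
  · rw [integral_smul, integral_finsetSum _ fun i _ => (hXi i).integrable (by norm_num),
      Finset.sum_congr rfl fun i _ => hmean i, Finset.sum_const, Finset.card_range,
      ← Nat.cast_smul_eq_nsmul ℝ, smul_smul, one_div_mul_cancel hn', one_smul]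
  · simp_rw [norm_smul, mul_pow]
    rw [integral_const_mul, integral_norm_sum_sq_of_indepFun (Finset.range n) (fun i _ => hXi i)
      (fun i _ j _ hij => (iIndepFun_infinitePi (P := fun _ : ℕ => μ)
        (X := fun _ z => sampleEst f γ ν z x u) fun _ => hm).indepFun hij)
      (fun i _ => hmean i) (fun i _ => hsq i), Finset.card_range,
      Real.norm_of_nonneg (by positivity)]
    field_simp
    ring

/-- One step of the method decreases the objective in expectation. -/
lemma SmoothAssumption.lintegral_step_add_le (hS : SmoothAssumption μ f Lf Mf)
    (hV : VarianceAssumption μ f β₁ β₂) (hd : 1 ≤ d) {LF θ α : ℝ} (hLF : 0 < LF)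
    (hL : GradLipschitz (objective μ f) LF)
    (hF : HessLipschitz (objective μ f) MF) (hMF : 0 ≤ MF)
    (hν : 0 < ν) (hD : DirectionBounds τ γ ν MF ε ρ S S' lam) (hε : 0 < ε) (hρ : 0 ≤ ρ)
    (hα : α = ρ * (1 / (4 * (1 + θ ^ 2) * LF))) {x : Vec d}
    (hx : ε < ‖∇ (objective μ f) x‖ ^ 2) {n : ℕ} (hn : 1 ≤ n)
    (hNC : NormCondition μ τ f γ ν θ x n) :
    ∫⁻ q, ENNReal.ofReal (objective μ f (x - α • batchEst f γ ν n q.2 x q.1) -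
        ⨅ y, objective μ f y) ∂(τ.prod (Measure.infinitePi fun _ : ℕ => μ)) +
      ENNReal.ofReal (α * ε / 8) ≤
      ENNReal.ofReal (objective μ f x - ⨅ y, objective μ f y) := by
  have := hD.isProbabilityMeasure
  set F := objective μ f with hFdef
  set Fs := ⨅ y, F y with hFs
  set κ := Measure.infinitePi fun _ : ℕ => μ with hκ
  have hα0 : 0 ≤ α := by rw [hα]; positivity
  have hge : ∀ y, 0 ≤ F y - Fs := fun y => sub_nonneg.2 (ciInf_le hS.bddBelow y)
  set Y : (Fin N → Vec d) × (ℕ → Ξ) → Vec d := fun q => batchEst f γ ν n q.2 x q.1 with hY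
  have hYm : Measurable Y := by
    have h1 := hS.measurable_batchEst (N := N) γ ν
    have h2 : Measurable fun q : (Fin N → Vec d) × (ℕ → Ξ) => ((x, n), q) := by fun_prop
    have h3 := h1.comp h2
    exact h3
  have hmom := fun u : Fin N → Vec d => hS.moments_batchEst (γ := γ) hV hd hν x hn u
  have hme := hS.memLp_meanEst hF hMF hν hD x
  have hcv := hS.integrable_condVariance hV hd hF hMF hν hD x
  have hY2 : Integrable (fun q => ‖Y q‖ ^ 2) (τ.prod κ) := by
    rw [integrable_prod_iff (hYm.norm.pow_const 2).aestronglyMeasurable]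
    refine ⟨Eventually.of_forall fun u => (hmom u).1.norm.integrable_sq, ?_⟩
    refine (hme.norm.integrable_sq.add (hcv.div_const n)).congr (Eventually.of_forall fun u => ?_)
    simp only [norm_pow, norm_norm, Pi.add_apply]
    exact (hmom u).2.2.symm
  have hYL : MemLp Y 2 (τ.prod κ) :=
    (memLp_two_iff_integrable_sq_norm hYm.aestronglyMeasurable).2 hY2
  have hY1 : Integrable Y (τ.prod κ) := hYL.integrable (by norm_num)
  have e1 : ∫ q, Y q ∂(τ.prod κ) = ∫ u, meanEst μ f γ ν x u ∂τ := by
    rw [integral_prod _ hY1]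
    exact integral_congr_ae (Eventually.of_forall fun u => (hmom u).2.1)
  have e2 : ∫ q, ‖Y q‖ ^ 2 ∂(τ.prod κ) =
      ∫ u, ‖meanEst μ f γ ν x u‖ ^ 2 ∂τ + sampleVariance μ τ f γ ν x / n := by
    rw [integral_prod _ hY2, integral_congr_ae (Eventually.of_forall fun u => (hmom u).2.2),
      integral_add hme.norm.integrable_sq (hcv.div_const n), integral_div]
    rfl
  have hdesc := hD.descent (objective μ f) hS.contDiff_objective hF x hx
  simp_rw [← hS.meanEst_eq] at hdesc
  rw [integral_inner (hme.integrable (by norm_num)), ← e1] at hdesc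
  set E := ∫ u, ‖meanEst μ f γ ν x u‖ ^ 2 ∂τ with hE
  have hE0 : 0 ≤ E := integral_nonneg fun u => by positivity
  have hle : ∫ q, ‖Y q‖ ^ 2 ∂(τ.prod κ) ≤ (1 + θ ^ 2) * E := by
    rw [e2]
    rw [NormCondition] at hNC
    linarith
  have hub : ∀ q, F (x - α • Y q) - Fs ≤
      F x - Fs - α * inner ℝ (∇ F x) (Y q) + LF / 2 * α ^ 2 * ‖Y q‖ ^ 2 := by
    intro q
    have h1 := le_add_inner_add_of_gradLipschitz hS.contDiff_objective hL x (-(α • Y q))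
    rw [← sub_eq_add_neg, inner_neg_right, inner_smul_right, norm_neg, norm_smul, mul_pow,
      Real.norm_of_nonneg hα0] at h1
    linarith
  have hlin : Integrable (fun q => F x - Fs - α * inner ℝ (∇ F x) (Y q)) (τ.prod κ) :=
    (integrable_const _).sub ((hY1.const_inner _).const_mul _)
  have hubi : Integrable (fun q => F x - Fs - α * inner ℝ (∇ F x) (Y q) +
      LF / 2 * α ^ 2 * ‖Y q‖ ^ 2) (τ.prod κ) :=
    hlin.add (hY2.const_mul _)
  have hI : ∫ q, (F x - Fs - α * inner ℝ (∇ F x) (Y q) + LF / 2 * α ^ 2 * ‖Y q‖ ^ 2) ∂(τ.prod κ) =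
      F x - Fs - α * inner ℝ (∇ F x) (∫ q, Y q ∂(τ.prod κ)) +
        LF / 2 * α ^ 2 * ∫ q, ‖Y q‖ ^ 2 ∂(τ.prod κ) := by
    rw [integral_add hlin (hY2.const_mul _), integral_sub (integrable_const _) ((hY1.const_inner _).const_mul _),
      integral_const, integral_const_mul, integral_const_mul, integral_inner hY1]
    simp
  -- The potential is nonnegative, so lower integrals need no integrability of `F` along the run;
  -- the quadratic upper bound is integrable and brings the estimate back to Bochner integrals.
  calc _ ≤ ∫⁻ q, ENNReal.ofReal (F x - Fs - α * inner ℝ (∇ F x) (Y q) +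
          LF / 2 * α ^ 2 * ‖Y q‖ ^ 2) ∂(τ.prod κ) + ENNReal.ofReal (α * ε / 8) := by
        gcongr with q
        exact hub q
    _ = ENNReal.ofReal (∫ q, (F x - Fs - α * inner ℝ (∇ F x) (Y q) +
          LF / 2 * α ^ 2 * ‖Y q‖ ^ 2) ∂(τ.prod κ)) + ENNReal.ofReal (α * ε / 8) := by
        rw [ofReal_integral_eq_lintegral_ofReal hubi
          (Eventually.of_forall fun q => (hge _).trans (hub q))]
    _ = ENNReal.ofReal (∫ q, (F x - Fs - α * inner ℝ (∇ F x) (Y q) +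
          LF / 2 * α ^ 2 * ‖Y q‖ ^ 2) ∂(τ.prod κ) + α * ε / 8) := by
        rw [ENNReal.ofReal_add (integral_nonneg fun q => (hge _).trans (hub q)) (by positivity)]
    _ ≤ _ := by
        refine ENNReal.ofReal_le_ofReal ?_
        rw [hI]
        -- This is the reason for the step size: `(LF/2)(1 + θ²) α = ρ/8`.
        have h1 : LF / 2 * α ^ 2 * ∫ q, ‖Y q‖ ^ 2 ∂(τ.prod κ) ≤ α * (ρ / 8 * E) := by
          calc _ ≤ LF / 2 * α ^ 2 * ((1 + θ ^ 2) * E) := by gcongr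
            _ = α * (LF / 2 * (1 + θ ^ 2) * α * E) := by ring
            _ = α * (ρ / 8 * E) := by
                congr 2
                rw [hα]
                field_simp
                ring
        change -inner ℝ (∇ F x) (∫ q, Y q ∂(τ.prod κ)) + ρ / 8 * E ≤ -(‖∇ F x‖ ^ 2 / 8) at hdesc
        have h2 := mul_le_mul_of_nonneg_left hdesc hα0
        have h3 := mul_le_mul_of_nonneg_left hx.le hα0
        linarith

end Sampling

/-! ### Runs of the algorithm -/

/-- Freezing the past: it replaces conditional expectations in the one-step estimate. -/
lemma lintegral_comp_prod_of_indepFun {Ω β δ : Type*} [MeasurableSpace Ω] [MeasurableSpace β]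
    [MeasurableSpace δ] {P : Measure Ω} [IsProbabilityMeasure P] {Y : Ω → β} {Z : Ω → δ}
    (hY : Measurable Y) (hZ : Measurable Z) (hYZ : IndepFun Y Z P) {Ψ : β × δ → ℝ≥0∞}
    (hΨ : Measurable Ψ) :
    ∫⁻ ω, Ψ (Y ω, Z ω) ∂P = ∫⁻ ω, ∫⁻ z, Ψ (Y ω, z) ∂(P.map Z) ∂P := by
  have h1 := (indepFun_iff_map_prod_eq_prod_map_map hY.aemeasurable hZ.aemeasurable).1 hYZ
  have : IsProbabilityMeasure (P.map Z) := Measure.isProbabilityMeasure_map hZ.aemeasurable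
  have : IsProbabilityMeasure (P.map Y) := Measure.isProbabilityMeasure_map hY.aemeasurable
  rw [← lintegral_map hΨ (hY.prodMk hZ), h1, lintegral_prod _ hΨ.aemeasurable,
    lintegral_map hΨ.lintegral_prod_right' hY]

section Run

variable {d N : ℕ} {Ξ Ω : Type*} [MeasurableSpace Ξ] {mΩ : MeasurableSpace Ω} {P : Measure Ω}
  {μ : Measure Ξ} {f : Vec d → Ξ → ℝ} {Lf Mf : ℝ} {τ : Measure (Fin N → Vec d)}
  {γ ν α ε : ℝ} {x₀ : Vec d} {ℱ : Filtration ℕ mΩ} {T : ℕ → Ω → Fin N → Vec d}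
  {ζ : ℕ → Ω → ℕ → Ξ} {n : ℕ → Ω → ℕ} {x : ℕ → Ω → Vec d}

lemma NotYetAccurate.mono {F : Vec d → ℝ} {j k : ℕ} (hjk : j ≤ k) {ω : Ω}
    (h : NotYetAccurate F ε x k ω) : NotYetAccurate F ε x j ω :=
  fun i hi => h i (hi.trans hjk)

lemma IsRun.measurable_iterate (hR : IsRun P μ τ f γ ν α x₀ ℱ T ζ n x)
    (hS : SmoothAssumption μ f Lf Mf) (k : ℕ) : Measurable[ℱ k] (x k) := by
  induction k with
  | zero =>
    rw [show x 0 = fun _ => x₀ from funext hR.init]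
    exact measurable_const
  | succ k ih =>
    have h1 : Measurable[ℱ (k + 1)] fun ω => ((x k ω, n k ω), (T k ω, ζ k ω)) :=
      ((ih.mono (ℱ.mono k.le_succ) le_rfl).prodMk
        ((hR.measurable_size k).mono (ℱ.mono k.le_succ) le_rfl)).prodMk
        ((hR.measurable_dir k).prodMk (hR.measurable_stream k))
    have h2 := hS.measurable_batchEst (N := N) γ ν
    have h3 := h2.comp h1
    rw [show x (k + 1) = fun ω => x k ω - α • batchEst f γ ν (n k ω) (ζ k ω) (x k ω) (T k ω) from
      funext (hR.step k)]
    exact (ih.mono (ℱ.mono k.le_succ) le_rfl).sub (h3.const_smul α)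

lemma IsRun.measurableSet_notYetAccurate (hR : IsRun P μ τ f γ ν α x₀ ℱ T ζ n x)
    (hS : SmoothAssumption μ f Lf Mf) (ε : ℝ) (k : ℕ) :
    MeasurableSet[ℱ k] {ω | NotYetAccurate (objective μ f) ε x k ω} := by
  have h1 : {ω | NotYetAccurate (objective μ f) ε x k ω} =
      ⋂ j ∈ Finset.range (k + 1), {ω | ε < ‖∇ (objective μ f) (x j ω)‖ ^ 2} := by
    ext ω
    simp [NotYetAccurate]
  rw [h1]
  refine Finset.measurableSet_biInter _ fun j hj => ?_
  have hc : Continuous fun y => ‖∇ (objective μ f) y‖ ^ 2 :=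
    (contDiff_gradient hS.contDiff_objective).continuous.norm.pow 2
  exact hc.measurable.comp ((hR.measurable_iterate hS j).mono
    (ℱ.mono (Nat.lt_succ_iff.1 (Finset.mem_range.1 hj))) le_rfl) measurableSet_Ioi

variable [IsProbabilityMeasure P]

/-- A potential that decreases in expectation at every admissible point decreases along a run. -/
lemma IsRun.setLIntegral_add_le (hR : IsRun P μ τ f γ ν α x₀ ℱ T ζ n x)
    (hS : SmoothAssumption μ f Lf Mf) {V : Vec d → ℝ≥0∞} (hV : Measurable V) {c : ℝ≥0∞}
    {good : Vec d → ℕ → Prop}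
    (hstep : ∀ y l, good y l → ∫⁻ q, V (y - α • batchEst f γ ν l q.2 y q.1)
      ∂(τ.prod (Measure.infinitePi fun _ : ℕ => μ)) + c ≤ V y)
    {k : ℕ} {A : Set Ω} (hA : MeasurableSet[ℱ k] A)
    (hg : ∀ᵐ ω ∂P, ω ∈ A → good (x k ω) (n k ω)) :
    ∫⁻ ω in A, V (x (k + 1) ω) ∂P + c * P A ≤ ∫⁻ ω in A, V (x k ω) ∂P := by
  have hA' : MeasurableSet A := ℱ.le k _ hA
  have hxm := hR.measurable_iterate hS k
  -- The indicator of `A` is carried as a coordinate of the past variable, so that freezing handles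
  -- the event together with the state.
  set I : Ω → ℝ≥0∞ := A.indicator fun _ => 1 with hI
  have hIm : Measurable[ℱ k] I := Measurable.indicator (m := ℱ k) measurable_const hA
  set Y : Ω → (Vec d × ℕ) × ℝ≥0∞ := fun ω => ((x k ω, n k ω), I ω) with hY
  have hYm : Measurable[ℱ k] Y := (hxm.prodMk (hR.measurable_size k)).prodMk hIm
  set Z : Ω → (Fin N → Vec d) × (ℕ → Ξ) := fun ω => (T k ω, ζ k ω) with hZ
  have hZm : Measurable Z :=
    ((hR.measurable_dir k).mono (ℱ.le _) le_rfl).prodMk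
      ((hR.measurable_stream k).mono (ℱ.le _) le_rfl)
  have hind : IndepFun Y Z P :=
    (IndepFun_iff_Indep _ _ _).2 (indep_of_indep_of_le_left (hR.indep k) hYm.comap_le)
  set Ψ : ((Vec d × ℕ) × ℝ≥0∞) × ((Fin N → Vec d) × (ℕ → Ξ)) → ℝ≥0∞ := fun w =>
    w.1.2 * V (w.1.1.1 - α • batchEst f γ ν w.1.1.2 w.2.2 w.1.1.1 w.2.1) with hΨ
  have hΨm : Measurable Ψ := by
    have h1 := hS.measurable_batchEst (N := N) γ ν
    have h2 : Measurable fun w : ((Vec d × ℕ) × ℝ≥0∞) × ((Fin N → Vec d) × (ℕ → Ξ)) =>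
      (w.1.1, w.2) := by fun_prop
    have h3 := h1.comp h2
    have h4 : Measurable fun w : ((Vec d × ℕ) × ℝ≥0∞) × ((Fin N → Vec d) × (ℕ → Ξ)) =>
      w.1.1.1 := by fun_prop
    have h5 := h4.sub (h3.const_smul α)
    have h6 := hV.comp h5
    have h7 : Measurable fun w : ((Vec d × ℕ) × ℝ≥0∞) × ((Fin N → Vec d) × (ℕ → Ξ)) =>
      w.1.2 := by fun_prop
    exact h7.mul h6
  have hmul : ∀ g : Ω → ℝ≥0∞, ∫⁻ ω in A, g ω ∂P = ∫⁻ ω, I ω * g ω ∂P := by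
    intro g
    rw [← lintegral_indicator hA']
    refine lintegral_congr fun ω => ?_
    by_cases h : ω ∈ A <;> simp [hI, h]
  have key := lintegral_comp_prod_of_indepFun (hYm.mono (ℱ.le k) le_rfl) hZm hind hΨm
  rw [hZ, hR.law k] at key
  have e1 : ∫⁻ ω in A, V (x (k + 1) ω) ∂P = ∫⁻ ω in A, ∫⁻ q,
      V (x k ω - α • batchEst f γ ν (n k ω) q.2 (x k ω) q.1)
        ∂(τ.prod (Measure.infinitePi fun _ : ℕ => μ)) ∂P := by
    rw [hmul, hmul]
    simp_rw [hR.step k]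
    refine key.trans (lintegral_congr fun ω => ?_)
    by_cases h : ω ∈ A <;> simp [hI, hΨ, hY, h]
  rw [e1, ← setLIntegral_const, ← lintegral_add_right _ measurable_const]
  refine lintegral_mono_ae ?_
  filter_upwards [ae_restrict_of_ae hg, ae_restrict_mem hA'] with ω h1 h2
  exact hstep _ _ (h1 h2)

/-- Telescoping: the events decrease and the potential is nonnegative, so shrinking the event only
lowers the left-hand side. -/
lemma IsRun.setLIntegral_notYetAccurate_add_le (hR : IsRun P μ τ f γ ν α x₀ ℱ T ζ n x)
    (hS : SmoothAssumption μ f Lf Mf) {V : Vec d → ℝ≥0∞} (hV : Measurable V) {c : ℝ≥0∞}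
    {good : Vec d → ℕ → Prop}
    (hstep : ∀ y l, good y l → ∫⁻ q, V (y - α • batchEst f γ ν l q.2 y q.1)
      ∂(τ.prod (Measure.infinitePi fun _ : ℕ => μ)) + c ≤ V y)
    (hg : ∀ᵐ ω ∂P, ∀ k, NotYetAccurate (objective μ f) ε x k ω → good (x k ω) (n k ω)) (k : ℕ) :
    ∫⁻ ω in {ω | NotYetAccurate (objective μ f) ε x k ω}, V (x k ω) ∂P +
      k * (c * P {ω | NotYetAccurate (objective μ f) ε x k ω}) ≤ V x₀ := by
  induction k with
  | zero =>
    simp_rw [hR.init]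
    rw [setLIntegral_const, Nat.cast_zero, zero_mul, add_zero]
    exact mul_le_of_le_one_right' prob_le_one
  | succ k ih =>
    set A := fun j => {ω | NotYetAccurate (objective μ f) ε x j ω} with hA
    have hsub : A (k + 1) ⊆ A k := fun ω h => h.mono k.le_succ
    have h1 := hR.setLIntegral_add_le hS hV hstep (A := A k)
      (hR.measurableSet_notYetAccurate hS ε k) (hg.mono fun ω h => h k)
    calc ∫⁻ ω in A (k + 1), V (x (k + 1) ω) ∂P + ((k + 1 : ℕ) : ℝ≥0∞) * (c * P (A (k + 1)))
        ≤ ∫⁻ ω in A k, V (x (k + 1) ω) ∂P + ((k + 1 : ℕ) : ℝ≥0∞) * (c * P (A k)) := by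
          gcongr
      _ = (∫⁻ ω in A k, V (x (k + 1) ω) ∂P + c * P (A k)) + k * (c * P (A k)) := by
          push_cast
          ring
      _ ≤ _ := (add_le_add_left h1 _).trans ih

/-- Markov-type bound on the probability that no accurate iterate has been reached. -/
lemma IsRun.mul_prob_notYetAccurate_le (hR : IsRun P μ τ f γ ν α x₀ ℱ T ζ n x)
    (hS : SmoothAssumption μ f Lf Mf) {V : Vec d → ℝ≥0∞} (hV : Measurable V) {c : ℝ≥0∞}
    {good : Vec d → ℕ → Prop}
    (hstep : ∀ y l, good y l → ∫⁻ q, V (y - α • batchEst f γ ν l q.2 y q.1)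
      ∂(τ.prod (Measure.infinitePi fun _ : ℕ => μ)) + c ≤ V y)
    (hg : ∀ᵐ ω ∂P, ∀ k, NotYetAccurate (objective μ f) ε x k ω → good (x k ω) (n k ω)) (k : ℕ) :
    (k + 1) * (c * P {ω | NotYetAccurate (objective μ f) ε x k ω}) ≤ V x₀ := by
  -- On the event that `x_k` is not accurate one more step can be charged, which gives `k + 1`
  -- instead of `k`.
  have h1 := hR.setLIntegral_add_le hS hV hstep (hR.measurableSet_notYetAccurate hS ε k)
    (hg.mono fun ω h => h k)
  calc _ = c * P {ω | NotYetAccurate (objective μ f) ε x k ω} +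
        k * (c * P {ω | NotYetAccurate (objective μ f) ε x k ω}) := by ring
    _ ≤ ∫⁻ ω in {ω | NotYetAccurate (objective μ f) ε x k ω}, V (x k ω) ∂P +
        k * (c * P {ω | NotYetAccurate (objective μ f) ε x k ω}) := by
      gcongr
      exact le_add_self.trans h1
    _ ≤ _ := hR.setLIntegral_notYetAccurate_add_le hS hV hstep hg k

end Run

/-! ### High-probability bounds for iterations and function evaluations -/

section Complexity

variable {d N : ℕ} {Ξ Ω : Type*} [MeasurableSpace Ξ] {mΩ : MeasurableSpace Ω} {P : Measure Ω}
  {μ : Measure Ξ} {f : Vec d → Ξ → ℝ} {Lf Mf LF MF θ β₁ β₂ ε p : ℝ}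
  {τ : Measure (Fin N → Vec d)} {m : Method} {x₀ : Vec d} {ℱ : Filtration ℕ mΩ}
  {T : ℕ → Ω → Fin N → Vec d} {ζ : ℕ → Ω → ℕ → Ξ} {n : ℕ → Ω → ℕ} {x : ℕ → Ω → Vec d}
  [IsProbabilityMeasure P] [IsProbabilityMeasure μ]

/-- Taking the first accurate index makes the size bound available at every earlier iteration. -/
lemma exists_le_of_not_notYetAccurate {F : Vec d → ℝ} {k : ℕ} {ω : Ω}
    (h : ¬ NotYetAccurate F ε x k ω) : ∃ i ≤ k, ‖∇ F (x i ω)‖ ^ 2 ≤ ε ∧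
      ∀ j < i, NotYetAccurate F ε x j ω := by
  classical
  have h1 : ∃ i, ‖∇ F (x i ω)‖ ^ 2 ≤ ε := by
    simp only [NotYetAccurate, not_forall, not_lt] at h
    obtain ⟨i, _, hi⟩ := h
    exact ⟨i, hi⟩
  refine ⟨Nat.find h1, ?_, Nat.find_spec h1, fun j hj i hi =>
    not_le.1 (Nat.find_min h1 (hi.trans_lt hj))⟩
  simp only [NotYetAccurate, not_forall, not_lt] at h
  obtain ⟨i, hi, hi'⟩ := h
  exact (Nat.find_min' h1 hi').trans hi

lemma b₁_nonneg (m : Method) (d : ℕ) (θ : ℝ) (hβ₁ : 0 ≤ β₁) : 0 ≤ b₁ m d θ β₁ := by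
  cases m <;> simp only [b₁] <;> positivity

lemma b₂_nonneg (m : Method) (d : ℕ) (θ Mf ν : ℝ) (hβ₁ : 0 ≤ β₁) (hβ₂ : 0 ≤ β₂) :
    0 ≤ b₂ m d θ Mf β₁ β₂ ν := by
  cases m <;> simp only [b₂] <;> positivity

lemma stepSize_pos (m : Method) (hd : 1 ≤ d) (hN : 1 ≤ N) (hLF : 0 < LF) (θ : ℝ) :
    0 < stepSize m d N θ LF := by
  rw [stepSize_eq]
  have := stepFactor_pos m hd hN
  positivity

lemma IsRun.le_prob_exists_accurate (hd : 1 ≤ d) (hN : 1 ≤ N) (hτ : IsDirectionLaw m d N τ)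
    (hθ : 0 < θ) (hLF : 0 < LF) (hMF : 0 < MF) (hε : 0 < ε) (hp : 0 < p) (hp1 : p ≤ 1)
    (hS : SmoothAssumption μ f Lf Mf) (hV : VarianceAssumption μ f β₁ β₂)
    (hL : GradLipschitz (objective μ f) LF) (hF : HessLipschitz (objective μ f) MF)
    (hR : IsRun P μ τ f (scaling m d N) (radius m d N MF ε p) (stepSize m d N θ LF) x₀ ℱ T ζ n x)
    (hn : ∀ᵐ ω ∂P, ∀ k, NotYetAccurate (objective μ f) ε x k ω →
      NormCondition μ τ f (scaling m d N) (radius m d N MF ε p) θ (x k ω) (n k ω)) {k : ℕ}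
    (hk : 1 ≤ k)
    (hK : iterComplexity m d N θ LF (objective μ f x₀ - ⨅ y, objective μ f y) p ε ≤ k) :
    1 - p ≤ P.real {ω | ¬ NotYetAccurate (objective μ f) ε x (k - 1) ω} := by
  obtain ⟨S, S', lam, -, -, -, hD, -⟩ := exists_directionBounds hd hN hτ hθ hMF hε hp hp1
  have hν := radius_pos m hd (N := N) hMF hε hp
  have hα := stepSize_pos m hd hN hLF θ
  set α := stepSize m d N θ LF with hαdef
  set F := objective μ f with hFdef
  set Δ := F x₀ - ⨅ y, F y with hΔ
  have hΔ0 : 0 ≤ Δ := sub_nonneg.2 (ciInf_le hS.bddBelow x₀)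
  obtain ⟨k, rfl⟩ : ∃ l, k = l + 1 := ⟨k - 1, by omega⟩
  rw [Nat.add_sub_cancel]
  have hm := (hR.measurableSet_notYetAccurate hS ε k)
  have hm' : MeasurableSet {ω | NotYetAccurate F ε x k ω} := ℱ.le k _ hm
  have hVm : Measurable fun y => ENNReal.ofReal (F y - ⨅ y, F y) :=
    (hS.contDiff_objective.continuous.measurable.sub_const _).ennreal_ofReal
  have h1 := hR.mul_prob_notYetAccurate_le hS hVm (c := ENNReal.ofReal (α * ε / 8))
    (good := fun y l => ε < ‖∇ F y‖ ^ 2 ∧ 1 ≤ l ∧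
      NormCondition μ τ f (scaling m d N) (radius m d N MF ε p) θ y l)
    (fun y l h => hS.lintegral_step_add_le hV hd hLF hL hF hMF.le hν hD hε
      (stepFactor_pos m hd hN).le (stepSize_eq m d N θ LF) h.1 h.2.1 h.2.2)
    (hn.mono fun ω h j hj => ⟨hj j le_rfl, hR.one_le_size j ω, h j hj⟩) k
  have h2 : ((k : ℝ) + 1) * (α * ε / 8 * P.real {ω | NotYetAccurate F ε x k ω}) ≤ Δ := by
    have h3 := ENNReal.toReal_mono ENNReal.ofReal_ne_top h1
    rw [ENNReal.toReal_mul, ENNReal.toReal_mul, ENNReal.toReal_ofReal (by positivity),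
      ENNReal.toReal_ofReal hΔ0] at h3
    exact_mod_cast h3
  -- The hypothesis on `k` becomes `8Δ ≤ (k + 1) ε p α`, which turns the Markov-type bound `h2` into
  -- a probability at most `p`.
  rw [iterComplexity, div_le_iff₀ (by positivity)] at hK
  push_cast at hK
  have h4 : P.real {ω | NotYetAccurate F ε x k ω} ≤ p := by
    have h5 : ((k : ℝ) + 1) * (α * ε / 8) * P.real {ω | NotYetAccurate F ε x k ω} ≤
        ((k : ℝ) + 1) * (α * ε / 8) * p := by linarith
    exact le_of_mul_le_mul_left h5 (by positivity)
  have h6 := probReal_compl_eq_one_sub (μ := P) hm'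
  change 1 - p ≤ P.real {ω | NotYetAccurate F ε x k ω}ᶜ
  linarith

lemma IsRun.le_prob_sum_size_le (hd : 1 ≤ d) (hN : 1 ≤ N) (hτ : IsDirectionLaw m d N τ)
    (hθ : 0 < θ) (hLF : 0 < LF) (hMF : 0 < MF) (hε : 0 < ε) (hp : 0 < p) (hp1 : p ≤ 1)
    (hβ₁ : 0 ≤ β₁) (hβ₂ : 0 ≤ β₂)
    (hS : SmoothAssumption μ f Lf Mf) (hV : VarianceAssumption μ f β₁ β₂)
    (hL : GradLipschitz (objective μ f) LF) (hF : HessLipschitz (objective μ f) MF)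
    (hR : IsRun P μ τ f (scaling m d N) (radius m d N MF ε p) (stepSize m d N θ LF) x₀ ℱ T ζ n x)
    (hn : ∀ᵐ ω ∂P, ∀ k, NotYetAccurate (objective μ f) ε x k ω →
      IsLeast {l : ℕ | 1 ≤ l ∧
        NormCondition μ τ f (scaling m d N) (radius m d N MF ε p) θ (x k ω) l} (n k ω)) {K : ℝ}
    (hK : K = iterComplexity m d N θ LF (objective μ f x₀ - ⨅ y, objective μ f y) p ε) :
    1 - p ≤ P.real {ω | ∃ i : ℕ, (i : ℝ) ≤ K ∧ ‖∇ (objective μ f) (x i ω)‖ ^ 2 ≤ ε ∧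
      ((∑ j ∈ Finset.range i, 2 * N * n j ω : ℕ) : ℝ) ≤ 2 * N * K *
        (b₁ m d θ β₁ + 4 * b₂ m d θ Mf β₁ β₂ (radius m d N MF ε p) / ε)} := by
  have hν := radius_pos m hd (N := N) hMF hε hp
  have hα := stepSize_pos m hd hN hLF θ
  have hΔ0 : 0 ≤ objective μ f x₀ - ⨅ y, objective μ f y :=
    sub_nonneg.2 (ciInf_le hS.bddBelow x₀)
  have hK0 : 0 ≤ K := by
    rw [hK, iterComplexity]
    positivity
  -- With `⌊K⌋ + 1` iterates the accurate index is at most `⌊K⌋ ≤ K`, so no rounding is lost.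
  have h1 := hR.le_prob_exists_accurate hd hN hτ hθ hLF hMF hε hp hp1 hS hV hL hF
    (hn.mono fun ω h j hj => (h j hj).1.2) (k := ⌊K⌋₊ + 1) (Nat.le_add_left _ _)
    (by rw [← hK]; exact_mod_cast (Nat.lt_floor_add_one K).le)
  rw [Nat.add_sub_cancel] at h1
  refine h1.trans (ENNReal.toReal_mono (measure_ne_top _ _) (measure_mono_ae ?_))
  obtain ⟨S, S', lam, hS0, hS0', hlam, hD, hB⟩ :=
    exists_directionBounds hd hN hτ hθ hMF hε hp hp1
  filter_upwards [hn] with ω hω hacc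
  obtain ⟨i, hi, hie, hlt⟩ := exists_le_of_not_notYetAccurate hacc
  set B := b₁ m d θ β₁ + 4 * b₂ m d θ Mf β₁ β₂ (radius m d N MF ε p) / ε with hBdef
  have hsize : ∀ j ∈ Finset.range i, ((2 * N * n j ω : ℕ) : ℝ) ≤ 2 * N * B := by
    intro j hj
    have hj' := hlt j (Finset.mem_range.1 hj)
    have := hS.size_le hV hd hF hν hD hS0 hS0' hlam hε hβ₁ hβ₂ hθ hB (hj' j le_rfl) (hω j hj')
    push_cast
    gcongr
  have hiK : (i : ℝ) ≤ K := (Nat.cast_le.2 hi).trans (Nat.floor_le hK0)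
  have hB0 : 0 ≤ B := by
    have h2 := b₁_nonneg m d θ hβ₁
    have h3 := b₂_nonneg m d θ Mf (radius m d N MF ε p) hβ₁ hβ₂
    positivity
  refine ⟨i, hiK, hie, ?_⟩
  rw [Nat.cast_sum]
  calc _ ≤ ∑ _j ∈ Finset.range i, 2 * N * B := Finset.sum_le_sum hsize
    _ = i * (2 * N * B) := by simp
    _ ≤ K * (2 * N * B) := by gcongr
    _ = _ := by ring

end Complexity

/-! ### Orders of magnitude of the complexities -/

section Orders

variable {d N : ℕ}

lemma iterComplexity_eq (m : Method) (hd : 1 ≤ d) (hN : 1 ≤ N) {θ LF : ℝ} (hLF : 0 < LF)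
    (Δ p e : ℝ) :
    iterComplexity m d N θ LF Δ p e =
      32 * (1 + θ ^ 2) * Δ * (LF / (e * p)) * (stepFactor m d N)⁻¹ := by
  rw [iterComplexity, stepSize_eq]
  have := stepFactor_pos m hd hN
  have h1 : 0 < 1 + θ ^ 2 := by positivity
  -- For `e = 0` or `p = 0` both sides are `0`, since division by zero gives zero.
  by_cases he : e = 0
  · simp [he]
  by_cases hp : p = 0
  · simp [hp]
  field_simp
  ring

lemma isBigO_iterComplexity (m : Method) (d N : ℕ) (θ LF Δ p : ℝ) (l : Filter ℝ) :
    iterComplexity m d N θ LF Δ p =O[l] fun e => e⁻¹ := by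
  have h1 : iterComplexity m d N θ LF Δ p =
      fun e => 8 * Δ / (p * stepSize m d N θ LF) * e⁻¹ := by
    ext e
    rw [iterComplexity, mul_assoc, mul_comm e, ← div_div, div_eq_mul_inv _ e]
  rw [h1]
  exact isBigO_const_mul_self _ _ _

lemma exists_b₂_eq (m : Method) (d : ℕ) (θ Mf β₁ β₂ : ℝ) :
    ∃ A B : ℝ, ∀ ν, b₂ m d θ Mf β₁ β₂ ν = A * ν ^ 4 + B := by
  cases m
  case cGS =>
    exact ⟨2 * Mf ^ 2 * d * (d + 2) * (1 / 9 * (d + 4) * (d + 6) + 2 * β₁ * d) / θ ^ 2,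
      2 * (d + 2) * β₂ / θ ^ 2, fun ν => by simp only [b₂]; ring⟩
  case cSS =>
    exact ⟨2 * d * Mf ^ 2 * (d / 9 + 2 * β₁) / θ ^ 2, 2 * d * β₂ / θ ^ 2,
      fun ν => by simp only [b₂]; ring⟩
  all_goals
    exact ⟨(2 + β₁) * Mf ^ 2 * d / (9 * θ ^ 2), 2 * β₂ / θ ^ 2, fun ν => by simp only [b₂]; ring⟩

/-- The fourth power of the radius is linear in `e`, so `4 b₂ / e` is a constant plus a multiple of
`1/e`. -/
lemma isBigO_evalComplexity (m : Method) (hd : 1 ≤ d) (N : ℕ) {p : ℝ} (hp : 0 < p)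
    (θ LF MF Mf β₁ β₂ Δ : ℝ) :
    evalComplexity m d N θ LF MF Mf β₁ β₂ Δ p =O[𝓝[>] 0] fun e => (e ^ 2)⁻¹ := by
  obtain ⟨A, B, hAB⟩ := exists_b₂_eq m d θ Mf β₁ β₂
  set R := radiusFactor m d N * (6 * p / (MF ^ 2 * d)) with hR
  have h1 : (fun e => 2 * N * iterComplexity m d N θ LF Δ p e) =O[𝓝[>] 0] fun e : ℝ => e⁻¹ :=
    (isBigO_iterComplexity m d N θ LF Δ p _).const_mul_left _
  have hone : (fun _ : ℝ => (1 : ℝ)) =O[𝓝[>] 0] fun e : ℝ => e⁻¹ := by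
    refine IsBigO.of_bound 1 ?_
    filter_upwards [Ioc_mem_nhdsGT (zero_lt_one' ℝ)] with e he
    rw [one_mul, norm_one, norm_inv, Real.norm_of_nonneg he.1.le]
    exact (one_le_inv₀ he.1).2 he.2
  have h2 : (fun e => b₁ m d θ β₁ + 4 * b₂ m d θ Mf β₁ β₂ (radius m d N MF e p) / e)
      =O[𝓝[>] 0] fun e : ℝ => e⁻¹ := by
    have h3 : (fun e => b₁ m d θ β₁ + 4 * b₂ m d θ Mf β₁ β₂ (radius m d N MF e p) / e)
        =ᶠ[𝓝[>] 0] fun e => (b₁ m d θ β₁ + 4 * A * R) * 1 + 4 * B * e⁻¹ := by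
      filter_upwards [self_mem_nhdsWithin] with e he
      have he' : (e : ℝ) ≠ 0 := (Set.mem_Ioi.1 he).ne'
      rw [hAB, radius_pow_four m hd (Set.mem_Ioi.1 he).le hp.le, hR]
      field_simp
      ring
    exact ((hone.const_mul_left _).add (isBigO_const_mul_self _ _ _)).congr' h3.symm
      EventuallyEq.rfl
  refine (h1.mul h2).congr_right fun e => ?_
  rw [← mul_inv, sq]

lemma b₁_le_order (m : Method) (hd : 1 ≤ d) {θ β₁ C : ℝ} (hβ₁ : 0 ≤ β₁)
    (hC : 12 * (1 + 1 / θ ^ 2) ≤ C) : b₁ m d θ β₁ ≤ C * b₁Order m d β₁ := by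
  have hd' : (1 : ℝ) ≤ d := by exact_mod_cast hd
  have hs : 0 ≤ 1 / θ ^ 2 := by positivity
  set s := 1 / θ ^ 2 with hsdef
  have key : b₁ m d θ β₁ ≤ 12 * (1 + s) * b₁Order m d β₁ := by
    have h1 : 0 ≤ s * β₁ := by positivity
    have h2 : s * β₁ ≤ s * β₁ * d := le_mul_of_one_le_right h1 hd'
    have h3 : 0 ≤ s * d := by positivity
    have h4 : 0 ≤ β₁ * d := by positivity
    cases m
    case cGS =>
      have : b₁ .cGS d θ β₁ = 1 + 4 * (d + 2) * β₁ * s := by simp only [b₁, hsdef]; ring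
      rw [this, b₁Order]
      linarith
    case cSS =>
      have : b₁ .cSS d θ β₁ = 1 + 4 * d * β₁ * s := by simp only [b₁, hsdef]; ring
      rw [this, b₁Order]
      linarith
    -- The three orthonormal methods share one formula, so the identity written for cFD unfolds to
    -- each of them.
    all_goals
      have : b₁ .cFD d θ β₁ = 1 + 4 * β₁ * s := by simp only [b₁, hsdef]; ring
      simp only [b₁] at this ⊢
      rw [this, b₁Order]
      linarith
  refine key.trans (mul_le_mul_of_nonneg_right hC ?_)
  cases m <;> simp only [b₁Order] <;> positivity

lemma b₂_le_order (m : Method) (hd : 1 ≤ d) {θ β₁ β₂ C : ℝ} (hβ₁ : 0 ≤ β₁) (hβ₂ : 0 ≤ β₂)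
    (Mf ν : ℝ) (hC : 24 * (1 / θ ^ 2) ≤ C) :
    b₂ m d θ Mf β₁ β₂ ν ≤ C * b₂Order m d Mf β₁ β₂ ν := by
  have hd' : (1 : ℝ) ≤ d := by exact_mod_cast hd
  have hs : 0 ≤ 1 / θ ^ 2 := by positivity
  set s := 1 / θ ^ 2 with hsdef
  have hY : 0 ≤ Mf ^ 2 * ν ^ 4 := by positivity
  set Y := Mf ^ 2 * ν ^ 4 with hYdef
  have key : b₂ m d θ Mf β₁ β₂ ν ≤ 24 * s * b₂Order m d Mf β₁ β₂ ν := by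
    cases m
    case cGS =>
      have h1 : b₂ .cGS d θ Mf β₁ β₂ ν = s * (2 * (d + 2) * β₂ + Y * (2 * d * (d + 2) *
          (1 / 9 * (d + 4) * (d + 6) + 2 * β₁ * d))) := by
        simp only [b₂, hsdef, hYdef]; ring
      have h2 : b₂Order .cGS d Mf β₁ β₂ ν = Y * ((β₁ + d) * d ^ 3) + d * β₂ := by
        simp only [b₂Order, hYdef]; ring
      rw [h1, h2, mul_comm 24 s, mul_assoc s 24]
      refine mul_le_mul_of_nonneg_left ?_ hs
      have h3 : 2 * d * (d + 2) * (1 / 9 * (d + 4) * (d + 6) + 2 * β₁ * d) ≤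
          24 * ((β₁ + d) * d ^ 3) := by
        -- Replacing `2, 4, 6` by `2d, 4d, 6d` gives the leading coefficient `70/3`, whence the
        -- constant `24`.
        calc 2 * d * (d + 2) * (1 / 9 * (d + 4) * (d + 6) + 2 * β₁ * d)
            ≤ 2 * d * (d + 2 * d) * (1 / 9 * (d + 4 * d) * (d + 6 * d) + 2 * β₁ * d) := by
              gcongr <;> linarith
          _ = 24 * ((β₁ + d) * d ^ 3) - (12 * β₁ * d ^ 3 + 2 / 3 * d ^ 4) := by ring
          _ ≤ _ := sub_le_self _ (by positivity)
      have h4 := mul_le_mul_of_nonneg_left h3 hY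
      have h5 : 2 * (d + 2) * β₂ ≤ 24 * d * β₂ := by gcongr ?_ * β₂; linarith
      linarith
    case cSS =>
      have h1 : b₂ .cSS d θ Mf β₁ β₂ ν = s * (2 * d * β₂ + Y * d * (2 / 9 * d + 4 * β₁)) := by
        simp only [b₂, hsdef, hYdef]; ring
      have h2 : b₂Order .cSS d Mf β₁ β₂ ν = Y * d * (β₁ + d) + d * β₂ := by
        simp only [b₂Order, hYdef]; ring
      rw [h1, h2, mul_comm 24 s, mul_assoc s 24]
      refine mul_le_mul_of_nonneg_left ?_ hs
      have h3 : 2 / 9 * d + 4 * β₁ ≤ 24 * (β₁ + d) := by linarith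
      have h4 := mul_le_mul_of_nonneg_left h3 (by positivity : 0 ≤ Y * d)
      have h5 : 0 ≤ d * β₂ := by positivity
      linarith
    all_goals
      have h1 : b₂ .cFD d θ Mf β₁ β₂ ν = s * (2 * β₂ + Y * d * ((2 + β₁) / 9)) := by
        simp only [b₂, hsdef, hYdef]; ring
      have h2 : b₂Order .cFD d Mf β₁ β₂ ν = Y * d * (1 + β₁) + β₂ := by
        simp only [b₂Order, hYdef]; ring
      simp only [b₂, b₂Order] at h1 h2 ⊢
      rw [h1, h2, mul_comm 24 s, mul_assoc s 24]
      refine mul_le_mul_of_nonneg_left ?_ hs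
      have h3 : (2 + β₁) / 9 ≤ 24 * (1 + β₁) := by linarith
      have h4 := mul_le_mul_of_nonneg_left h3 (by positivity : 0 ≤ Y * d)
      linarith
  refine key.trans (mul_le_mul_of_nonneg_right hC ?_)
  cases m <;> simp only [b₂Order] <;> positivity

lemma iterComplexity_le_order (m : Method) (hd : 1 ≤ d) (hN : 1 ≤ N) {θ LF Δ p ε C : ℝ}
    (hLF : 0 < LF) (hΔ : 0 ≤ Δ) (hp : 0 < p) (hε : 0 < ε) (hC : 144 * (1 + θ ^ 2) ≤ C) :
    iterComplexity m d N θ LF Δ p ε ≤ C * Δ * iterOrder m d N LF p ε := by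
  have hN0 : (0 : ℝ) < N := by exact_mod_cast hN
  have hd0 : (0 : ℝ) < d := by exact_mod_cast hd
  -- The factor comes from `N + 4.5 d ≤ (9/2)(N + d)`; then `144 = 32 · 9/2`.
  have h1 : LF / (ε * p) * (stepFactor m d N)⁻¹ ≤ 9 / 2 * iterOrder m d N LF p ε := by
    have h2 : 0 < LF / (ε * p) := by positivity
    cases m
    case cFD => simp only [stepFactor, iterOrder, inv_one, mul_one]; linarith
    case cRC => simp only [stepFactor, iterOrder, inv_div]; nlinarith [div_pos hd0 hN0]
    case cRS => simp only [stepFactor, iterOrder, inv_div]; nlinarith [div_pos hd0 hN0]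
    all_goals
      simp only [stepFactor, iterOrder, inv_div]
      rw [mul_left_comm]
      refine mul_le_mul_of_nonneg_left ?_ h2.le
      rw [← mul_div_assoc]
      gcongr
      linarith
  have h2 : 0 ≤ iterOrder m d N LF p ε := by
    cases m <;> simp only [iterOrder] <;> positivity
  rw [iterComplexity_eq m hd hN hLF]
  calc 32 * (1 + θ ^ 2) * Δ * (LF / (ε * p)) * (stepFactor m d N)⁻¹
      = 32 * (1 + θ ^ 2) * Δ * (LF / (ε * p) * (stepFactor m d N)⁻¹) := by ring
    _ ≤ 32 * (1 + θ ^ 2) * Δ * (9 / 2 * iterOrder m d N LF p ε) := by gcongr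
    _ = 144 * (1 + θ ^ 2) * Δ * iterOrder m d N LF p ε := by ring
    _ ≤ _ := by gcongr

/-- The numerators use `2 (N + 4.5 d) ≤ 9 (N + d)`; of the denominators only `N d + d³`,
respectively `N + d²`, is kept. -/
lemma radiusFactor_le (hd : 1 ≤ d) (N : ℕ) :
    radiusFactor .cGS d N ≤ 9 * ((N + d) / (N + d ^ 2)) / d ∧
      radiusFactor .cSS d N ≤ 9 * ((N + d) / (N + d ^ 2)) * d := by
  have hd0 : (0 : ℝ) < d := by exact_mod_cast hd
  have hN0 : (0 : ℝ) ≤ N := Nat.cast_nonneg N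
  constructor
  · rw [radiusFactor, ← mul_div_assoc, div_div]
    refine div_le_div₀ (by positivity) (by linarith) (by positivity) ?_
    have h1 : 0 ≤ (N : ℝ) * d := by positivity
    ring_nf
    nlinarith [sq_nonneg (d : ℝ)]
  · rw [radiusFactor, ← mul_div_assoc, div_mul_eq_mul_div]
    refine div_le_div₀ (by positivity) ?_ (by positivity) (by linarith)
    nlinarith [mul_nonneg hd0.le hN0, sq_nonneg (d : ℝ)]

/-- Bookkeeping with `s = 1/θ²` and `R = (Mf/MF)²`: `c₀` comes from `b₁`, `c₁` from `β₂`, and `c₂`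
from the `ν⁴` term. The constant `5184 = 24 · 9 · 24` combines the radius with the bound on `b₂`; `ε
≤ 1` absorbs `a` into `a/ε`. -/
lemma add_add_le_of_order {s R B β₁ β₂ ε p a b c₀ c₁ c₂ : ℝ} (hs : 0 ≤ s) (hR : 1 ≤ R)
    (hβ₁ : 0 ≤ β₁) (hβ₂ : 0 ≤ β₂) (hB : B = 1 + β₁ + β₂) (hε : 0 < ε) (hε1 : ε ≤ 1) (hp : 0 < p)
    (hp1 : p ≤ 1) (ha : 0 ≤ a) (hb : 0 ≤ b) (h0 : c₀ ≤ 12 * (1 + s) * (1 + β₁) * a)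
    (h1 : c₁ ≤ 24 * s * β₂ * (a / ε))
    (h2 : c₂ ≤ R * p * s * B * (5184 * b) + R * p * s * B * (24 * a)) :
    c₀ + (c₁ + c₂) ≤ 6000 * (1 + s) * B * R * (a / ε + b * p) := by
  have hB1 : 1 ≤ B := by linarith
  have ha' : a ≤ a / ε := by
    rw [le_div_iff₀ hε]; exact mul_le_of_le_one_right ha hε1
  have g0 : 12 * (1 + s) * (1 + β₁) * a ≤ 12 * (1 + s) * B * R * (a / ε) := by
    calc 12 * (1 + s) * (1 + β₁) * a = 12 * (1 + s) * (1 + β₁) * 1 * a := by ring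
      _ ≤ _ := by gcongr; linarith
  have g1 : 24 * s * β₂ * (a / ε) ≤ 24 * (1 + s) * B * R * (a / ε) := by
    calc 24 * s * β₂ * (a / ε) = 24 * s * β₂ * 1 * (a / ε) := by ring
      _ ≤ _ := by gcongr <;> linarith
  have g2 : R * p * s * B * (5184 * b) ≤ 5184 * (1 + s) * B * R * (b * p) := by
    calc R * p * s * B * (5184 * b) = 5184 * s * B * R * (b * p) := by ring
      _ ≤ _ := by gcongr; linarith
  have g3 : R * p * s * B * (24 * a) ≤ 24 * (1 + s) * B * R * (a / ε) := by
    calc R * p * s * B * (24 * a) ≤ R * 1 * (1 + s) * B * (24 * (a / ε)) := by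
          gcongr; linarith
      _ = _ := by ring
  have g4 : 0 ≤ (1 + s) * B * R * (a / ε) := by positivity
  have g5 : 0 ≤ (1 + s) * B * R * (b * p) := by positivity
  calc _ ≤ 60 * ((1 + s) * B * R * (a / ε)) + 5184 * ((1 + s) * B * R * (b * p)) := by linarith
    _ ≤ 6000 * ((1 + s) * B * R * (a / ε)) + 6000 * ((1 + s) * B * R * (b * p)) := by linarith
    _ = _ := by ring

/-- The cancellation of `ε` here keeps the finite-difference error out of the `ε⁻²` term for cGS and
cSS. -/
lemma mul_radius_pow_four_div (m : Method) (hd : 1 ≤ d) (N : ℕ) {ε p MF : ℝ} (hε : 0 < ε)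
    (hp : 0 < p) (hMF : 0 < MF) (Mf : ℝ) :
    4 * (Mf ^ 2 * radius m d N MF ε p ^ 4) / ε =
      24 * ((Mf / MF) ^ 2 * p) * (radiusFactor m d N / d) := by
  have hd0 : (0 : ℝ) < d := by exact_mod_cast hd
  rw [radius_pow_four m hd hε.le hp.le]
  field_simp
  ring

variable {θ β₁ β₂ ε p MF Mf : ℝ}

lemma size_le_order_cFD (hd : 1 ≤ d) (N : ℕ) (hβ₁ : 0 ≤ β₁) (hβ₂ : 0 ≤ β₂)
    (hε : 0 < ε) (hε1 : ε ≤ 1) (hp : 0 < p) (hp1 : p ≤ 1) (hMF : 0 < MF) (hM : MF ≤ Mf) :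
    b₁ .cFD d θ β₁ + 4 * b₂ .cFD d θ Mf β₁ β₂ (radius .cFD d N MF ε p) / ε ≤
      6000 * (1 + 1 / θ ^ 2) * (1 + β₁ + β₂) * (Mf / MF) ^ 2 * (1 / ε + 0 * p) := by
  have hd0 : (0 : ℝ) < d := by exact_mod_cast hd
  have hs : 0 ≤ 1 / θ ^ 2 := by positivity
  have h1 : b₁ .cFD d θ β₁ + 4 * b₂ .cFD d θ Mf β₁ β₂ (radius .cFD d N MF ε p) / ε =
      (1 + 4 * (1 / θ ^ 2 * β₁)) + (8 * (1 / θ ^ 2) * β₂ / ε +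
        4 * (Mf ^ 2 * radius .cFD d N MF ε p ^ 4) / ε *
          (1 / θ ^ 2 * (d * ((2 + β₁) / 9)))) := by
    simp only [b₁, b₂]
    ring
  rw [h1, mul_radius_pow_four_div .cFD hd N hε hp hMF]
  refine add_add_le_of_order hs (one_le_pow₀ ((one_le_div hMF).2 hM)) hβ₁ hβ₂ rfl hε hε1 hp hp1
    zero_le_one le_rfl ?_ ?_ ?_
  · nlinarith [mul_nonneg hs hβ₁]
  · calc 8 * (1 / θ ^ 2) * β₂ / ε ≤ 24 * (1 / θ ^ 2) * β₂ / ε := by gcongr; norm_num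
      _ = _ := by ring
  · simp only [radiusFactor]
    calc _ = (Mf / MF) ^ 2 * p * (1 / θ ^ 2) * (24 / 9 * (2 + β₁)) := by
          field_simp
      _ ≤ (Mf / MF) ^ 2 * p * (1 / θ ^ 2) * (24 * (1 + β₁ + β₂)) := by
          refine mul_le_mul_of_nonneg_left ?_ (by positivity)
          linarith
      _ = _ := by ring

lemma size_le_order_cGS (hd : 1 ≤ d) (N : ℕ) (hβ₁ : 0 ≤ β₁) (hβ₂ : 0 ≤ β₂)
    (hε : 0 < ε) (hε1 : ε ≤ 1) (hp : 0 < p) (hp1 : p ≤ 1) (hMF : 0 < MF) (hM : MF ≤ Mf) :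
    b₁ .cGS d θ β₁ + 4 * b₂ .cGS d θ Mf β₁ β₂ (radius .cGS d N MF ε p) / ε ≤
      6000 * (1 + 1 / θ ^ 2) * (1 + β₁ + β₂) * (Mf / MF) ^ 2 *
        (d / ε + (N + d) / (N + d ^ 2) * d ^ 2 * p) := by
  have hd' : (1 : ℝ) ≤ d := by exact_mod_cast hd
  have hd0 : (0 : ℝ) < d := by linarith
  have hs : 0 ≤ 1 / θ ^ 2 := by positivity
  have h1 : b₁ .cGS d θ β₁ + 4 * b₂ .cGS d θ Mf β₁ β₂ (radius .cGS d N MF ε p) / ε =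
      (1 + 4 * (d + 2) * (1 / θ ^ 2 * β₁)) + (8 * (d + 2) * (1 / θ ^ 2) * β₂ / ε +
        4 * (Mf ^ 2 * radius .cGS d N MF ε p ^ 4) / ε * (1 / θ ^ 2 * (2 * d * (d + 2) *
          (1 / 9 * (d + 4) * (d + 6) + 2 * β₁ * d)))) := by
    simp only [b₁, b₂]
    ring
  rw [h1, mul_radius_pow_four_div .cGS hd N hε hp hMF]
  refine add_add_le_of_order hs (one_le_pow₀ ((one_le_div hMF).2 hM)) hβ₁ hβ₂ rfl hε hε1 hp hp1
    hd0.le (by positivity) ?_ ?_ ?_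
  · nlinarith [mul_nonneg (mul_nonneg hs hβ₁) (sub_nonneg.2 hd'), mul_nonneg hs hd0.le,
      mul_nonneg hβ₁ hd0.le]
  · calc 8 * (d + 2) * (1 / θ ^ 2) * β₂ / ε ≤ 8 * (d + 2 * d) * (1 / θ ^ 2) * β₂ / ε := by
          gcongr; linarith
      _ = _ := by ring
  · have h2 : 2 * d * (d + 2) * (1 / 9 * (d + 4) * (d + 6) + 2 * β₁ * d) ≤
        24 * d ^ 4 * (1 + β₁ + β₂) := by
      calc 2 * d * (d + 2) * (1 / 9 * (d + 4) * (d + 6) + 2 * β₁ * d)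
          ≤ 2 * d * (d + 2 * d) * (1 / 9 * (d + 4 * d) * (d + 6 * d) + 2 * β₁ * (d * d)) := by
            gcongr <;> nlinarith
        _ = 24 * d ^ 4 * (1 + β₁ + β₂) -
              (2 / 3 * d ^ 4 + 12 * d ^ 4 * β₁ + 24 * d ^ 4 * β₂) := by ring
        _ ≤ _ := sub_le_self _ (by positivity)
    have h3 := (radiusFactor_le hd N).1
    have h4 : (0 : ℝ) < N + d ^ 2 := by positivity
    calc _ ≤ 24 * ((Mf / MF) ^ 2 * p) * (9 * ((N + d) / (N + d ^ 2)) / d / d) *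
          (1 / θ ^ 2 * (24 * d ^ 4 * (1 + β₁ + β₂))) := by gcongr
      _ = (Mf / MF) ^ 2 * p * (1 / θ ^ 2) * (1 + β₁ + β₂) *
          (5184 * ((N + d) / (N + d ^ 2) * d ^ 2)) * (d / d) * (d / d) := by ring
      _ = (Mf / MF) ^ 2 * p * (1 / θ ^ 2) * (1 + β₁ + β₂) *
          (5184 * ((N + d) / (N + d ^ 2) * d ^ 2)) := by
          rw [div_self hd0.ne', mul_one, mul_one]
      _ ≤ _ := le_add_of_nonneg_right (by positivity)

lemma size_le_order_cSS (hd : 1 ≤ d) (N : ℕ) (hβ₁ : 0 ≤ β₁) (hβ₂ : 0 ≤ β₂)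
    (hε : 0 < ε) (hε1 : ε ≤ 1) (hp : 0 < p) (hp1 : p ≤ 1) (hMF : 0 < MF) (hM : MF ≤ Mf) :
    b₁ .cSS d θ β₁ + 4 * b₂ .cSS d θ Mf β₁ β₂ (radius .cSS d N MF ε p) / ε ≤
      6000 * (1 + 1 / θ ^ 2) * (1 + β₁ + β₂) * (Mf / MF) ^ 2 *
        (d / ε + (N + d) / (N + d ^ 2) * d ^ 2 * p) := by
  have hd' : (1 : ℝ) ≤ d := by exact_mod_cast hd
  have hd0 : (0 : ℝ) < d := by linarith
  have hs : 0 ≤ 1 / θ ^ 2 := by positivity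
  have h1 : b₁ .cSS d θ β₁ + 4 * b₂ .cSS d θ Mf β₁ β₂ (radius .cSS d N MF ε p) / ε =
      (1 + 4 * d * (1 / θ ^ 2 * β₁)) + (8 * d * (1 / θ ^ 2) * β₂ / ε +
        4 * (Mf ^ 2 * radius .cSS d N MF ε p ^ 4) / ε *
          (1 / θ ^ 2 * (2 * d * (d / 9 + 2 * β₁)))) := by
    simp only [b₁, b₂]
    ring
  rw [h1, mul_radius_pow_four_div .cSS hd N hε hp hMF]
  refine add_add_le_of_order hs (one_le_pow₀ ((one_le_div hMF).2 hM)) hβ₁ hβ₂ rfl hε hε1 hp hp1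
    hd0.le (by positivity) ?_ ?_ ?_
  · nlinarith [mul_nonneg (mul_nonneg hs hβ₁) (sub_nonneg.2 hd'), mul_nonneg hs hd0.le,
      mul_nonneg hβ₁ hd0.le]
  · calc 8 * d * (1 / θ ^ 2) * β₂ / ε ≤ 24 * d * (1 / θ ^ 2) * β₂ / ε := by gcongr; norm_num
      _ = _ := by ring
  · have h2 : 2 * d * (d / 9 + 2 * β₁) ≤ 24 * d ^ 2 * (1 + β₁ + β₂) := by
      calc 2 * d * (d / 9 + 2 * β₁) ≤ 2 * d * (d / 9 + 2 * (β₁ * d)) := by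
            gcongr; exact le_mul_of_one_le_right hβ₁ hd'
        _ = 24 * d ^ 2 * (1 + β₁ + β₂) -
              (214 / 9 * d ^ 2 + 20 * d ^ 2 * β₁ + 24 * d ^ 2 * β₂) := by ring
        _ ≤ _ := sub_le_self _ (by positivity)
    have h3 := (radiusFactor_le hd N).2
    have h4 : (0 : ℝ) < N + d ^ 2 := by positivity
    calc _ ≤ 24 * ((Mf / MF) ^ 2 * p) * (9 * ((N + d) / (N + d ^ 2)) * d / d) *
          (1 / θ ^ 2 * (24 * d ^ 2 * (1 + β₁ + β₂))) := by gcongr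
      _ = (Mf / MF) ^ 2 * p * (1 / θ ^ 2) * (1 + β₁ + β₂) *
          (5184 * ((N + d) / (N + d ^ 2) * d ^ 2)) * (d / d) := by ring
      _ = (Mf / MF) ^ 2 * p * (1 / θ ^ 2) * (1 + β₁ + β₂) *
          (5184 * ((N + d) / (N + d ^ 2) * d ^ 2)) := by
          rw [div_self hd0.ne', mul_one]
      _ ≤ _ := le_add_of_nonneg_right (by positivity)

/-- One factorization for all methods: `g` measures the iteration count times `N`, and `a/ε + b p`
the sample size per iteration. For orthonormal directions `b = 0`, because the radius term is of the
order of a constant and is absorbed by `a = 1`. -/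
lemma exists_evalOrder_eq (m : Method) (hd : 1 ≤ d) (hN : 1 ≤ N) {τ : Measure (Fin N → Vec d)}
    (hτ : IsDirectionLaw m d N τ) (hβ₁ : 0 ≤ β₁) (hβ₂ : 0 ≤ β₂)
    (hε : 0 < ε) (hε1 : ε ≤ 1) (hp : 0 < p) (hp1 : p ≤ 1) (hMF : 0 < MF) (hM : MF ≤ Mf)
    (LF : ℝ) :
    ∃ a b g : ℝ, 0 ≤ a ∧ 0 ≤ b ∧ 0 ≤ g ∧ N * (stepFactor m d N)⁻¹ ≤ 9 / 2 * g ∧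
      b₁ m d θ β₁ + 4 * b₂ m d θ Mf β₁ β₂ (radius m d N MF ε p) / ε ≤
        6000 * (1 + 1 / θ ^ 2) * (1 + β₁ + β₂) * (Mf / MF) ^ 2 * (a / ε + b * p) ∧
      evalOrder m d N LF p ε = LF / (ε * p) * g * (a / ε + b * p) := by
  have hd0 : (0 : ℝ) < d := by exact_mod_cast hd
  have hN0 : (0 : ℝ) < N := by exact_mod_cast hN
  have hiso : N * (N / (N + 4.5 * d) : ℝ)⁻¹ ≤ 9 / 2 * (N + d) := by
    rw [inv_div, mul_div_cancel₀ _ hN0.ne']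
    linarith
  have hord : LF * d * (N + d) / (ε ^ 2 * p) + LF * (N + d) ^ 2 * d ^ 2 / (ε * (N + d ^ 2)) =
      LF / (ε * p) * (N + d) * (d / ε + (N + d) / (N + d ^ 2) * d ^ 2 * p) := by
    field_simp
  have horth : N * (N / d : ℝ)⁻¹ ≤ 9 / 2 * d := by
    rw [inv_div, mul_div_cancel₀ _ hN0.ne']
    linarith
  have hord' : LF * d / (ε ^ 2 * p) = LF / (ε * p) * d * (1 / ε + 0 * p) := by
    field_simp
    ring
  have hFD := size_le_order_cFD (θ := θ) hd N hβ₁ hβ₂ hε hε1 hp hp1 hMF hM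
  cases m
  case cFD =>
    refine ⟨1, 0, d, zero_le_one, le_rfl, hd0.le, ?_, hFD, hord'⟩
    have h : (N : ℝ) = d := by exact_mod_cast hτ.1
    rw [h, stepFactor, inv_one]
    linarith
  case cRC => exact ⟨1, 0, d, zero_le_one, le_rfl, hd0.le, horth, hFD, hord'⟩
  case cRS => exact ⟨1, 0, d, zero_le_one, le_rfl, hd0.le, horth, hFD, hord'⟩
  case cGS =>
    exact ⟨d, (N + d) / (N + d ^ 2) * d ^ 2, N + d, hd0.le, by positivity, by positivity, hiso,
      size_le_order_cGS hd N hβ₁ hβ₂ hε hε1 hp hp1 hMF hM, hord⟩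
  case cSS =>
    exact ⟨d, (N + d) / (N + d ^ 2) * d ^ 2, N + d, hd0.le, by positivity, by positivity, hiso,
      size_le_order_cSS hd N hβ₁ hβ₂ hε hε1 hp hp1 hMF hM, hord⟩

lemma evalComplexity_le_order (m : Method) (hd : 1 ≤ d) (hN : 1 ≤ N)
    {τ : Measure (Fin N → Vec d)} (hτ : IsDirectionLaw m d N τ) {θ β₁ β₂ ε p MF Mf LF Δ C : ℝ}
    (hβ₁ : 0 ≤ β₁) (hβ₂ : 0 ≤ β₂) (hε : 0 < ε) (hε1 : ε ≤ 1) (hp : 0 < p) (hp1 : p ≤ 1)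
    (hLF : 0 < LF) (hMF : 0 < MF) (hM : MF ≤ Mf) (hΔ : 0 ≤ Δ)
    (hC : 1728000 * (1 + θ ^ 2) * (1 + 1 / θ ^ 2) ≤ C) :
    evalComplexity m d N θ LF MF Mf β₁ β₂ Δ p ε ≤
      C * Δ * (1 + β₁ + β₂) * (Mf / MF) ^ 2 * evalOrder m d N LF p ε := by
  obtain ⟨a, b, g, ha, hb, hg, h1, h2, h3⟩ :=
    exists_evalOrder_eq (θ := θ) m hd hN hτ hβ₁ hβ₂ hε hε1 hp hp1 hMF hM LF
  set B := b₁ m d θ β₁ + 4 * b₂ m d θ Mf β₁ β₂ (radius m d N MF ε p) / ε with hB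
  have hB0 : 0 ≤ B := by
    have h2 := b₁_nonneg m d θ hβ₁
    have h3 := b₂_nonneg m d θ Mf (radius m d N MF ε p) hβ₁ hβ₂
    positivity
  rw [evalComplexity, iterComplexity_eq m hd hN hLF, h3, ← hB]
  calc 2 * N * (32 * (1 + θ ^ 2) * Δ * (LF / (ε * p)) * (stepFactor m d N)⁻¹) * B
      = 64 * (1 + θ ^ 2) * Δ * (LF / (ε * p)) * (N * (stepFactor m d N)⁻¹) * B := by ring
    -- The final constant is `64 · (9/2) · 6000 = 1728000`.
    _ ≤ 64 * (1 + θ ^ 2) * Δ * (LF / (ε * p)) * (9 / 2 * g) * (6000 * (1 + 1 / θ ^ 2) *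
        (1 + β₁ + β₂) * (Mf / MF) ^ 2 * (a / ε + b * p)) := by gcongr
    _ = 1728000 * (1 + θ ^ 2) * (1 + 1 / θ ^ 2) * Δ * (1 + β₁ + β₂) * (Mf / MF) ^ 2 *
        (LF / (ε * p) * g * (a / ε + b * p)) := by ring
    _ ≤ _ := by gcongr

end Orders

end CentralFD

end

/-! ### The complexity theorem -/

open CentralFD in
theorem theorem2 (θ : ℝ) (hθ : 0 < θ) :
    -- the constant of the order estimates depends only on `θ`
    ∃ C : ℝ, 0 < C ∧
    ∀ (m : Method) (d N : ℕ) (LF MF Lf Mf β₁ β₂ ε p : ℝ)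
      (Ξ : Type*) [MeasurableSpace Ξ] (μ : Measure Ξ) [IsProbabilityMeasure μ]
      (f : Vec d → Ξ → ℝ) (τ : Measure (Fin N → Vec d)) (x₀ : Vec d)
      (F : Vec d → ℝ) (Δ γ ν α : ℝ) (K W : ℝ → ℝ),
      1 ≤ d → 1 ≤ N → 0 < LF → 0 < MF → MF ≤ Mf → 0 ≤ β₁ → 0 ≤ β₂ → 0 < ε → 0 < p → p ≤ 1 →
      SmoothAssumption μ f Lf Mf →
      VarianceAssumption μ f β₁ β₂ →
      IsDirectionLaw m d N τ →
      F = objective μ f →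
      GradLipschitz F LF →
      HessLipschitz F MF →
      Δ = F x₀ - ⨅ y, F y →
      γ = scaling m d N →
      ν = radius m d N MF ε p →
      α = stepSize m d N θ LF →
      K = iterComplexity m d N θ LF Δ p →
      W = evalComplexity m d N θ LF MF Mf β₁ β₂ Δ p →
      -- iteration complexity and sample complexity of every run of the algorithm
      (∀ (Ω : Type*) (mΩ : MeasurableSpace Ω) (P : Measure Ω) (_ : IsProbabilityMeasure P)
          (ℱ : Filtration ℕ mΩ) (T : ℕ → Ω → Fin N → Vec d) (ζ : ℕ → Ω → ℕ → Ξ)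
          (n : ℕ → Ω → ℕ) (x : ℕ → Ω → Vec d),
          IsRun P μ τ f γ ν α x₀ ℱ T ζ n x →
          -- the sample sizes satisfy the norm condition until an accurate iterate is reached
          (∀ᵐ ω ∂P, ∀ k, NotYetAccurate F ε x k ω →
            NormCondition μ τ f γ ν θ (x k ω) (n k ω)) →
          (∀ k : ℕ, 1 ≤ k → K ε ≤ k →
            1 - p ≤ P.real {ω | ∃ i < k, ‖∇ F (x i ω)‖ ^ 2 ≤ ε}) ∧
          -- with the smallest such sample sizes
          ((∀ᵐ ω ∂P, ∀ k, NotYetAccurate F ε x k ω →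
              IsLeast {l : ℕ | 1 ≤ l ∧ NormCondition μ τ f γ ν θ (x k ω) l} (n k ω)) →
            1 - p ≤ P.real {ω | ∃ i : ℕ, (i : ℝ) ≤ K ε ∧ ‖∇ F (x i ω)‖ ^ 2 ≤ ε ∧
              ((∑ j ∈ Finset.range i, 2 * N * n j ω : ℕ) : ℝ) ≤ W ε})) ∧
      -- orders in `ε`
      (K =O[𝓝[>] 0] fun e => e⁻¹) ∧
      (W =O[𝓝[>] 0] fun e => (e ^ 2)⁻¹) ∧
      -- dependence on all the parameters
      b₁ m d θ β₁ ≤ C * b₁Order m d β₁ ∧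
      b₂ m d θ Mf β₁ β₂ ν ≤ C * b₂Order m d Mf β₁ β₂ ν ∧
      K ε ≤ C * Δ * iterOrder m d N LF p ε ∧
      (ε ≤ 1 → W ε ≤ C * Δ * (1 + β₁ + β₂) * (Mf / MF) ^ 2 * evalOrder m d N LF p ε) := by
  have ht : 0 < θ ^ 2 := by positivity
  have hs : 0 < 1 / θ ^ 2 := by positivity
  have hts : 0 < θ ^ 2 * (1 / θ ^ 2) := by positivity
  -- The constant of the evaluation bound also dominates `12 (1 + 1/θ²)`, `24/θ²` and `144 (1 +
  -- θ²)`, which the other three order estimates need.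
  refine ⟨1728000 * (1 + θ ^ 2) * (1 + 1 / θ ^ 2), by positivity, ?_⟩
  rintro m d N LF MF Lf Mf β₁ β₂ ε p Ξ _ μ _ f τ x₀ F Δ γ ν α K W hd hN hLF hMF hM hβ₁ hβ₂ hε hp hp1
    hS hV hτ rfl hL hF rfl rfl rfl rfl rfl rfl
  have hΔ0 : 0 ≤ objective μ f x₀ - ⨅ y, objective μ f y :=
    sub_nonneg.2 (ciInf_le hS.bddBelow x₀)
  refine ⟨?_, isBigO_iterComplexity .., isBigO_evalComplexity m hd N hp .., ?_, ?_, ?_, ?_⟩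
  · intro Ω mΩ P _ ℱ T ζ n x hR hn
    refine ⟨fun k hk hK => ?_, fun hn' => ?_⟩
    · refine (hR.le_prob_exists_accurate hd hN hτ hθ hLF hMF hε hp hp1 hS hV hL hF hn hk hK).trans
        (measureReal_mono fun ω hω => ?_)
      obtain ⟨i, hi, h, -⟩ := exists_le_of_not_notYetAccurate hω
      exact ⟨i, by omega, h⟩
    · exact hR.le_prob_sum_size_le hd hN hτ hθ hLF hMF hε hp hp1 hβ₁ hβ₂ hS hV hL hF hn' rfl
  · exact b₁_le_order m hd hβ₁ (by nlinarith)
  · exact b₂_le_order m hd hβ₁ hβ₂ Mf _ (by nlinarith)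
  · exact iterComplexity_le_order m hd hN hLF hΔ0 hp hε (by nlinarith)
  · exact fun hε1 => evalComplexity_le_order m hd hN hτ hβ₁ hβ₂ hε hε1 hp hp1 hLF hMF hM hΔ0 le_rfl
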